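/- Let $L$ be an even positive definite lattice of rank $l\ge 1$ with bilinear form $\langle\cdot,\cdot\rangle$ and dual lattice $L^*$, and let $G$ be a subgroup of the integral orthogonal group $\mathrm O(L)$. For $k\in\mathbb Z$ and $t\in\mathbb Z_{\ge0}$, a $G$-invariant weak Jacobi form of weight $k$ and index $t$ associated to $L$ is a holomorphic function $\varphi:\mathbb H\times(L\otimes\mathbb C)\to\mathbb C$ such that $$\varphi\Big(\frac{a\tau+b}{c\tau+d},\frac{\mathfrak z}{c\tau+d}\Big)=(c\tau+d)^k\exp\Big(t\pi i\frac{c\langle\mathfrak z,\mathfrak z\rangle}{c\tau+d}\Big)\varphi(\tau,\mathfrak z)\quad\text{for }\begin{pmatrix}a&b\\c&d\end{pmatrix}\in\mathrm{SL}_2(\mathbb Z),$$ $$\varphi(\tau,\mathfrak z+x\tau+y)=\exp\big(-t\pi i[\langle x,x\rangle\tau+2\langle x,\mathfrak z\rangle]\big)\varphi(\tau,\mathfrak z)\quad\text{for }x,y\in L,$$ such that $\varphi$ has a Fourier expansion $\varphi(\tau,\mathfrak z)=\sum_{n\ge0}\sum_{\ell\in L^*}f(n,\ell)e^{2\pi i(n\tau+\langle\ell,\mathfrak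 z\rangle)}$, and such that $\varphi(\tau,\sigma(\mathfrak z))=\varphi(\tau,\mathfrak z)$ for $\sigma\in G$. Let $J^{w,G}_{k,L,t}$ be the space of these forms (when $G$ is trivial they are called simply weak Jacobi forms), let $J^{w,G}_{*,L,*}=\bigoplus_{k\in\mathbb Z,\,t\ge0}J^{w,G}_{k,L,t}$ be the bigraded algebra of all of them, and let $M_*=\bigoplus_kM_k(\mathrm{SL}_2(\mathbb Z))$ be the ring of modular forms, over which $J^{w,G}_{*,L,*}$ is an algebra since modular forms are weak Jacobi forms of index $0$. For $1\le j\le l+1$ let $\phi_j\in J^{w,G}_{k_j,L,m_j}$. Fix linear coordinates $\mathfrak z=(z_1,\dots,z_l)$ of $L\otimes\mathbb C$ and suppose that the Jacobian $$J=J(\phi_1,\dots,\phi_{l+1})=\begin{vmatrix}m_1\phi_1&\cdots&m_{l+1}\phi_{l+1}\\ \partial\phi_1/\partial z_1&\cdots&\partial\phi_{l+1}/\partial z_1\\ \vdots&&\vdots\\ \partial\phi_1/\partial z_l&\cdots&\partial\phi_{l+1}/\partial z_l\end{vmatrix}$$ is not identically zero. Put $k_0=l+\sum_jk_j$ and $m_0=\sum_jm_j$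 (the weight and the index of $J$). For a primitive vector $r\in L$ let $\sigma_r(v)=v-\langle r^\vee,v\rangle r$ with $r^\vee=2r/\langle r,r\rangle$, and let $D_r(\tau)=\{(\tau,\mathfrak z)\in\mathbb H\times(L\otimes\mathbb C):\langle r^\vee,\mathfrak z\rangle\in\mathbb Z\tau\oplus\mathbb Z\}$. Suppose that there is a weak Jacobi form $\hat J$ of weight $\hat k_0$ and index $m_0$ associated to $L$ which vanishes precisely, and with multiplicity one, on $D_r(\tau)$ for all primitive $r\in L$ with $\sigma_r\in G$ (where $D_r=D_{-r}$ is counted once), and which has a nonzero Fourier coefficient of type $f(0,\ell)$. 1. If $k_0=\hat k_0$, then $J^{w,G}_{*,L,*}$ is freely generated by $\phi_1,\dots,\phi_{l+1}$ over $M_*$. 2. If $k_0>\hat k_0$, then $g:=J/\hat J$ belongs to $M_{k_0-\hat k_0}(\mathrm{SL}_2(\mathbb Z))$, and the following hold. (a) Suppose that $M_*[\phi_1,\dots,\phi_{l+1}]\ne J^{w,G}_{*,L,*}$, and let $M$ be the minimal index of a $G$-invariant weak Jacobi form not contained in $M_*[\phi_1,\dots,\phi_{l+1}]$. Then for every $\varphi_m\in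 J^{w,G}_{k,L,m}$ (with $k\in\mathbb Z$ and $m\ge0$ arbitrary) there is a unique polynomial $P$ over $M_*$ in $l+1$ variables such that $$g^{\max(m-M+1,\,0)}\varphi_m=P(\phi_1,\dots,\phi_{l+1}).$$ If instead $M_*[\phi_1,\dots,\phi_{l+1}]=J^{w,G}_{*,L,*}$, then every such $\varphi_m$ is itself $P(\phi_1,\dots,\phi_{l+1})$ for a unique such $P$. (b) With the meromorphic Jacobi forms $\hat\phi_j=\phi_j/g^{m_j}$, $1\le j\le l+1$, one has $$J^{w,G}_{*,L,*}\subsetneq M_*[\hat\phi_1,\dots,\hat\phi_{l+1}].$$ -/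

import Mathlib

open UpperHalfPlane Matrix
open scoped MatrixGroups DirectSum

noncomputable section

/-- An even positive definite lattice `L` of rank `l`, given by its Gram matrix with respect to a
`ℤ`-basis: `L = ℤ^l`, `L ⊗ ℂ = ℂ^l`, and `⟨x, y⟩ = xᵀ S y` where `S` is the Gram matrix. -/
structure EvenLattice (l : ℕ) where
  gram : Matrix (Fin l) (Fin l) ℤ
  symm : gram.IsSymm
  even : ∀ x : Fin l → ℤ, Even (x ⬝ᵥ gram *ᵥ x)
  posDef : ∀ x : Fin l → ℤ, x ≠ 0 → 0 < x ⬝ᵥ gram *ᵥ x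

namespace EvenLattice

variable {l : ℕ} (L : EvenLattice l)

/-- The `R`-bilinear extension of the form of `L` to `L ⊗ R = R^l`. -/
def form {R : Type} [CommRing R] (x y : Fin l → R) : R :=
  x ⬝ᵥ (L.gram.map (Int.cast : ℤ → R)) *ᵥ y

/-- The inclusion `L → L ⊗ R`, that is `ℤ^l → R^l`. -/
def incl (R : Type) [CommRing R] (x : Fin l → ℤ) : Fin l → R := fun i => (x i : R)

/-- The dual lattice `L^* = {ℓ ∈ L ⊗ ℚ : ⟨ℓ, x⟩ ∈ ℤ for all x ∈ L}`. -/
def dual : AddSubgroup (Fin l → ℚ) where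
  carrier := {v | ∀ x : Fin l → ℤ, ∃ n : ℤ, L.form v (incl ℚ x) = n}
  zero_mem' := fun x => ⟨0, by simp [form]⟩
  add_mem' := by
    intro v w hv hw x
    obtain ⟨m, hm⟩ := hv x
    obtain ⟨n, hn⟩ := hw x
    refine ⟨m + n, ?_⟩
    simp only [form] at hm hn ⊢
    rw [add_dotProduct, hm, hn]
    push_cast
    rfl
  neg_mem' := by
    intro v hv x
    obtain ⟨m, hm⟩ := hv x
    refine ⟨-m, ?_⟩
    simp only [form] at hm ⊢
    rw [neg_dotProduct, hm]
    push_cast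
    rfl

/-- An element of `L^*` as a vector of `L ⊗ ℂ`. -/
def dualIncl (v : L.dual) : Fin l → ℂ := fun i => ((v : Fin l → ℚ) i : ℂ)

/-- The integral orthogonal group `O(L)`. -/
def orthogonalGroup : Subgroup (GL (Fin l) ℤ) where
  carrier := {A | (A : Matrix (Fin l) (Fin l) ℤ)ᵀ * L.gram * (A : Matrix (Fin l) (Fin l) ℤ)
    = L.gram}
  one_mem' := by simp
  mul_mem' := by
    intro A B hA hB
    simp only [Set.mem_ofPred_eq] at hA hB ⊢
    rw [Units.val_mul, transpose_mul]
    calc _ = (B : Matrix (Fin l) (Fin l) ℤ)ᵀ *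
          ((A : Matrix (Fin l) (Fin l) ℤ)ᵀ * L.gram * (A : Matrix (Fin l) (Fin l) ℤ)) *
          (B : Matrix (Fin l) (Fin l) ℤ) := by simp only [Matrix.mul_assoc]
      _ = L.gram := by rw [hA, hB]
  inv_mem' := by
    intro A hA
    simp only [Set.mem_ofPred_eq] at hA ⊢
    have h1 : (A : Matrix (Fin l) (Fin l) ℤ) * ((A⁻¹ : GL (Fin l) ℤ) : Matrix (Fin l) (Fin l) ℤ)
        = 1 := Units.mul_inv A
    have h2 : ((A⁻¹ : GL (Fin l) ℤ) : Matrix (Fin l) (Fin l) ℤ)ᵀ *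
        (A : Matrix (Fin l) (Fin l) ℤ)ᵀ = 1 := by
      rw [← transpose_mul, h1, transpose_one]
    calc _ = ((A⁻¹ : GL (Fin l) ℤ) : Matrix (Fin l) (Fin l) ℤ)ᵀ *
          ((A : Matrix (Fin l) (Fin l) ℤ)ᵀ * L.gram * (A : Matrix (Fin l) (Fin l) ℤ)) *
          ((A⁻¹ : GL (Fin l) ℤ) : Matrix (Fin l) (Fin l) ℤ) := by rw [hA]
      _ = (((A⁻¹ : GL (Fin l) ℤ) : Matrix (Fin l) (Fin l) ℤ)ᵀ *
          (A : Matrix (Fin l) (Fin l) ℤ)ᵀ) * L.gram * ((A : Matrix (Fin l) (Fin l) ℤ) *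
          ((A⁻¹ : GL (Fin l) ℤ) : Matrix (Fin l) (Fin l) ℤ)) := by
            simp only [Matrix.mul_assoc]
      _ = L.gram := by rw [h1, h2, Matrix.one_mul, Matrix.mul_one]

/-- The `ℂ`-linear action of `O(L)` on `L ⊗ ℂ`. -/
def act (σ : L.orthogonalGroup) (z : Fin l → ℂ) : Fin l → ℂ :=
  (((σ : GL (Fin l) ℤ) : Matrix (Fin l) (Fin l) ℤ).map (Int.cast : ℤ → ℂ)) *ᵥ z

/-- The exponential `e^{2πi(nτ + ⟨ℓ, z⟩)}`. -/
def expTerm (p : ℕ × L.dual) (τ : ℍ) (z : Fin l → ℂ) : ℂ :=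
  Complex.exp (2 * Real.pi * Complex.I * (p.1 * τ + L.form (L.dualIncl p.2) z))

/-- `φ(τ, z) = ∑_{n ≥ 0} ∑_{ℓ ∈ L^*} f(n, ℓ) e^{2πi(nτ + ⟨ℓ, z⟩)}` (absolutely convergent). -/
def IsFourierExpansion (f : ℕ → L.dual → ℂ) (φ : ℍ → (Fin l → ℂ) → ℂ) : Prop :=
  ∀ (τ : ℍ) (z : Fin l → ℂ), HasSum (fun p : ℕ × L.dual => f p.1 p.2 * L.expTerm p τ z) (φ τ z)

/-- `φ` is a `G`-invariant weak Jacobi form of weight `k` and index `t` associated to `L`. -/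
structure IsWeakJacobiForm (G : Subgroup L.orthogonalGroup) (k : ℤ) (t : ℕ)
    (φ : ℍ → (Fin l → ℂ) → ℂ) : Prop where
  holomorphic : DifferentiableOn ℂ (fun p : ℂ × (Fin l → ℂ) => φ (ofComplex p.1) p.2)
    {p | 0 < p.1.im}
  modular : ∀ (γ : SL(2, ℤ)) (τ : ℍ) (z : Fin l → ℂ),
    φ (γ • τ) ((((γ 1 0 : ℤ) : ℂ) * τ + ((γ 1 1 : ℤ) : ℂ))⁻¹ • z) =
      (((γ 1 0 : ℤ) : ℂ) * τ + ((γ 1 1 : ℤ) : ℂ)) ^ k *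
      Complex.exp (t * Real.pi * Complex.I * (((γ 1 0 : ℤ) : ℂ) * L.form z z /
        (((γ 1 0 : ℤ) : ℂ) * τ + ((γ 1 1 : ℤ) : ℂ)))) * φ τ z
  elliptic : ∀ (x y : Fin l → ℤ) (τ : ℍ) (z : Fin l → ℂ),
    φ τ (z + (τ : ℂ) • incl ℂ x + incl ℂ y) =
      Complex.exp (-(t * Real.pi * Complex.I *
        (L.form (incl ℂ x) (incl ℂ x) * τ + 2 * L.form (incl ℂ x) z))) * φ τ z
  fourier : ∃ f : ℕ → L.dual → ℂ, L.IsFourierExpansion f φ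
  invariant : ∀ σ ∈ G, ∀ (τ : ℍ) (z : Fin l → ℂ), φ τ (L.act σ z) = φ τ z

/-- The vector space `J^{w,G}_{k,L,t}`. -/
def weakJacobi (G : Subgroup L.orthogonalGroup) (k : ℤ) (t : ℕ) :
    Submodule ℂ (ℍ → (Fin l → ℂ) → ℂ) where
  carrier := {φ | L.IsWeakJacobiForm G k t φ}
  zero_mem' := by
    refine ⟨?_, ?_, ?_, ⟨fun _ _ => 0, ?_⟩, ?_⟩
    · simp
    · simp
    · simp
    · intro τ z
      simp
    · simp
  add_mem' := by
    rintro φ ψ ⟨h1, h2, h3, ⟨f, hf⟩, h5⟩ ⟨g1, g2, g3, ⟨g, hg⟩, g5⟩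
    refine ⟨?_, ?_, ?_, ⟨fun n v => f n v + g n v, ?_⟩, ?_⟩
    · exact h1.add g1
    · intro γ τ z
      simp only [Pi.add_apply]
      rw [h2, g2]; ring
    · intro x y τ z
      simp only [Pi.add_apply]
      rw [h3, g3]; ring
    · intro τ z
      simpa [add_mul] using (hf τ z).add (hg τ z)
    · intro σ hσ τ z
      simp only [Pi.add_apply]
      rw [h5 σ hσ, g5 σ hσ]
  smul_mem' := by
    rintro c φ ⟨h1, h2, h3, ⟨f, hf⟩, h5⟩
    refine ⟨?_, ?_, ?_, ⟨fun n v => c * f n v, ?_⟩, ?_⟩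
    · exact h1.const_smul c
    · intro γ τ z
      simp only [Pi.smul_apply, smul_eq_mul]
      rw [h2]; ring
    · intro x y τ z
      simp only [Pi.smul_apply, smul_eq_mul]
      rw [h3]; ring
    · intro τ z
      simpa [mul_assoc] using (hf τ z).mul_left c
    · intro σ hσ τ z
      simp only [Pi.smul_apply, smul_eq_mul]
      rw [h5 σ hσ]

theorem expTerm_add (p q : ℕ × L.dual) (τ : ℍ) (z : Fin l → ℂ) :
    L.expTerm (p + q) τ z = L.expTerm p τ z * L.expTerm q τ z := by
  have h : L.dualIncl (p + q).2 = L.dualIncl p.2 + L.dualIncl q.2 := by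
    funext i; simp [dualIncl]
  unfold expTerm
  rw [← Complex.exp_add, h]
  simp only [form, add_dotProduct, Prod.fst_add, Nat.cast_add]
  ring_nf

theorem expTerm_zero (τ : ℍ) (z : Fin l → ℂ) : L.expTerm 0 τ z = 1 := by
  have h : L.dualIncl 0 = 0 := by
    funext i; simp [dualIncl]
  simp [expTerm, form, h]

theorem IsFourierExpansion.exists_mul {f g : ℕ → L.dual → ℂ} {φ ψ : ℍ → (Fin l → ℂ) → ℂ}
    (hf : L.IsFourierExpansion f φ) (hg : L.IsFourierExpansion g ψ) :
    ∃ h : ℕ → L.dual → ℂ, L.IsFourierExpansion h (φ * ψ) := by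
  refine ⟨fun n v => ∑' x : {x : (ℕ × L.dual) × (ℕ × L.dual) // x.1 + x.2 = (n, v)},
    f x.1.1.1 x.1.1.2 * g x.1.2.1 x.1.2.2, ?_⟩
  intro τ z
  have hF := hf τ z
  have hG := hg τ z
  have hs := summable_mul_of_summable_norm hF.summable.norm hG.summable.norm
  have hprod := hF.mul hG hs
  have hsig := (Equiv.sigmaFiberEquiv (fun x : (ℕ × L.dual) × (ℕ × L.dual) => x.1 + x.2)).hasSum_iff
    |>.mpr hprod
  have key := hsig.sigma (g := fun p : ℕ × L.dual =>
      (∑' x : {x : (ℕ × L.dual) × (ℕ × L.dual) // x.1 + x.2 = p},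
        f x.1.1.1 x.1.1.2 * g x.1.2.1 x.1.2.2) * L.expTerm p τ z) ?_
  · exact key
  · intro p
    have hsp := hsig.summable.sigma_factor p
    have heq : ∀ x : {x : (ℕ × L.dual) × (ℕ × L.dual) // x.1 + x.2 = p},
        (f x.1.1.1 x.1.1.2 * g x.1.2.1 x.1.2.2) * L.expTerm p τ z =
        f x.1.1.1 x.1.1.2 * L.expTerm x.1.1 τ z * (g x.1.2.1 x.1.2.2 * L.expTerm x.1.2 τ z) := by
      rintro ⟨x, rfl⟩
      rw [expTerm_add]; ring
    have hsp' : Summable (fun x : {x : (ℕ × L.dual) × (ℕ × L.dual) // x.1 + x.2 = p} =>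
        (f x.1.1.1 x.1.1.2 * g x.1.2.1 x.1.2.2) * L.expTerm p τ z) := by
      simp_rw [heq]
      exact hsp
    have hne : L.expTerm p τ z ≠ 0 := Complex.exp_ne_zero _
    have h0 := ((summable_mul_right_iff hne).mp hsp').hasSum.mul_right (L.expTerm p τ z)
    simp_rw [heq] at h0
    exact h0

/-- The components of the bigraded algebra, indexed by (weight, index). -/
def jacobiPiece (G : Subgroup L.orthogonalGroup) (i : ℤ × ℕ) :
    Submodule ℂ (ℍ → (Fin l → ℂ) → ℂ) := L.weakJacobi G i.1 i.2

theorem _root_.denomSL_ne_zero (γ : SL(2, ℤ)) (τ : ℍ) :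
    ((γ 1 0 : ℤ) : ℂ) * τ + ((γ 1 1 : ℤ) : ℂ) ≠ 0 := by
  have h := UpperHalfPlane.denom_ne_zero (γ : GL (Fin 2) ℝ) τ
  simpa [UpperHalfPlane.denom] using h

instance jacobiPiece_gradedMonoid (G : Subgroup L.orthogonalGroup) :
    SetLike.GradedMonoid (L.jacobiPiece G) where
  one_mem := by
    refine ⟨?_, ?_, ?_, ⟨fun n v => if (n, v) = 0 then 1 else 0, ?_⟩, ?_⟩
    · simp
    · simp
    · simp
    · intro τ z
      have := hasSum_ite_eq (0 : ℕ × L.dual) (1 : ℂ)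
      convert! this using 2 with p
      by_cases hp : p = 0
      · subst hp; simp [expTerm_zero]
      · simp [hp]
    · simp
  mul_mem := by
    rintro ⟨k, s⟩ ⟨m, t⟩ φ ψ ⟨h1, h2, h3, ⟨f, hf⟩, h5⟩ ⟨g1, g2, g3, ⟨g, hg⟩, g5⟩
    refine ⟨?_, ?_, ?_, hf.exists_mul L hg, ?_⟩
    · exact h1.mul g1
    · intro γ τ z
      simp only [Pi.mul_apply, Prod.mk_add_mk, Nat.cast_add]
      rw [h2, g2, zpow_add₀ (denomSL_ne_zero γ τ), add_mul, add_mul, add_mul, Complex.exp_add]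
      ring
    · intro x y τ z
      simp only [Pi.mul_apply, Prod.mk_add_mk, Nat.cast_add]
      rw [h3, g3, add_mul, add_mul, add_mul, neg_add, Complex.exp_add]
      ring
    · intro σ hσ τ z
      simp only [Pi.mul_apply]
      rw [h5 σ hσ, g5 σ hσ]

/-- The bigraded algebra `J^{w,G}_{*,L,*} = ⨁_{k ∈ ℤ, t ≥ 0} J^{w,G}_{k,L,t}`. -/
abbrev JacobiAlgebra (G : Subgroup L.orthogonalGroup) : Type := ⨁ i : ℤ × ℕ, L.jacobiPiece G i

/-- The graded ring `M_*(SL₂(ℤ)) = ⨁_k M_k(SL₂(ℤ))` of modular forms. -/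
abbrev _root_.ModularFormRing : Type := ⨁ k : ℤ, ModularForm 𝒮ℒ k

theorem modularForm_mem (G : Subgroup L.orthogonalGroup) {k : ℤ} (f : ModularForm 𝒮ℒ k) :
    (fun (τ : ℍ) (_ : Fin l → ℂ) => f τ) ∈ L.jacobiPiece G (k, 0) := by
  refine ⟨?_, ?_, ?_, ⟨fun n v => if v = 0 then (qExpansion 1 f).coeff n else 0, ?_⟩, ?_⟩
  · have h := UpperHalfPlane.mdifferentiable_iff.mp (ModularFormClass.holo f)
    exact h.comp differentiableOn_fst (fun p hp => hp)
  · intro γ τ z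
    have h := SlashInvariantForm.slash_action_eqn'' (Γ := 𝒮ℒ) f
      (γ := SpecialLinearGroup.mapGL ℝ γ) ⟨γ, rfl⟩ τ
    have h2 : UpperHalfPlane.denom (SpecialLinearGroup.mapGL ℝ γ) τ =
        ((γ 1 0 : ℤ) : ℂ) * τ + ((γ 1 1 : ℤ) : ℂ) := by
      simp [UpperHalfPlane.denom]
    rw [h2] at h
    have h3 : γ • τ = SpecialLinearGroup.mapGL ℝ γ • τ := rfl
    rw [h3]
    dsimp only
    rw [h]
    simp
  · intro x y τ z
    simp
  · intro τ z
    have h := ModularForm.hasSum_qExpansion f one_pos (by simp) τ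
    have hinj : Function.Injective (fun n : ℕ => ((n, 0) : ℕ × L.dual)) := by
      intro a b hab
      exact (Prod.ext_iff.mp hab).1
    rw [← hinj.hasSum_iff]
    · convert! h using 2 with n
      have h0 : L.dualIncl 0 = 0 := by
        funext i; simp [dualIncl]
      simp only [Function.comp_apply, if_true, expTerm, h0, form, zero_dotProduct,
        add_zero, Function.Periodic.qParam, ← Complex.exp_nat_mul]
      congr 2
      push_cast
      ring
    · rintro ⟨n, v⟩ hv
      have : v ≠ 0 := by
        rintro rfl
        exact hv ⟨n, rfl⟩
      simp [this]
  · simp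

/-- A modular form of weight `k` as a weak Jacobi form of weight `k` and index `0`. -/
def modularPiece (G : Subgroup L.orthogonalGroup) (k : ℤ) :
    ModularForm 𝒮ℒ k →+ L.JacobiAlgebra G :=
  (DirectSum.of (fun i => L.jacobiPiece G i) (k, 0)).comp
    { toFun := fun f => ⟨fun τ _ => f τ, L.modularForm_mem G f⟩
      map_zero' := by ext; rfl
      map_add' := fun f g => by ext; rfl }

/-- The homomorphism `M_*(SL₂(ℤ)) → J^{w,G}_{*,L,*}`. -/
def modularHom (G : Subgroup L.orthogonalGroup) : ModularFormRing →+* L.JacobiAlgebra G :=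
  DirectSum.toSemiring (L.modularPiece G)
    (by rfl)
    (by
      intro i j f g
      simp only [modularPiece, AddMonoidHom.comp_apply, DirectSum.of_mul_of]
      refine DirectSum.of_eq_of_gradedMonoid_eq ?_
      exact Sigma.subtype_ext rfl rfl)

instance jacobiAlgebra_algebra (G : Subgroup L.orthogonalGroup) :
    Algebra ModularFormRing (L.JacobiAlgebra G) := (L.modularHom G).toAlgebra

/-- The element of `J^{w,G}_{*,L,*}` given by a weak Jacobi form. -/
def toAlg {G : Subgroup L.orthogonalGroup} {k : ℤ} {t : ℕ} (φ : L.weakJacobi G k t) :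
    L.JacobiAlgebra G :=
  DirectSum.of (fun i => L.jacobiPiece G i) (k, t) φ

/-- The set of indices of `G`-invariant weak Jacobi forms that are not contained in the
subalgebra `A`. -/
def missingIndices {G : Subgroup L.orthogonalGroup}
    (A : Subalgebra ModularFormRing (L.JacobiAlgebra G)) : Set ℕ :=
  {t | ∃ (k : ℤ) (ψ : L.weakJacobi G k t), L.toAlg ψ ∉ A}

/-- The Jacobian of `φ_1, …, φ_{l+1}`, of indices `m_1, …, m_{l+1}`, with respect to the linear
coordinates `z_1, …, z_l` of `L ⊗ ℂ` dual to the basis `e`: the first row is `m_j φ_j`, and the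
other rows are `∂φ_j / ∂z_i`. -/
def jacobian (e : Module.Basis (Fin l) ℂ (Fin l → ℂ)) (m : Fin (l + 1) → ℕ)
    (φ : Fin (l + 1) → ℍ → (Fin l → ℂ) → ℂ) (τ : ℍ) (z : Fin l → ℂ) : ℂ :=
  Matrix.det (Matrix.of fun (i j : Fin (l + 1)) =>
    (Fin.cases ((m j : ℂ) * φ j τ z) (fun i' => lineDeriv ℂ (φ j τ) z (e i')) i : ℂ))

/-- `r` is a primitive vector of `L`. -/
def IsPrimitive (r : Fin l → ℤ) : Prop :=
  ∀ (n : ℤ) (s : Fin l → ℤ), r = n • s → IsUnit n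

/-- The pairing `⟨r^∨, z⟩` with the coroot `r^∨ = 2r / ⟨r, r⟩`. -/
def corootPairing (r : Fin l → ℤ) (z : Fin l → ℂ) : ℂ :=
  2 * L.form (incl ℂ r) z / L.form (incl ℂ r) (incl ℂ r)

/-- `r` is a primitive vector of `L` and the reflection `σ_r : v ↦ v - ⟨r^∨, v⟩ r` belongs
to `G`. -/
def IsMirrorVector (G : Subgroup L.orthogonalGroup) (r : Fin l → ℤ) : Prop :=
  IsPrimitive r ∧ ∃ σ ∈ G, ∀ v : Fin l → ℂ, L.act σ v = v - L.corootPairing r v • incl ℂ r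

/-- The set `D_r(τ) = {(τ, z) : ⟨r^∨, z⟩ ∈ ℤτ ⊕ ℤ}`, for all `τ` together. -/
def mirror (r : Fin l → ℤ) : Set (ℍ × (Fin l → ℂ)) :=
  {p | ∃ a b : ℤ, L.corootPairing r p.2 = a * (p.1 : ℂ) + b}

/-- `F` vanishes precisely, and with multiplicity one, on the sets `D_r(τ)` for all primitive
`r ∈ L` with `σ_r ∈ G`. Here `D_r = D_{-r}`, and the multiplicity along `D_r` is read off at the
points of `D_r` that lie on no other mirror: `D_r` is smooth there, and the direction `r` is
transversal to it since `⟨r^∨, r⟩ = 2`. -/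
structure VanishesSimplyOnMirrors (G : Subgroup L.orthogonalGroup)
    (F : ℍ → (Fin l → ℂ) → ℂ) : Prop where
  zero_iff : ∀ (τ : ℍ) (z : Fin l → ℂ),
    F τ z = 0 ↔ ∃ r, L.IsMirrorVector G r ∧ (τ, z) ∈ L.mirror r
  order_eq_one : ∀ (r : Fin l → ℤ) (τ : ℍ) (z : Fin l → ℂ),
    L.IsMirrorVector G r → (τ, z) ∈ L.mirror r →
    (∀ r', L.IsMirrorVector G r' → (τ, z) ∈ L.mirror r' → r' = r ∨ r' = -r) →
    analyticOrderAt (fun w : ℂ => F τ (z + w • incl ℂ r)) 0 = 1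

/-- Elements of `J^{w,G}_{*,L,*}` as functions on the open set where `g(τ) ≠ 0`. -/
def restrict (G : Subgroup L.orthogonalGroup) (g : ℍ → ℂ) :
    L.JacobiAlgebra G →+* ({p : ℍ × (Fin l → ℂ) // g p.1 ≠ 0} → ℂ) :=
  (RingHom.pi fun p : {p : ℍ × (Fin l → ℂ) // g p.1 ≠ 0} =>
    (Pi.evalRingHom (fun _ : Fin l → ℂ => ℂ) p.1.2).comp
      (Pi.evalRingHom (fun _ : ℍ => (Fin l → ℂ) → ℂ) p.1.1)).comp
    (DirectSum.coeRingHom (L.jacobiPiece G))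

/-- The algebra `J^{w,G}_{*,L,*}` as a ring of functions on the dense open set where
`g(τ) ≠ 0`. -/
def jacobiRing (G : Subgroup L.orthogonalGroup) (g : ℍ → ℂ) :
    Subring ({p : ℍ × (Fin l → ℂ) // g p.1 ≠ 0} → ℂ) :=
  RingHom.range (R := L.JacobiAlgebra G) (S := {p : ℍ × (Fin l → ℂ) // g p.1 ≠ 0} → ℂ)
    (L.restrict G g)

/-- The ring `M_*(SL₂(ℤ))[φ_j / g^{m_j} : j]` of meromorphic functions with poles at most on the
zeros of `g(τ)`, as functions on the dense open set where `g(τ) ≠ 0`. -/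
def hatRing (G : Subgroup L.orthogonalGroup) (g : ℍ → ℂ) (m : Fin (l + 1) → ℕ)
    (φ : Fin (l + 1) → ℍ → (Fin l → ℂ) → ℂ) :
    Subring ({p : ℍ × (Fin l → ℂ) // g p.1 ≠ 0} → ℂ) :=
  (MvPolynomial.eval₂Hom ((L.restrict G g).comp (algebraMap ModularFormRing (L.JacobiAlgebra G)))
    (fun j p => φ j p.1.1 p.1.2 / g p.1.1 ^ m j)).range

end EvenLattice

end

/-! Everything rests on dividing Jacobians by `JHat`. Differentiating the transformation laws shows
that the Jacobian of l+1 forms transforms like a Jacobi form: the derivative of an exponential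
factor adds to a derivative row only a multiple of the row m_j φ_j, which the determinant ignores.
An element σ of G multiplies the Jacobian by det σ, so a reflection changes its sign; on a mirror
the reflected point is also a lattice translate with trivial automorphy factor, so the Jacobian
vanishes there. Since `JHat` has simple zeros exactly on the mirrors, the quotient is holomorphic.
Since `JHat` has a nonzero q^0-term, the quotient stays bounded at i∞, hence has a Fourier expansion
without negative powers of q. The quotient has index equal to the difference of the indices. If that
is negative the quotient is zero, and if it is zero the quotient is a modular form, in particular g
= J / JHat (`IsJacobianDivisor.exists_quotient`, `IsJacobianDivisor.exists_modularForm`).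

Now let ψ be an invariant form of index t > 0. Expand the determinant of size l+2 built from ψ, φ_1,
…, φ_{l+1} whose first two rows coincide. This gives t ψ J as a signed sum of m_s φ_s J_s, where J_s
is the Jacobian of ψ and the φ_j with j ≠ s. Dividing by `JHat` yields g ψ = ∑ φ_s h_s with h_s an
invariant form of index t - m_s, or zero (`IsJacobianDivisor.exists_expansion`). All m_s are
positive, since a form of index zero would give a zero column, so induction on the index applies. If
g has weight zero it is a nonzero constant and the φ_j generate. Otherwise each step costs one
factor g, and none is needed below the index M. Writing φ_s / g = g^(m_s - 1) · φ_s / g^(m_s) gives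
the inclusion in (b). If that inclusion were an equality, the φ_j / g^(m_j) would be holomorphic,
and their Jacobian divided by `JHat` would be a modular form of weight (k₀ - kHat)(1 - m₀) < 0,
hence zero, contradicting J ≠ 0.

Uniqueness is algebraic independence. The ∂/∂z_i and the operator multiplying by the index are
derivations that kill modular forms. Applied to a relation P(φ) = 0 they show that the vector of the
(∂P/∂X_j)(φ) is annihilated by the Jacobian matrix, so these are again relations, of smaller degree.
Elements of the algebra are formal sums, and they may be treated as functions because forms of
distinct weights and indices are linearly independent (`toFunHom_injective`). -/

noncomputable section

/-! ### Holomorphic dependence of integrals on parameters. -/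

section ParametricIntegral

open MeasureTheory Metric Topology

variable {E : Type*} [NormedAddCommGroup E] [NormedSpace ℂ E]

/-- Cauchy's estimate for the Fréchet derivative. -/
theorem norm_fderiv_le_of_forall_mem_ball_norm_le {f : E → ℂ} {c : E} {r C : ℝ} (hr : 0 < r)
    (hd : DifferentiableOn ℂ f (ball c r)) (hC : ∀ x ∈ ball c r, ‖f x‖ ≤ C) :
    ‖fderiv ℂ f c‖ ≤ 2 * C / r := by
  refine Complex.norm_fderiv_le_div_of_mapsTo_ball hd (fun x hx => ?_) hr
  have h1 := hC x hx
  have h2 := hC c (mem_ball_self hr)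
  have := norm_sub_le (f x) (f c)
  rw [mem_closedBall, dist_eq_norm]
  linarith

/-- Differentiation under the integral sign. Cauchy's estimate provides both the constant that
dominates the derivatives and, applied to differences, the continuity of the derivative in the
integration variable, so nothing has to be assumed about derivatives. -/
theorem differentiableOn_setIntegral_of_isCompact [FiniteDimensional ℂ E] {X : Type*}
    [MetricSpace X] [MeasurableSpace X] [BorelSpace X] [SecondCountableTopology X]
    {K : Set X} (hK : IsCompact K) {μ : Measure X} [IsFiniteMeasureOnCompacts μ]
    {F : E → X → ℂ} {U : Set E} (hU : IsOpen U)
    (hc : ContinuousOn (fun p : E × X => F p.1 p.2) (U ×ˢ K))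
    (hd : ∀ x ∈ K, DifferentiableOn ℂ (fun e => F e x) U) :
    DifferentiableOn ℂ (fun e => ∫ x in K, F e x ∂μ) U := by
  have : ProperSpace E := FiniteDimensional.proper ℂ E
  intro x₀ hx₀
  obtain ⟨R, hR, hRU⟩ := Metric.nhds_basis_closedBall.mem_iff.1 (hU.mem_nhds hx₀)
  obtain ⟨r, hr, rfl⟩ : ∃ r, 0 < r ∧ R = 2 * r := ⟨R / 2, by linarith, by ring⟩
  have hcB : ContinuousOn (fun p : E × X => F p.1 p.2) (closedBall x₀ (2 * r) ×ˢ K) :=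
    hc.mono (Set.prod_mono hRU subset_rfl)
  obtain ⟨C, hC⟩ := ((isCompact_closedBall x₀ (2 * r)).prod hK).exists_bound_of_continuousOn hcB
  have hsub : ∀ x ∈ ball x₀ r, ball x r ⊆ closedBall x₀ (2 * r) := fun x hx y hy => by
    rw [mem_ball] at hx hy
    rw [mem_closedBall]
    linarith [dist_triangle y x x₀]
  have hmeas : ∀ x ∈ U, ContinuousOn (F x) K := fun x hx =>
    hc.comp (Continuous.prodMk continuous_const continuous_id).continuousOn
      (fun a ha => ⟨hx, ha⟩)
  have hF' : ContinuousOn (fun a => fderiv ℂ (fun e => F e a) x₀) K := by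
    have huc := ((isCompact_closedBall x₀ (2 * r)).prod hK).uniformContinuousOn_of_continuous hcB
    rw [Metric.uniformContinuousOn_iff] at huc
    rw [Metric.continuousOn_iff]
    intro b hb ε hε
    -- Cauchy's estimate on a ball of radius r turns a difference of at most ε * r / 4 into one of
    -- at most ε / 2 for the derivatives.
    obtain ⟨δ, hδ, h⟩ := huc (ε * r / 4) (by positivity)
    refine ⟨δ, hδ, fun a ha hab => ?_⟩
    have hda := fun a (ha : a ∈ K) => (hd a ha).differentiableAt (hU.mem_nhds hx₀)
    rw [dist_eq_norm, ← fderiv_fun_sub (hda a ha) (hda b hb)]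
    have := norm_fderiv_le_of_forall_mem_ball_norm_le (f := fun e => F e a - F e b) (c := x₀)
      (C := ε * r / 4) hr ?_ ?_
    · refine this.trans_lt ?_
      field_simp
      linarith
    · refine DifferentiableOn.mono ((hd a ha).sub (hd b hb)) ?_
      exact (hsub x₀ (mem_ball_self hr)).trans hRU
    · intro x hx
      have hx' := hsub x₀ (mem_ball_self hr) hx
      have := h (x, a) ⟨hx', ha⟩ (x, b) ⟨hx', hb⟩ (by
        rw [Prod.dist_eq, dist_self]
        exact max_lt hδ hab)
      rw [dist_eq_norm] at this
      exact this.le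
  refine DifferentiableAt.differentiableWithinAt
    (hasFDerivAt_integral_of_dominated_of_fderiv_le (μ := μ.restrict K)
    (F' := fun x a => fderiv ℂ (fun e => F e a) x) (bound := fun _ => 2 * C / r)
    (ball_mem_nhds x₀ hr) ?_ ?_ ?_ ?_ ?_ ?_).differentiableAt
  · filter_upwards [hU.mem_nhds hx₀] with x hx
    exact (hmeas x hx).aestronglyMeasurable_of_isCompact hK hK.measurableSet
  · exact (hmeas x₀ hx₀).integrableOn_compact hK
  · exact hF'.aestronglyMeasurable_of_isCompact hK hK.measurableSet
  · refine (ae_restrict_iff' hK.measurableSet).2 (Filter.Eventually.of_forall fun a ha x hx => ?_)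
    refine norm_fderiv_le_of_forall_mem_ball_norm_le hr
      ((hd a ha).mono ((hsub x hx).trans hRU)) fun y hy => ?_
    exact hC (y, a) ⟨hsub x hx hy, ha⟩
  · have : IsFiniteMeasure (μ.restrict K) := ⟨by
      simpa using hK.measure_lt_top⟩
    exact integrable_const _
  · refine (ae_restrict_iff' hK.measurableSet).2 (Filter.Eventually.of_forall fun a ha x hx => ?_)
    have : x ∈ U := hRU (closedBall_subset_closedBall (by linarith) (ball_subset_closedBall hx))
    exact ((hd a ha).differentiableAt (hU.mem_nhds this)).hasFDerivAt

theorem differentiableOn_circleIntegral [FiniteDimensional ℂ E] {F : E → ℂ → ℂ} {U : Set E}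
    (hU : IsOpen U) {c : ℂ} {r : ℝ} (hr : 0 ≤ r)
    (hc : ContinuousOn (fun p : E × ℂ => F p.1 p.2) (U ×ˢ sphere c r))
    (hd : ∀ w ∈ sphere c r, DifferentiableOn ℂ (fun e => F e w) U) :
    DifferentiableOn ℂ (fun e => ∮ w in C(c, r), F e w) U := by
  have h : ∀ e, (∮ w in C(c, r), F e w) =
      ∫ θ in Set.Icc 0 (2 * Real.pi), deriv (circleMap c r) θ • F e (circleMap c r θ) := by
    intro e
    rw [circleIntegral, intervalIntegral.integral_of_le (by positivity),
      integral_Icc_eq_integral_Ioc]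
  simp_rw [h]
  refine differentiableOn_setIntegral_of_isCompact isCompact_Icc hU ?_ ?_
  · simp only [deriv_circleMap]
    refine ContinuousOn.smul (Continuous.continuousOn
      (f := fun p : E × ℝ => circleMap 0 r p.2 * Complex.I) (by fun_prop)) ?_
    exact hc.comp (f := fun p : E × ℝ => (p.1, circleMap c r p.2)) (by fun_prop)
      (fun p hp => ⟨hp.1, circleMap_mem_sphere c hr p.2⟩)
  · intro θ _
    exact DifferentiableOn.const_smul (hd _ (circleMap_mem_sphere c hr θ)) (deriv (circleMap c r) θ)

end ParametricIntegral

/-! ### Restriction to complex lines and division of holomorphic functions. -/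

section Lines

open Metric Topology

variable {E : Type*} [NormedAddCommGroup E] [NormedSpace ℂ E]

theorem DifferentiableOn.comp_line {f : E → ℂ} {U : Set E} (hf : DifferentiableOn ℂ f U)
    (p v : E) : DifferentiableOn ℂ (fun w : ℂ => f (p + w • v)) {w | p + w • v ∈ U} :=
  hf.comp (f := fun w : ℂ => p + w • v) (by fun_prop) (fun _ hw => hw)

theorem isOpen_line_preimage {U : Set E} (hU : IsOpen U) (p v : E) :
    IsOpen {w : ℂ | p + w • v ∈ U} :=
  hU.preimage (by fun_prop)

/-- A nonzero holomorphic function on a convex open set is nonzero on a dense subset. -/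
theorem DifferentiableOn.frequently_ne_zero {f : E → ℂ} {U : Set E} (hf : DifferentiableOn ℂ f U)
    (hU : IsOpen U) (hconv : Convex ℝ U) {p₁ : E} (hp₁ : p₁ ∈ U) (hne : f p₁ ≠ 0) {p : E}
    (hp : p ∈ U) : ∃ᶠ x in 𝓝 p, f x ≠ 0 := by
  intro hev
  simp only [not_not] at hev
  set W : Set ℂ := {w | p + w • (p₁ - p) ∈ U} with hW
  have hWo : IsOpen W := isOpen_line_preimage hU _ _
  have hWc : Convex ℝ W := by
    intro a ha b hb s t hs ht hst
    have := hconv ha hb hs ht hst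
    simp only [hW, Set.mem_ofPred_eq]
    convert this using 1
    have h1 : (p : E) = s • p + t • p := by rw [← add_smul, hst, one_smul]
    nth_rw 1 [h1]
    simp only [smul_add, add_smul, smul_assoc]
    abel
  have han := (hf.comp_line p (p₁ - p)).analyticOnNhd hWo
  have h0 : (0 : ℂ) ∈ W := by simpa [hW] using hp
  have h1 : (1 : ℂ) ∈ W := by simpa [hW] using hp₁
  have hz := han.eqOn_zero_of_preconnected_of_eventuallyEq_zero hWc.isPreconnected h0 ?_
  · apply hne
    simpa using hz h1
  · have : Filter.Tendsto (fun w : ℂ => p + w • (p₁ - p)) (𝓝 0) (𝓝 p) := by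
      have : Continuous (fun w : ℂ => p + w • (p₁ - p)) := by fun_prop
      simpa using this.tendsto 0
    exact this.eventually hev

/-- Cauchy's formula writes the directional derivative as a circle integral whose integrand is
holomorphic in the base point. -/
theorem DifferentiableOn.lineDeriv [FiniteDimensional ℂ E] {f : E → ℂ} {U : Set E}
    (hf : DifferentiableOn ℂ f U) (hU : IsOpen U) (v : E) :
    DifferentiableOn ℂ (fun p => _root_.lineDeriv ℂ f p v) U := by
  intro p hp
  have hopen : IsOpen {x : E × ℂ | x.1 + x.2 • v ∈ U} := hU.preimage (by fun_prop)
  have hp0 : {x : E × ℂ | x.1 + x.2 • v ∈ U} ∈ 𝓝 (p, (0 : ℂ)) := hopen.mem_nhds (by simpa using hp)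
  obtain ⟨V, hV, W, hW, hVW⟩ := mem_nhds_prod_iff.1 hp0
  obtain ⟨r, hr, hrW⟩ := Metric.nhds_basis_closedBall.mem_iff.1 hW
  obtain ⟨V', hV'V, hV'o, hpV'⟩ := _root_.mem_nhds_iff.1 hV
  have hin : ∀ x ∈ V', ∀ w ∈ closedBall (0 : ℂ) r, x + w • v ∈ U := fun x hx w hw =>
    @hVW (x, w) ⟨hV'V hx, hrW hw⟩
  have heq : ∀ x ∈ V', _root_.lineDeriv ℂ f x v =
      (2 * Real.pi * Complex.I : ℂ)⁻¹ * ∮ w in C(0, r), (1 / (w - 0) ^ 2) • f (x + w • v) := by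
    intro x hx
    have hcl : DiffContOnCl ℂ (fun w : ℂ => f (x + w • v)) (ball 0 r) := by
      refine ((hf.comp_line x v).mono fun w hw => ?_).diffContOnCl
      rw [closure_ball _ hr.ne'] at hw
      exact hin x hx w hw
    have := hcl.deriv_eq_smul_circleIntegral hr
    rw [_root_.lineDeriv, this, smul_eq_mul, inv_mul_cancel_left₀]
    simp [Real.pi_ne_zero]
  have hdiff : DifferentiableOn ℂ (fun x => (2 * Real.pi * Complex.I : ℂ)⁻¹ *
      ∮ w in C(0, r), (1 / (w - 0) ^ 2) • f (x + w • v)) V' := by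
    refine (differentiableOn_circleIntegral
      (F := fun x w => (1 / (w - 0) ^ 2) • f (x + w • v)) hV'o hr.le ?_ ?_).const_mul _
    · have h1 : ContinuousOn (fun x : E × ℂ => 1 / (x.2 - 0) ^ 2) (V' ×ˢ sphere 0 r) := by
        refine continuousOn_const.div (by fun_prop) fun x hx => ?_
        have : ‖x.2‖ = r := by simpa using hx.2
        rw [sub_zero]
        exact pow_ne_zero _ (norm_pos_iff.1 (this ▸ hr))
      exact h1.smul (hf.continuousOn.comp (f := fun x : E × ℂ => x.1 + x.2 • v) (by fun_prop)
          (fun x hx => hin x.1 hx.1 x.2 (sphere_subset_closedBall hx.2)))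
    · intro w hw
      have := hf.comp (f := fun x : E => x + w • v) (by fun_prop)
        (fun x hx => hin x hx w (sphere_subset_closedBall hw))
      exact this.const_mul _
  have := (hdiff.congr heq).differentiableAt (hV'o.mem_nhds hpV')
  exact this.differentiableWithinAt

/-- Near a common zero c, both functions are (w - c) times their `dslope`; that of F is nonzero at c
because the zero is simple, and the factors w - c cancel. -/
theorem exists_differentiableOn_quotient {f F : ℂ → ℂ} {W : Set ℂ} (hW : IsOpen W)
    (hf : DifferentiableOn ℂ f W) (hF : DifferentiableOn ℂ F W)
    (h : ∀ c ∈ W, F c = 0 → f c = 0 ∧ deriv F c ≠ 0) :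
    ∃ q : ℂ → ℂ, DifferentiableOn ℂ q W ∧ ∀ w ∈ W, F w ≠ 0 → q w = f w / F w := by
  classical
  refine ⟨fun w => if F w = 0 then deriv f w / deriv F w else f w / F w, ?_, ?_⟩
  · intro c hc
    refine DifferentiableAt.differentiableWithinAt ?_
    have hWc := hW.mem_nhds hc
    by_cases hFc : F c = 0
    · obtain ⟨hfc, hFc'⟩ := h c hc hFc
      have h1 := ((Complex.differentiableOn_dslope hWc).2 hf).differentiableAt hWc
      have h2 := ((Complex.differentiableOn_dslope hWc).2 hF).differentiableAt hWc
      have h3 : dslope F c c ≠ 0 := by rwa [dslope_same]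
      refine (h1.div h2 h3).congr_of_eventuallyEq ?_
      filter_upwards [h2.continuousAt.eventually_ne h3] with w hw
      rcases eq_or_ne w c with rfl | hwc
      · simp [hFc]
      · have e1 := sub_smul_dslope f c w
        have e2 := sub_smul_dslope F c w
        rw [hfc, sub_zero, smul_eq_mul] at e1
        rw [hFc, sub_zero, smul_eq_mul] at e2
        have hwc' : w - c ≠ 0 := sub_ne_zero.2 hwc
        rw [Pi.div_apply, if_neg (by rw [← e2]; exact mul_ne_zero hwc' hw), ← e1, ← e2,
          mul_div_mul_left _ _ hwc']
    · refine (((hf.differentiableAt hWc).div (hF.differentiableAt hWc) hFc)).congr_of_eventuallyEq ?_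
      filter_upwards [(hF.differentiableAt hWc).continuousAt.eventually_ne hFc] with w hw
      simp [hw]
  · intro w _ hw
    simp [hw]

/-- Cauchy's formula for the extended quotient. The values on the circle, where F has no zero,
determine it at the centre even if F vanishes there. -/
theorem circleIntegral_quotient {f F : ℂ → ℂ} {W : Set ℂ} (hW : IsOpen W)
    (hf : DifferentiableOn ℂ f W) (hF : DifferentiableOn ℂ F W)
    (h : ∀ c ∈ W, F c = 0 → f c = 0 ∧ deriv F c ≠ 0) {r : ℝ} (hr : 0 < r)
    (hrW : closedBall 0 r ⊆ W) (hne : ∀ w ∈ sphere (0 : ℂ) r, F w ≠ 0) :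
    (2 * Real.pi * Complex.I : ℂ)⁻¹ • (∮ w in C(0, r), (w - 0)⁻¹ • (f w / F w)) * F 0 = f 0 := by
  obtain ⟨q, hq, hqe⟩ := exists_differentiableOn_quotient hW hf hF h
  have hqcl : DiffContOnCl ℂ q (ball 0 r) := by
    refine (hq.mono ?_).diffContOnCl
    rwa [closure_ball _ hr.ne']
  have hcauchy := hqcl.two_pi_i_inv_smul_circleIntegral_sub_inv_smul (mem_ball_self hr)
  have hcongr : (∮ w in C(0, r), (w - 0)⁻¹ • (f w / F w)) = ∮ w in C(0, r), (w - 0)⁻¹ • q w := by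
    refine circleIntegral.integral_congr hr.le fun w hw => ?_
    rw [hqe w (hrW (sphere_subset_closedBall hw)) (hne w hw)]
  rw [hcongr, hcauchy]
  have h0 : (0 : ℂ) ∈ W := hrW (mem_closedBall_self hr.le)
  by_cases hF0 : F 0 = 0
  · rw [hF0, mul_zero, (h 0 h0 hF0).1]
  · rw [hqe 0 h0 hF0, div_mul_cancel₀ _ hF0]

/-- If `f` vanishes at the zeros of `F` on almost all lines in the direction `v`, and these zeros
are simple, then `f / F` is holomorphic. -/
theorem exists_local_quotient [FiniteDimensional ℂ E] {f F : E → ℂ} {U : Set E} (hU : IsOpen U)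
    (hf : DifferentiableOn ℂ f U) (hF : DifferentiableOn ℂ F U) {p v : E} (hp : p ∈ U)
    (hFp : ¬ ∀ᶠ w : ℂ in 𝓝 0, F (p + w • v) = 0)
    (hD : ∀ V ⊆ U, IsOpen V → V.Nonempty → ∃ x ∈ V, ∀ w : ℂ, x + w • v ∈ U →
      F (x + w • v) = 0 → f (x + w • v) = 0 ∧ deriv (fun s : ℂ => F (x + s • v)) w ≠ 0) :
    ∃ V ∈ 𝓝 p, ∃ h : E → ℂ, DifferentiableOn ℂ h V ∧ ∀ x ∈ V, h x * F x = f x := by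
  have hWo : IsOpen {w : ℂ | p + w • v ∈ U} := isOpen_line_preimage hU p v
  have h0 : (0 : ℂ) ∈ {w : ℂ | p + w • v ∈ U} := by simpa using hp
  have han := (hF.comp_line p v).analyticOnNhd hWo 0 h0
  have hev := han.eventually_eq_zero_or_eventually_ne_zero.resolve_left hFp
  rw [eventually_nhdsWithin_iff] at hev
  obtain ⟨r, hr, hrs⟩ := Metric.nhds_basis_closedBall.mem_iff.1 (hev.and (hWo.mem_nhds h0))
  have hO1 : IsOpen {x : E × ℂ | x.1 + x.2 • v ∈ U} := hU.preimage (by fun_prop)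
  have hO2 : IsOpen {x : E × ℂ | x.1 + x.2 • v ∈ U ∩ F ⁻¹' {0}ᶜ} :=
    (hF.continuousOn.isOpen_inter_preimage hU isOpen_compl_singleton).preimage (by fun_prop)
  obtain ⟨V1, T1, hV1, -, hpV1, hT1, hVT1⟩ := generalized_tube_lemma
    (isCompact_singleton (x := p)) (isCompact_closedBall (0 : ℂ) r) hO1 (by
      rintro ⟨x, w⟩ ⟨rfl, hw⟩
      exact (hrs hw).2)
  obtain ⟨V2, T2, hV2, -, hpV2, hT2, hVT2⟩ := generalized_tube_lemma
    (isCompact_singleton (x := p)) (isCompact_sphere (0 : ℂ) r) hO2 (by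
      rintro ⟨x, w⟩ ⟨rfl, hw⟩
      have hw' := hrs (sphere_subset_closedBall hw)
      refine ⟨hw'.2, hw'.1 ?_⟩
      rintro rfl
      simp at hw
      exact hr.ne hw)
  have hVo : IsOpen (V1 ∩ V2) := hV1.inter hV2
  have hpV : p ∈ V1 ∩ V2 := ⟨hpV1 rfl, hpV2 rfl⟩
  have hin : ∀ x ∈ V1 ∩ V2, ∀ w ∈ closedBall (0 : ℂ) r, x + w • v ∈ U := fun x hx w hw =>
    @hVT1 (x, w) ⟨hx.1, hT1 hw⟩
  have hne : ∀ x ∈ V1 ∩ V2, ∀ w ∈ sphere (0 : ℂ) r, F (x + w • v) ≠ 0 := fun x hx w hw =>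
    (@hVT2 (x, w) ⟨hx.2, hT2 hw⟩).2
  have hVU : V1 ∩ V2 ⊆ U := fun x hx => by
    simpa using hin x hx 0 (mem_closedBall_self hr.le)
  -- The quotient is defined by its Cauchy integral over a circle in the direction v that avoids the
  -- zeros of F, uniformly near p. This is holomorphic before anything is known about the zeros of F
  -- inside.
  set h : E → ℂ := fun x => (2 * Real.pi * Complex.I : ℂ)⁻¹ •
    ∮ w in C(0, r), (w - 0)⁻¹ • (f (x + w • v) / F (x + w • v)) with hh
  have hdiff : DifferentiableOn ℂ h (V1 ∩ V2) := by
    refine (differentiableOn_circleIntegral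
      (F := fun x w => (w - 0)⁻¹ • (f (x + w • v) / F (x + w • v))) hVo hr.le ?_ ?_).const_mul
      (2 * Real.pi * Complex.I)⁻¹
    · have h1 : ContinuousOn (fun x : E × ℂ => (x.2 - 0)⁻¹) ((V1 ∩ V2) ×ˢ sphere 0 r) := by
        refine ContinuousOn.inv₀ (by fun_prop) fun x hx => ?_
        have : ‖x.2‖ = r := by simpa using hx.2
        rw [sub_zero, ← norm_pos_iff, this]
        exact hr
      refine h1.smul (ContinuousOn.div ?_ ?_ fun x hx => hne x.1 hx.1 x.2 hx.2)
      · exact hf.continuousOn.comp (f := fun x : E × ℂ => x.1 + x.2 • v) (by fun_prop)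
          (fun x hx => hin x.1 hx.1 x.2 (sphere_subset_closedBall hx.2))
      · exact hF.continuousOn.comp (f := fun x : E × ℂ => x.1 + x.2 • v) (by fun_prop)
          (fun x hx => hin x.1 hx.1 x.2 (sphere_subset_closedBall hx.2))
    · intro w hw
      have h1 := hf.comp (f := fun x : E => x + w • v) (by fun_prop)
        (fun x hx => hin x hx w (sphere_subset_closedBall hw))
      have h2 := hF.comp (f := fun x : E => x + w • v) (by fun_prop)
        (fun x hx => hin x hx w (sphere_subset_closedBall hw))
      simp only [div_eq_mul_inv]
      exact (h1.mul (h2.inv fun x hx => hne x hx w hw)).const_mul _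
  refine ⟨V1 ∩ V2, hVo.mem_nhds hpV, h, hdiff, ?_⟩
  intro x hx
  -- Failure of the identity would persist on an open set by continuity, and such a set meets a line
  -- on which the one-variable division applies.
  by_contra hxne
  have hc1 : ContinuousAt (fun y => h y * F y) x :=
    ((hdiff.differentiableAt (hVo.mem_nhds hx)).continuousAt).mul
      (hF.differentiableAt (hU.mem_nhds (hVU hx))).continuousAt
  have hc2 : ContinuousAt f x := (hf.differentiableAt (hU.mem_nhds (hVU hx))).continuousAt
  obtain ⟨O, hOs, hO, hxO⟩ := _root_.mem_nhds_iff.1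
    (((hc1.ne_iff_eventually_ne hc2).1 hxne).and (hVo.mem_nhds hx))
  obtain ⟨y, hyO, hy⟩ := hD O (fun y hy => hVU (hOs hy).2) hO ⟨x, hxO⟩
  obtain ⟨hy1, hyV⟩ := hOs hyO
  apply hy1
  have := circleIntegral_quotient (isOpen_line_preimage hU y v) (hf.comp_line y v)
    (hF.comp_line y v) hy hr (hin y hyV) (hne y hyV)
  simpa only [zero_smul, add_zero] using this

/-- Two local quotients agree where F is nonzero, which is a dense set, so they agree on overlaps
and glue. -/
theorem exists_quotient_of_forall_exists_local {f F : E → ℂ} {U : Set E} (hU : IsOpen U)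
    (hconv : Convex ℝ U) (hF : DifferentiableOn ℂ F U) {p₁ : E} (hp₁ : p₁ ∈ U) (hne : F p₁ ≠ 0)
    (hloc : ∀ p ∈ U, ∃ V ∈ 𝓝 p, ∃ h : E → ℂ, DifferentiableOn ℂ h V ∧ ∀ x ∈ V, h x * F x = f x) :
    ∃ h : E → ℂ, DifferentiableOn ℂ h U ∧ ∀ x ∈ U, h x * F x = f x := by
  choose! V hV h hd hmul using hloc
  refine ⟨fun p => h p p, fun p hp => ?_, fun p hp => hmul p hp p (mem_of_mem_nhds (hV p hp))⟩
  refine DifferentiableAt.differentiableWithinAt ?_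
  refine ((hd p hp).differentiableAt (hV p hp)).congr_of_eventuallyEq ?_
  filter_upwards [eventually_mem_nhds_iff.2 (hV p hp), hU.mem_nhds hp] with x hx hxU
  by_contra hxne
  have hc1 := ((hd x hxU).differentiableAt (hV x hxU)).continuousAt
  have hc2 := ((hd p hp).differentiableAt hx).continuousAt
  obtain ⟨y, hy1, hy2, hy3, hy4⟩ := ((hF.frequently_ne_zero hU hconv hp₁ hne hxU).and_eventually
    (((hc1.ne_iff_eventually_ne hc2).1 hxne).and (Filter.Eventually.and (p := fun y => y ∈ V x) (q := fun y => y ∈ V p) (hV x hxU) hx))).exists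
  exact hy2 (mul_right_cancel₀ hy1 ((hmul x hxU y hy3).trans (hmul p hp y hy4).symm))

end Lines

end

noncomputable section

/-! ### Fourier series of periodic holomorphic functions on tubes. -/

section TorusFourier

set_option linter.unusedSectionVars false

open MeasureTheory Metric Topology

attribute [local instance] instMeasureSpaceUnitAddCircle

variable {d : Type*} [Fintype d]

/-- The character `w ↦ e^{2πi N·w}` of `ℂ^d`. -/
def torusExp (N : d → ℤ) (w : d → ℂ) : ℂ :=
  Complex.exp (2 * Real.pi * Complex.I * ∑ i, (N i : ℂ) * w i)

theorem torusExp_add (N : d → ℤ) (v w : d → ℂ) :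
    torusExp N (v + w) = torusExp N v * torusExp N w := by
  simp only [torusExp, ← Complex.exp_add, Pi.add_apply, mul_add, Finset.sum_add_distrib]

theorem torusExp_ne_zero (N : d → ℤ) (w : d → ℂ) : torusExp N w ≠ 0 := Complex.exp_ne_zero _

theorem torusExp_neg (N : d → ℤ) (w : d → ℂ) : torusExp (-N) w = (torusExp N w)⁻¹ := by
  simp [torusExp, ← Complex.exp_neg]

theorem torusExp_int (N k : d → ℤ) : torusExp N (fun i => (k i : ℂ)) = 1 := by
  rw [torusExp, Complex.exp_eq_one_iff]
  exact ⟨∑ i, N i * k i, by push_cast; ring⟩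

theorem norm_torusExp (N : d → ℤ) (w : d → ℂ) :
    ‖torusExp N w‖ = Real.exp (-2 * Real.pi * ∑ i, (N i : ℝ) * (w i).im) := by
  rw [torusExp, Complex.norm_exp]
  congr 1
  have : (2 * Real.pi * Complex.I * ∑ i, (N i : ℂ) * w i) =
      ((2 * Real.pi : ℝ) : ℂ) * ((∑ i, (N i : ℂ) * w i) * Complex.I) := by push_cast; ring
  rw [this, Complex.re_ofReal_mul, Complex.mul_I_re, Complex.im_sum]
  simp

theorem differentiable_torusExp (N : d → ℤ) : Differentiable ℂ (torusExp N) := by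
  unfold torusExp
  fun_prop

theorem mFourier_coe (N : d → ℤ) (x : d → ℝ) :
    UnitAddTorus.mFourier N (fun i => (x i : UnitAddCircle)) =
      torusExp N (fun i => (x i : ℂ)) := by
  simp only [UnitAddTorus.mFourier, ContinuousMap.coe_mk, fourier_coe_apply, torusExp,
    ← Complex.exp_sum, Finset.mul_sum]
  congr 1
  refine Finset.sum_congr rfl fun i _ => ?_
  push_cast
  ring

theorem isOpenQuotientMap_torusMk :
    IsOpenQuotientMap (fun (x : d → ℝ) (i : d) => (x i : UnitAddCircle)) :=
  IsOpenQuotientMap.piMap fun _ => QuotientAddGroup.isOpenQuotientMap_mk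

theorem exists_torus_lift {α : Type*} {f : (d → ℝ) → α}
    (hf : ∀ (x : d → ℝ) (k : d → ℤ), f (x + fun i => (k i : ℝ)) = f x) :
    ∃ F : UnitAddTorus d → α, ∀ x : d → ℝ, F (fun i => (x i : UnitAddCircle)) = f x := by
  refine ⟨fun θ => f (Function.surjInv isOpenQuotientMap_torusMk.surjective θ), fun x => ?_⟩
  set y := Function.surjInv (isOpenQuotientMap_torusMk (d := d)).surjective
    (fun i => (x i : UnitAddCircle)) with hy
  have h := Function.surjInv_eq (isOpenQuotientMap_torusMk (d := d)).surjective
    (fun i => (x i : UnitAddCircle))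
  have h' : ∀ i, ∃ k : ℤ, y i = x i + k := fun i => by
    have h1 : ((y i - x i : ℝ) : UnitAddCircle) = 0 := by
      rw [AddCircle.coe_sub, sub_eq_zero]
      exact congrFun h i
    obtain ⟨k, hk⟩ := AddCircle.coe_eq_zero_iff (p := (1 : ℝ)) |>.1 h1
    exact ⟨k, by rw [zsmul_one] at hk; linarith⟩
  choose k hk using h'
  have : y = x + fun i => (k i : ℝ) := funext hk
  change f y = f x
  rw [this, hf]

/-- The half-open unit cube with corner `a`. -/
def unitBox (a : d → ℝ) : Set (d → ℝ) := {x | ∀ i, x i ∈ Set.Ioc (a i) (a i + 1)}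

theorem unitBox_ae_eq (a : d → ℝ) :
    unitBox a =ᵐ[volume] Set.Icc a (a + 1) := by
  have : unitBox a = Set.univ.pi fun i => Set.Ioc (a i) ((a + 1) i) := by
    ext x; simp [unitBox]
  rw [this]
  exact Measure.univ_pi_Ioc_ae_eq_Icc

theorem measurableSet_unitBox (a : d → ℝ) : MeasurableSet (unitBox a) :=
  MeasurableSet.univ_pi' fun _ => measurableSet_Ioc

theorem volume_unitBox (a : d → ℝ) : volume (unitBox a) = 1 := by
  have : unitBox a = Set.univ.pi fun i => Set.Ioc (a i) (a i + 1) := by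
    ext x; simp [unitBox]
  rw [this, Real.volume_pi_Ioc]
  simp

/-- Both sides are the integral over the torus of the induced function, read off on two fundamental
cubes. -/
theorem setIntegral_unitBox_shift {f : (d → ℝ) → ℂ}
    (hf : ∀ (x : d → ℝ) (k : d → ℤ), f (x + fun i => (k i : ℝ)) = f x) (s : d → ℝ) :
    ∫ x in unitBox 0, f (x + s) = ∫ x in unitBox 0, f x := by
  obtain ⟨F, hF⟩ := exists_torus_lift hf
  have h := (UnitAddTorus.integral_preimage F 0).symm.trans (UnitAddTorus.integral_preimage F s)
  simp only [hF] at h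
  change ∫ x in unitBox 0, f x = ∫ x in unitBox s, f x at h
  rw [h, ← integral_indicator (measurableSet_unitBox _),
    ← integral_indicator (measurableSet_unitBox _),
    ← integral_add_right_eq_self ((unitBox s).indicator f) s]
  refine integral_congr_ae (Filter.Eventually.of_forall fun x => ?_)
  dsimp only
  have : x ∈ unitBox (0 : d → ℝ) ↔ x + s ∈ unitBox s := by
    simp only [unitBox, Set.mem_ofPred_eq, Set.mem_Ioc, Pi.add_apply, Pi.zero_apply]
    refine forall_congr' fun i => ?_
    constructor <;> rintro ⟨h1, h2⟩ <;> constructor <;> linarith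
  by_cases hx : x ∈ unitBox (0 : d → ℝ)
  · rw [Set.indicator_of_mem hx, Set.indicator_of_mem (this.1 hx)]
  · rw [Set.indicator_of_notMem hx, Set.indicator_of_notMem (mt this.2 hx)]

/-- The tube over `B`. -/
def tube (B : Set (d → ℝ)) : Set (d → ℂ) := {w | (fun i => (w i).im) ∈ B}

theorem isOpen_tube {B : Set (d → ℝ)} (hB : IsOpen B) : IsOpen (tube B) :=
  hB.preimage (continuous_pi fun i => Complex.continuous_im.comp (continuous_apply i))

theorem convex_tube {B : Set (d → ℝ)} (hB : Convex ℝ B) : Convex ℝ (tube B) := by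
  intro a ha b hb s t hs ht hst
  have := hB ha hb hs ht hst
  simp only [tube, Set.mem_ofPred_eq]
  convert this using 1
  ext i
  simp

/-- The integral of `H(w) e^{-2πi N·w}` over a real unit cube. -/
def tubeCoeff (H : (d → ℂ) → ℂ) (N : d → ℤ) (w : d → ℂ) : ℂ :=
  ∫ x in unitBox (0 : d → ℝ),
    H ((fun i => (x i : ℂ)) + w) * torusExp (-N) ((fun i => (x i : ℂ)) + w)

variable {H : (d → ℂ) → ℂ} {B : Set (d → ℝ)}

theorem ofReal_add_mem_tube {w : d → ℂ} (hw : w ∈ tube B) (x : d → ℝ) :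
    (fun i => (x i : ℂ)) + w ∈ tube B := by
  simpa [tube] using hw

theorem differentiableOn_tubeCoeff (hB : IsOpen B) (hH : DifferentiableOn ℂ H (tube B))
    (N : d → ℤ) : DifferentiableOn ℂ (tubeCoeff H N) (tube B) := by
  have h : tubeCoeff H N = fun w => ∫ x in Set.Icc (0 : d → ℝ) (0 + 1),
      H ((fun i => (x i : ℂ)) + w) * torusExp (-N) ((fun i => (x i : ℂ)) + w) := by
    funext w
    exact setIntegral_congr_set (unitBox_ae_eq 0)
  have hd : DifferentiableOn ℂ (fun w => H w * torusExp (-N) w) (tube B) :=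
    hH.mul (differentiable_torusExp _).differentiableOn
  rw [h]
  refine differentiableOn_setIntegral_of_isCompact isCompact_Icc (isOpen_tube hB) ?_ ?_
  · exact hd.continuousOn.comp (f := fun p : (d → ℂ) × (d → ℝ) => (fun i => (p.2 i : ℂ)) + p.1)
      (by fun_prop) (fun p hp => ofReal_add_mem_tube hp.1 _)
  · intro x _
    exact hd.comp (f := fun w : d → ℂ => (fun i => (x i : ℂ)) + w) (by fun_prop)
      (fun w hw => ofReal_add_mem_tube hw _)

theorem tubeCoeff_add_ofReal
    (hper : ∀ w ∈ tube B, ∀ k : d → ℤ, H (w + fun i => (k i : ℂ)) = H w) (N : d → ℤ) {w : d → ℂ}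
    (hw : w ∈ tube B) (s : d → ℝ) :
    tubeCoeff H N (w + fun i => (s i : ℂ)) = tubeCoeff H N w := by
  have := setIntegral_unitBox_shift (f := fun x : d → ℝ =>
    H ((fun i => (x i : ℂ)) + w) * torusExp (-N) ((fun i => (x i : ℂ)) + w)) ?_ s
  · simp only [tubeCoeff]
    rw [← this]
    have : ∀ x : d → ℝ, (fun i => (x i : ℂ)) + (w + fun i => (s i : ℂ)) =
        (fun i => ((x + s) i : ℂ)) + w := fun x => by
      ext i; simp; ring
    simp_rw [this]
  · intro x k
    have : (fun i => ((x + fun i => (k i : ℝ)) i : ℂ)) + w =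
        ((fun i => (x i : ℂ)) + w) + fun i => (k i : ℂ) := by
      ext i; simp; ring
    simp only [this]
    rw [hper _ (ofReal_add_mem_tube hw x), torusExp_add _ _ (fun i => (k i : ℂ)), torusExp_int,
      mul_one]

/-- The Fourier coefficient does not depend on the base point. It is holomorphic and invariant under
real translations, so its ℂ-linear derivative kills real vectors, hence all vectors. This replaces a
shift of contours in several variables. -/
theorem tubeCoeff_eq (hB : IsOpen B) (hBc : Convex ℝ B) (hH : DifferentiableOn ℂ H (tube B))
    (hper : ∀ w ∈ tube B, ∀ k : d → ℤ, H (w + fun i => (k i : ℂ)) = H w) (N : d → ℤ)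
    {v w : d → ℂ} (hv : v ∈ tube B) (hw : w ∈ tube B) : tubeCoeff H N v = tubeCoeff H N w := by
  have hd := differentiableOn_tubeCoeff hB hH N
  refine (isOpen_tube hB).is_const_of_fderiv_eq_zero (𝕜 := ℂ) (convex_tube hBc).isPreconnected
    hd ?_ hv hw
  intro u hu
  have hreal : ∀ s : d → ℝ, fderiv ℂ (tubeCoeff H N) u (fun i => (s i : ℂ)) = 0 := by
    intro s
    have h1 := (hd.differentiableAt ((isOpen_tube hB).mem_nhds hu)).hasFDerivAt
    have h2 : HasDerivAt (fun t : ℝ => tubeCoeff H N (u + t • fun i => (s i : ℂ)))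
        (fderiv ℂ (tubeCoeff H N) u (fun i => (s i : ℂ))) 0 := by
      have h3 : HasDerivAt (fun t : ℝ => u + t • fun i => (s i : ℂ)) (fun i => (s i : ℂ)) 0 := by
        simpa using ((hasDerivAt_id (0 : ℝ)).smul_const (fun i => (s i : ℂ))).const_add u
      refine HasFDerivAt.comp_hasDerivAt (x := (0 : ℝ)) (f := fun t : ℝ => u + t • fun i => (s i : ℂ))
        (l := tubeCoeff H N) (l' := (fderiv ℂ (tubeCoeff H N) u).restrictScalars ℝ) ?_ h3
      simpa using h1.restrictScalars ℝ
    have h4 : (fun t : ℝ => tubeCoeff H N (u + t • fun i => (s i : ℂ))) =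
        fun _ => tubeCoeff H N u := by
      funext t
      rw [← tubeCoeff_add_ofReal hper N hu (t • s)]
      congr 2
      ext i
      simp
    rw [h4] at h2
    exact h2.unique (hasDerivAt_const _ _)
  ext v
  have hv : v = (fun i => ((v i).re : ℂ)) + Complex.I • fun i => ((v i).im : ℂ) := by
    ext i
    simp only [Pi.add_apply, Pi.smul_apply, smul_eq_mul]
    rw [mul_comm, Complex.re_add_im]
  rw [hv, map_add, map_smul, hreal (fun i => (v i).re), hreal (fun i => (v i).im)]
  simp

theorem norm_tubeCoeff_le (N : d → ℤ) {w : d → ℂ} {C : ℝ}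
    (hC : ∀ x : d → ℝ, ‖H ((fun i => (x i : ℂ)) + w)‖ ≤ C) :
    ‖tubeCoeff H N w‖ ≤ C * Real.exp (2 * Real.pi * ∑ i, (N i : ℝ) * (w i).im) := by
  have := norm_setIntegral_le_of_norm_le_const (μ := volume) (s := unitBox (0 : d → ℝ))
    (f := fun x : d → ℝ =>
      H ((fun i => (x i : ℂ)) + w) * torusExp (-N) ((fun i => (x i : ℂ)) + w))
    (C := C * Real.exp (2 * Real.pi * ∑ i, (N i : ℝ) * (w i).im)) ?_ ?_
  · rwa [Measure.real, volume_unitBox, ENNReal.toReal_one, mul_one] at this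
  · rw [volume_unitBox]; exact ENNReal.one_lt_top
  · intro x _
    rw [norm_mul, norm_torusExp]
    refine mul_le_mul (hC x) (le_of_eq ?_) (Real.exp_pos _).le ((norm_nonneg _).trans (hC x))
    simp

theorem summable_prod_fin {g : ℤ → ℝ} (hg : Summable g) (h0 : ∀ n, 0 ≤ g n) (n : ℕ) :
    Summable (fun N : Fin n → ℤ => ∏ i, g (N i)) := by
  induction n with
  | zero => exact (hasSum_fintype _).summable
  | succ n ih =>
    rw [← (Fin.consEquiv fun _ : Fin (n + 1) => ℤ).summable_iff]
    have := hg.mul_of_nonneg ih h0 (fun N => Finset.prod_nonneg fun i _ => h0 _)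
    refine this.congr fun p => ?_
    simp [Fin.consEquiv, Fin.prod_univ_succ]

theorem summable_exp_neg_abs {δ : ℝ} (hδ : 0 < δ) : Summable fun n : ℤ => Real.exp (-δ * |(n : ℝ)|) := by
  have h : Summable fun n : ℕ => Real.exp (-δ * n) := by
    have := summable_geometric_of_lt_one (Real.exp_pos (-δ)).le (by simpa using hδ)
    refine this.congr fun n => ?_
    rw [← Real.exp_nat_mul, mul_comm]
  refine Summable.of_nat_of_neg ?_ ?_ <;> simpa using h

theorem mFourierCoeff_lift {F : UnitAddTorus d → ℂ} {w : d → ℂ}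
    (hF : ∀ x : d → ℝ, F (fun i => (x i : UnitAddCircle)) = H ((fun i => (x i : ℂ)) + w))
    (N : d → ℤ) : UnitAddTorus.mFourierCoeff F N = tubeCoeff H N w * torusExp N w := by
  rw [UnitAddTorus.mFourierCoeff_eq_integral F N 0]
  change ∫ x in unitBox 0, _ = _
  rw [tubeCoeff, ← integral_mul_const]
  refine setIntegral_congr_fun (measurableSet_unitBox 0) fun x _ => ?_
  rw [hF, mFourier_coe, torusExp_add, smul_eq_mul, torusExp_neg N w]
  field_simp [torusExp_ne_zero]

/-- Periodicity moves the real parts into the unit cube, which leaves a compact set. -/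
theorem exists_bound_tube (hH : ContinuousOn H (tube B))
    (hper : ∀ w ∈ tube B, ∀ k : d → ℤ, H (w + fun i => (k i : ℂ)) = H w) {T : Set (d → ℝ)}
    (hT : IsCompact T) (hTB : T ⊆ B) : ∃ C : ℝ, ∀ w ∈ tube T, ‖H w‖ ≤ C := by
  have hc : ContinuousOn (fun p : (d → ℝ) × (d → ℝ) =>
      H (fun i => (p.1 i : ℂ) + p.2 i * Complex.I)) (Set.Icc 0 1 ×ˢ T) := by
    refine hH.comp (f := fun p : (d → ℝ) × (d → ℝ) => fun i => (p.1 i : ℂ) + p.2 i * Complex.I)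
      (by fun_prop) ?_
    rintro ⟨x, y⟩ ⟨_, hy⟩
    simpa [tube] using hTB hy
  obtain ⟨C, hC⟩ := (isCompact_Icc.prod hT).exists_bound_of_continuousOn hc
  refine ⟨C, fun w hw => ?_⟩
  have hfr := hC (fun i => Int.fract (w i).re, fun i => (w i).im)
    ⟨⟨fun i => Int.fract_nonneg _, fun i => (Int.fract_lt_one _).le⟩, hw⟩
  rw [← hper w (hTB hw) (fun i => -⌊(w i).re⌋)]
  have : (w + fun i => ((-⌊(w i).re⌋ : ℤ) : ℂ)) =
      fun i => ((Int.fract (w i).re : ℝ) : ℂ) + (w i).im * Complex.I := by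
    ext i
    apply Complex.ext <;> simp [Int.fract, sub_eq_add_neg]
  rw [this]
  exact hfr

/-- Fourier expansion of a periodic holomorphic function on a tube domain. -/
theorem hasSum_tubeCoeff {n : ℕ} {H : (Fin n → ℂ) → ℂ} {B : Set (Fin n → ℝ)}
    (hB : IsOpen B) (hBc : Convex ℝ B) (hH : DifferentiableOn ℂ H (tube B))
    (hper : ∀ w ∈ tube B, ∀ k : Fin n → ℤ, H (w + fun i => (k i : ℂ)) = H w)
    {w₀ w : Fin n → ℂ} (hw₀ : w₀ ∈ tube B) (hw : w ∈ tube B) :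
    HasSum (fun N => tubeCoeff H N w₀ * torusExp N w) (H w) := by
  have hfper : ∀ (x : Fin n → ℝ) (k : Fin n → ℤ), H ((fun i => ((x + fun i => (k i : ℝ)) i : ℂ)) + w)
      = H ((fun i => (x i : ℂ)) + w) := by
    intro x k
    rw [← hper _ (ofReal_add_mem_tube hw x) k]
    congr 1
    ext i
    simp
    ring
  obtain ⟨F, hF⟩ := exists_torus_lift
    (f := fun x : Fin n → ℝ => H ((fun i => (x i : ℂ)) + w)) hfper
  have hFc : Continuous F := by
    rw [isOpenQuotientMap_torusMk.isQuotientMap.continuous_iff]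
    have : F ∘ (fun (x : Fin n → ℝ) (i : Fin n) => (x i : UnitAddCircle)) =
        fun x => H ((fun i => (x i : ℂ)) + w) := funext hF
    rw [this]
    exact hH.continuousOn.comp_continuous (f := fun x : Fin n → ℝ => (fun i => (x i : ℂ)) + w)
      (by fun_prop) (fun x => ofReal_add_mem_tube hw x)
  have hcoef : ∀ N, UnitAddTorus.mFourierCoeff F N = tubeCoeff H N w₀ * torusExp N w := fun N => by
    rw [mFourierCoeff_lift hF, tubeCoeff_eq hB hBc hH hper N hw hw₀]
  obtain ⟨δ, hδ, hδB⟩ := Metric.nhds_basis_closedBall.mem_iff.1 (hB.mem_nhds hw)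
  obtain ⟨C, hC⟩ := exists_bound_tube hH.continuousOn hper
    (isCompact_closedBall (fun i => (w i).im) δ) hδB
  have hsum : Summable fun N => UnitAddTorus.mFourierCoeff F N := by
    have hs := (summable_prod_fin (summable_exp_neg_abs (δ := 2 * Real.pi * δ) (by positivity))
      (fun _ => (Real.exp_pos _).le) n).mul_left C
    refine Summable.of_norm_bounded hs fun N => ?_
    -- Shifting each imaginary part by δ against the sign of N i gains the factor exp(-2πδ ∑ |N i|),
    -- which is summable over all N.
    set w' : Fin n → ℂ := fun i => w i - (δ * (SignType.sign (N i : ℝ) : ℝ) : ℝ) * Complex.I with hw'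
    have hw'T : w' ∈ tube (closedBall (fun i => (w i).im) δ) := by
      simp only [tube, Set.mem_ofPred_eq, mem_closedBall, dist_pi_le_iff hδ.le, Real.dist_eq, hw']
      intro i
      have : |(SignType.sign (N i : ℝ) : ℝ)| ≤ 1 := by
        rcases SignType.sign (N i : ℝ) with _ | _ | _ <;> simp
      simpa [abs_mul, abs_of_pos hδ] using mul_le_mul_of_nonneg_left this hδ.le
    have hw'B : w' ∈ tube B := hδB hw'T
    rw [hcoef, tubeCoeff_eq hB hBc hH hper N hw₀ hw'B, norm_mul]
    have h1 := norm_tubeCoeff_le (H := H) N (w := w') (C := C) fun x => hC _ (by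
      exact ofReal_add_mem_tube hw'T x)
    refine (mul_le_mul_of_nonneg_right h1 (norm_nonneg _)).trans (le_of_eq ?_)
    rw [norm_torusExp, mul_assoc, ← Real.exp_add, ← Real.exp_sum]
    congr 2
    rw [Finset.mul_sum, Finset.mul_sum, ← Finset.sum_add_distrib]
    refine Finset.sum_congr rfl fun i _ => ?_
    have : (SignType.sign (N i : ℝ) : ℝ) * (N i : ℝ) = |(N i : ℝ)| := sign_mul_self _
    rw [← this]
    simp [hw']
    ring
  have h := UnitAddTorus.hasSum_mFourier_series_apply_of_summable (f := ⟨F, hFc⟩) hsum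
    (fun i => ((0 : ℝ) : UnitAddCircle))
  simp only [ContinuousMap.coe_mk, hF, hcoef, mFourier_coe] at h
  have e0 : (fun i : Fin n => (0 : ℂ)) + w = w := by ext i; simp
  have e1 : ∀ N : Fin n → ℤ, torusExp N (fun i : Fin n => (0 : ℂ)) = 1 := fun N => by
    simp [torusExp]
  simpa [e0, e1] using h

/-- Uniqueness of Fourier coefficients. -/
theorem eq_zero_of_hasSum_torusExp {c : (d → ℤ) → ℂ}
    (h : ∀ x : d → ℝ, HasSum (fun N => c N * torusExp N (fun i => (x i : ℂ))) 0) : c = 0 := by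
  have hs : Summable fun N => ‖c N‖ := by
    have := (h 0).summable.norm
    refine this.congr fun N => ?_
    simp [torusExp]
  have hS : Summable fun N => c N • UnitAddTorus.mFourier N := by
    refine Summable.of_norm_bounded hs fun N => ?_
    rw [norm_smul, UnitAddTorus.mFourier_norm, mul_one]
  obtain ⟨S, hS⟩ := hS
  have hS0 : S = 0 := by
    ext θ
    obtain ⟨x, rfl⟩ := isOpenQuotientMap_torusMk.surjective θ
    have h1 := ContinuousMap.hasSum_apply hS (fun i => (x i : UnitAddCircle))
    simp only [ContinuousMap.smul_apply, mFourier_coe, smul_eq_mul] at h1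
    exact h1.unique (h x)
  rw [hS0] at hS
  have : IsProbabilityMeasure (volume : Measure UnitAddCircle) :=
    inferInstanceAs (IsProbabilityMeasure AddCircle.haarAddCircle)
  funext M
  -- Uniform convergence implies convergence in L², where pairing with the M-th mode isolates the
  -- coefficient c M.
  have h1 := hS.mapL (ContinuousMap.toLp (E := ℂ) 2 volume ℂ)
  have h2 := h1.mapL (innerSL ℂ (UnitAddTorus.mFourierLp 2 M))
  simp only [map_smul, map_zero] at h2
  have h3 : ∀ N, innerSL ℂ (UnitAddTorus.mFourierLp 2 M)
      (ContinuousMap.toLp (E := ℂ) 2 volume ℂ (UnitAddTorus.mFourier N)) = if M = N then 1 else 0 :=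
    fun N => orthonormal_iff_ite.1 UnitAddTorus.orthonormal_mFourier M N
  simp only [h3] at h2
  have h4 := hasSum_single (f := fun N => c N • if M = N then (1 : ℂ) else 0) M (fun N hN => by
    simp [hN.symm])
  simpa using h4.unique h2

end TorusFourier

end

noncomputable section

namespace EvenLattice

variable {l : ℕ} (L : EvenLattice l)

/-! ### The bilinear form and coordinates on the dual lattice. -/

section Form

variable {R : Type} [CommRing R]

theorem form_add_left (x y z : Fin l → R) : L.form (x + y) z = L.form x z + L.form y z :=
  add_dotProduct _ _ _

theorem form_add_right (x y z : Fin l → R) : L.form x (y + z) = L.form x y + L.form x z := by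
  simp [form, mulVec_add]

theorem form_smul_left (c : R) (x y : Fin l → R) : L.form (c • x) y = c * L.form x y := by
  simp [form]

theorem form_smul_right (c : R) (x y : Fin l → R) : L.form x (c • y) = c * L.form x y := by
  simp [form, mulVec_smul]

theorem form_comm (x y : Fin l → R) : L.form x y = L.form y x := by
  have h : (L.gram.map (Int.cast : ℤ → R))ᵀ = L.gram.map (Int.cast : ℤ → R) := by
    rw [← transpose_map, L.symm]
  rw [form, form, dotProduct_comm, dotProduct_mulVec, ← mulVec_transpose, h]

theorem form_incl (x y : Fin l → ℤ) :
    L.form (incl R x) (incl R y) = ((x ⬝ᵥ L.gram *ᵥ y : ℤ) : R) := by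
  simp [form, incl, dotProduct, mulVec]

theorem det_gram_ne_zero : L.gram.det ≠ 0 := by
  intro h
  obtain ⟨v, hv, h0⟩ := exists_mulVec_eq_zero_iff.2 h
  have := L.posDef v hv
  rw [h0] at this
  simp at this

theorem isUnit_det_gram (K : Type) [Field K] [CharZero K] :
    IsUnit (L.gram.map (Int.cast : ℤ → K)).det := by
  have : (L.gram.map (Int.cast : ℤ → K)).det = ((L.gram.det : ℤ) : K) := by
    have := (Int.castRingHom K).map_det L.gram
    simpa [RingHom.mapMatrix_apply] using this.symm
  rw [this, isUnit_iff_ne_zero]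
  exact_mod_cast L.det_gram_ne_zero

theorem eq_zero_of_form_eq_zero {K : Type} [Field K] [CharZero K] {x : Fin l → K}
    (h : ∀ y, L.form x y = 0) : x = 0 := by
  have h1 : x ᵥ* (L.gram.map (Int.cast : ℤ → K)) = 0 := by
    funext i
    have := h (Pi.single i 1)
    rw [form, dotProduct_mulVec, dotProduct_single_one] at this
    exact this
  have := congrArg (fun y => y ᵥ* (L.gram.map (Int.cast : ℤ → K))⁻¹) h1
  simpa [vecMul_vecMul, mul_nonsing_inv _ (L.isUnit_det_gram K)] using this

theorem exists_form_ne_zero {K : Type} [Field K] [CharZero K] {x : Fin l → K} (hx : x ≠ 0) :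
    ∃ y, L.form x y ≠ 0 := by
  by_contra! h
  exact hx (L.eq_zero_of_form_eq_zero h)

end Form

theorem incl_injective (K : Type) [Field K] [CharZero K] :
    Function.Injective (incl K : (Fin l → ℤ) → Fin l → K) := by
  intro x y h
  funext i
  have := congrFun h i
  simpa [incl] using this

/-- The coordinates `⟨v, e_i⟩` of an element of the dual lattice. -/
def dualCoord (v : L.dual) (i : Fin l) : ℤ := (v.2 (Pi.single i 1)).choose

theorem form_dual_single (v : L.dual) (i : Fin l) :
    L.form (v : Fin l → ℚ) (Pi.single i 1) = L.dualCoord v i := by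
  have := (v.2 (Pi.single i 1)).choose_spec
  rw [← dualCoord] at this
  rw [← this]
  congr 1
  ext j
  by_cases h : j = i <;> simp [incl, h]

theorem vecMul_dual (v : L.dual) :
    (v : Fin l → ℚ) ᵥ* (L.gram.map (Int.cast : ℤ → ℚ)) = fun i => (L.dualCoord v i : ℚ) := by
  funext i
  rw [← form_dual_single, form, dotProduct_mulVec, dotProduct_single_one]

theorem form_dualIncl (v : L.dual) (z : Fin l → ℂ) :
    L.form (L.dualIncl v) z = ∑ i, (L.dualCoord v i : ℂ) * z i := by
  rw [form, dotProduct_mulVec, dotProduct]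
  refine Finset.sum_congr rfl fun i _ => ?_
  congr 1
  have := congrArg (fun q : ℚ => (q : ℂ)) (congrFun (L.vecMul_dual v) i)
  simpa [vecMul, dotProduct, dualIncl] using this

/-- `L^* ≅ ℤ^l`. -/
def dualEquiv : L.dual ≃ (Fin l → ℤ) :=
  Equiv.ofBijective L.dualCoord <| by
    have hu := L.isUnit_det_gram ℚ
    constructor
    · intro v w h
      have h1 : (v : Fin l → ℚ) ᵥ* (L.gram.map (Int.cast : ℤ → ℚ)) =
          (w : Fin l → ℚ) ᵥ* (L.gram.map (Int.cast : ℤ → ℚ)) := by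
        rw [vecMul_dual, vecMul_dual, h]
      have := congrArg (fun y => y ᵥ* (L.gram.map (Int.cast : ℤ → ℚ))⁻¹) h1
      simp only [vecMul_vecMul, mul_nonsing_inv _ hu, vecMul_one] at this
      exact Subtype.ext this
    · intro a
      have h : ∀ x : Fin l → ℤ, L.form ((fun i => (a i : ℚ)) ᵥ* (L.gram.map (Int.cast : ℤ → ℚ))⁻¹)
          (incl ℚ x) = ((∑ i, a i * x i : ℤ) : ℚ) := by
        intro x
        rw [form, dotProduct_mulVec, vecMul_vecMul, nonsing_inv_mul _ hu, vecMul_one]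
        simp [dotProduct, incl]
      refine ⟨⟨_, fun x => ⟨_, h x⟩⟩, ?_⟩
      funext i
      have h1 := L.form_dual_single ⟨_, fun x => ⟨_, h x⟩⟩ i
      have h2 := h (Pi.single i 1)
      have h3 : incl ℚ (Pi.single i 1) = Pi.single i 1 := by
        ext j
        by_cases h : j = i <;> simp [incl, h]
      rw [h3] at h2
      have h4 := h1.symm.trans h2
      simpa [Pi.single_apply] using h4

theorem dualEquiv_apply (v : L.dual) : L.dualEquiv v = L.dualCoord v := rfl

/-- In the coordinates ⟨ℓ, e_i⟩ of the dual lattice, the exponentials are characters of ℂ^(l+1), so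
the results on tubes apply. -/
theorem expTerm_eq (p : ℕ × L.dual) (τ : ℍ) (z : Fin l → ℂ) :
    L.expTerm p τ z = torusExp (Fin.cons (p.1 : ℤ) (L.dualEquiv p.2) : Fin (l + 1) → ℤ)
      (Fin.cons (τ : ℂ) z : Fin (l + 1) → ℂ) := by
  rw [expTerm, form_dualIncl, torusExp, Fin.sum_univ_succ]
  simp [dualEquiv_apply]

theorem norm_expTerm (p : ℕ × L.dual) (τ : ℍ) (z : Fin l → ℂ) :
    ‖L.expTerm p τ z‖ =
      Real.exp (-2 * Real.pi * (p.1 * τ.im + ∑ i, (L.dualCoord p.2 i : ℝ) * (z i).im)) := by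
  rw [expTerm_eq, norm_torusExp, Fin.sum_univ_succ]
  simp [dualEquiv_apply]

/-! ### Uniform bounds for Fourier expansions. -/

section FourierBounds

variable {L} {f : ℕ → L.dual → ℂ} {φ : ℍ → (Fin l → ℂ) → ℂ}

/-- On the box |Im z_i| ≤ R each exponential is largest in absolute value at one of the 2^l corners,
and the series converges absolutely at every corner. Keeping the decay in Im τ - Y explicit allows
the terms with n ≥ 1 to be estimated separately. -/
theorem IsFourierExpansion.exists_bound (hf : L.IsFourierExpansion f φ) {Y : ℝ} (hY : 0 < Y)
    (R : ℝ) : ∃ u : ℕ × L.dual → ℝ, Summable u ∧ (∀ p, 0 ≤ u p) ∧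
      ∀ (p : ℕ × L.dual) (τ : ℍ) (z : Fin l → ℂ), (∀ i, |(z i).im| ≤ R) →
        ‖f p.1 p.2 * L.expTerm p τ z‖ ≤ u p * Real.exp (-2 * Real.pi * (p.1 * (τ.im - Y))) := by
  let τ₀ : ℍ := ⟨Y * Complex.I, by simpa using hY⟩
  have hτ₀ : τ₀.im = Y := by
    change (Y * Complex.I : ℂ).im = Y
    simp
  let ζ : (Fin l → Bool) → Fin l → ℂ := fun ε i => (if ε i then R else -R : ℝ) * Complex.I
  refine ⟨fun p => ∑ ε : Fin l → Bool, ‖f p.1 p.2 * L.expTerm p τ₀ (ζ ε)‖, ?_, ?_, ?_⟩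
  · exact summable_sum fun ε _ => (hf τ₀ (ζ ε)).summable.norm
  · exact fun p => Finset.sum_nonneg fun _ _ => norm_nonneg _
  · intro p τ z hz
    -- The corner whose imaginary parts have signs opposite to the coordinates of ℓ maximises the
    -- exponential.
    have h1 : ‖f p.1 p.2 * L.expTerm p τ₀ (ζ fun i => decide (L.dualCoord p.2 i < 0))‖ ≤
        ∑ ε : Fin l → Bool, ‖f p.1 p.2 * L.expTerm p τ₀ (ζ ε)‖ :=
      Finset.single_le_sum (f := fun ε => ‖f p.1 p.2 * L.expTerm p τ₀ (ζ ε)‖)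
        (fun _ _ => norm_nonneg _) (Finset.mem_univ _)
    refine le_trans ?_ (mul_le_mul_of_nonneg_right h1 (Real.exp_pos _).le)
    rw [norm_mul, norm_mul, norm_expTerm, norm_expTerm, hτ₀, mul_assoc ‖f p.1 p.2‖, ← Real.exp_add]
    refine mul_le_mul_of_nonneg_left (Real.exp_le_exp.2 ?_) (norm_nonneg _)
    have h2 : ∑ i, (L.dualCoord p.2 i : ℝ) * (ζ (fun i => decide (L.dualCoord p.2 i < 0)) i).im ≤
        ∑ i, (L.dualCoord p.2 i : ℝ) * (z i).im := by
      refine Finset.sum_le_sum fun i _ => ?_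
      have hzi := abs_le.1 (hz i)
      simp only [ζ, Complex.im_ofReal_mul, Complex.I_im, mul_one,
        decide_eq_true_eq]
      split_ifs with hneg
      · have : (L.dualCoord p.2 i : ℝ) < 0 := by exact_mod_cast hneg
        nlinarith
      · have : (0 : ℝ) ≤ L.dualCoord p.2 i := by exact_mod_cast not_lt.1 hneg
        nlinarith
    nlinarith [Real.pi_pos, mul_le_mul_of_nonneg_left h2 Real.pi_pos.le]

theorem IsFourierExpansion.exists_bound' (hf : L.IsFourierExpansion f φ) {Y : ℝ} (hY : 0 < Y)
    (R : ℝ) : ∃ u : ℕ × L.dual → ℝ, Summable u ∧ ∀ (p : ℕ × L.dual) (τ : ℍ) (z : Fin l → ℂ),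
      Y ≤ τ.im → (∀ i, |(z i).im| ≤ R) → ‖f p.1 p.2 * L.expTerm p τ z‖ ≤ u p := by
  obtain ⟨u, hu, hu0, h⟩ := hf.exists_bound hY R
  refine ⟨u, hu, fun p τ z hτ hz => (h p τ z hz).trans ?_⟩
  refine mul_le_of_le_one_right (hu0 p) (Real.exp_le_one_iff.2 ?_)
  have : 0 ≤ (p.1 : ℝ) * (τ.im - Y) := mul_nonneg (Nat.cast_nonneg _) (by linarith)
  nlinarith [Real.pi_pos, mul_nonneg Real.pi_pos.le this]

theorem IsFourierExpansion.exists_norm_le (hf : L.IsFourierExpansion f φ) {Y : ℝ} (hY : 0 < Y)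
    (R : ℝ) : ∃ C, ∀ (τ : ℍ) (z : Fin l → ℂ), Y ≤ τ.im → (∀ i, |(z i).im| ≤ R) → ‖φ τ z‖ ≤ C := by
  obtain ⟨u, hu, h⟩ := hf.exists_bound' hY R
  refine ⟨∑' p, u p, fun τ z hτ hz => ?_⟩
  rw [← (hf τ z).tsum_eq]
  exact tsum_of_norm_bounded hu.hasSum fun p => h p τ z hτ hz

/-- The `q^0`-term of a Fourier expansion. -/
def constTerm (f : ℕ → L.dual → ℂ) (z : Fin l → ℂ) : ℂ :=
  ∑' v : L.dual, f 0 v * L.expTerm (0, v) UpperHalfPlane.I z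

theorem IsFourierExpansion.exists_norm_sub_constTerm_le (hf : L.IsFourierExpansion f φ) {Y : ℝ}
    (hY : 0 < Y) (R : ℝ) : ∃ C, ∀ (τ : ℍ) (z : Fin l → ℂ), Y ≤ τ.im → (∀ i, |(z i).im| ≤ R) →
      ‖φ τ z - constTerm f z‖ ≤ C * Real.exp (-2 * Real.pi * (τ.im - Y)) := by
  obtain ⟨u, hu, hu0, h⟩ := hf.exists_bound hY R
  refine ⟨∑' p, u p, fun τ z hτ hz => ?_⟩
  have hinj : Function.Injective (fun v : L.dual => ((0, v) : ℕ × L.dual)) := by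
    intro a b hab
    exact (Prod.ext_iff.mp hab).2
  have h0 : HasSum (fun p : ℕ × L.dual => if p.1 = 0 then f p.1 p.2 * L.expTerm p τ z else 0)
      (constTerm f z) := by
    rw [← hinj.hasSum_iff]
    · have hs : HasSum (fun v => f 0 v * L.expTerm (0, v) UpperHalfPlane.I z) (constTerm f z) :=
        ((hf UpperHalfPlane.I z).summable.comp_injective hinj).hasSum
      have he : ∀ v, L.expTerm (0, v) UpperHalfPlane.I z = L.expTerm (0, v) τ z := fun v => by
        simp [expTerm]
      simp only [he] at hs
      exact hs
    · rintro ⟨n, v⟩ hv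
      have : n ≠ 0 := by
        rintro rfl
        exact hv ⟨v, rfl⟩
      simp [this]
  have hsub := (hf τ z).sub h0
  rw [← hsub.tsum_eq]
  refine tsum_of_norm_bounded (hu.hasSum.mul_right _) fun p => ?_
  by_cases hp : p.1 = 0
  · simp only [hp, if_true, sub_self, norm_zero]
    exact mul_nonneg (hu0 p) (Real.exp_pos _).le
  · simp only [hp, if_false, sub_zero]
    refine (h p τ z hz).trans (mul_le_mul_of_nonneg_left (Real.exp_le_exp.2 ?_) (hu0 p))
    have h1 : (1 : ℝ) ≤ p.1 := by exact_mod_cast Nat.one_le_iff_ne_zero.2 hp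
    have : τ.im - Y ≤ p.1 * (τ.im - Y) := le_mul_of_one_le_left (by linarith) h1
    nlinarith [Real.pi_pos, mul_le_mul_of_nonneg_left this Real.pi_pos.le]

end FourierBounds

end EvenLattice

end

noncomputable section

namespace EvenLattice

open Metric Topology Filter

variable {l : ℕ} {L : EvenLattice l}

/-! ### Termwise differentiation and the q^0-term. -/

section FourierAnalysis

variable {f : ℕ → L.dual → ℂ} {φ : ℍ → (Fin l → ℂ) → ℂ}

theorem expTerm_add_smul (p : ℕ × L.dual) (τ : ℍ) (z v : Fin l → ℂ) (w : ℂ) :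
    L.expTerm p τ (z + w • v) =
      L.expTerm p τ z * Complex.exp (w * (2 * Real.pi * Complex.I * L.form (L.dualIncl p.2) v)) := by
  rw [expTerm, expTerm, ← Complex.exp_add, form_add_right, form_smul_right]
  ring_nf

theorem hasDerivAt_expTerm (p : ℕ × L.dual) (τ : ℍ) (z v : Fin l → ℂ) (w : ℂ) :
    HasDerivAt (fun w : ℂ => L.expTerm p τ (z + w • v))
      (L.expTerm p τ (z + w • v) * (2 * Real.pi * Complex.I * L.form (L.dualIncl p.2) v)) w := by
  simp only [expTerm_add_smul]
  set b := 2 * Real.pi * Complex.I * L.form (L.dualIncl p.2) v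
  have := (((hasDerivAt_id w).mul_const b).cexp).const_mul (L.expTerm p τ z)
  simpa [mul_assoc] using this

theorem abs_im_add_smul_le (z v : Fin l → ℂ) {w : ℂ} {r : ℝ} (hw : ‖w‖ ≤ r) (i : Fin l) :
    |((z + w • v) i).im| ≤ ‖z‖ + r * ‖v‖ := by
  refine (Complex.abs_im_le_norm _).trans ((norm_le_pi_norm (z + w • v) i).trans ?_)
  refine (norm_add_le _ _).trans ?_
  rw [norm_smul]
  gcongr

theorem IsFourierExpansion.exists_lineDeriv (hf : L.IsFourierExpansion f φ) (v : Fin l → ℂ) :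
    ∃ g, L.IsFourierExpansion g (fun τ z => lineDeriv ℂ (φ τ) z v) := by
  refine ⟨fun n u => f n u * (2 * Real.pi * Complex.I * L.form (L.dualIncl u) v), fun τ z => ?_⟩
  obtain ⟨u, hu, hb⟩ := hf.exists_bound' τ.im_pos (‖z‖ + 1 * ‖v‖)
  have h := Complex.hasSum_deriv_of_summable_norm (U := ball (0 : ℂ) 1) (z := 0)
    (F := fun p w => f p.1 p.2 * L.expTerm p τ (z + w • v)) hu
    (fun p w _ => ((hasDerivAt_expTerm p τ z v w).const_mul _).differentiableAt.differentiableWithinAt)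
    isOpen_ball
    (fun p w hw => hb p τ _ le_rfl fun i => abs_im_add_smul_le z v (by simpa using (mem_ball.1 hw).le) i)
    (mem_ball_self one_pos)
  have h1 : (fun w : ℂ => ∑' p, f p.1 p.2 * L.expTerm p τ (z + w • v)) =
      fun w => φ τ (z + w • v) := funext fun w => (hf τ _).tsum_eq
  rw [h1] at h
  have h2 : ∀ p : ℕ × L.dual, deriv (fun w : ℂ => f p.1 p.2 * L.expTerm p τ (z + w • v)) 0 =
      f p.1 p.2 * (2 * Real.pi * Complex.I * L.form (L.dualIncl p.2) v) * L.expTerm p τ z := fun p => by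
    rw [((hasDerivAt_expTerm p τ z v 0).const_mul _).deriv, zero_smul, add_zero]
    ring
  simp only [h2] at h
  exact h

theorem continuous_constTerm (hf : L.IsFourierExpansion f φ) : Continuous (constTerm f) := by
  rw [continuous_iff_continuousAt]
  intro z
  obtain ⟨u, hu, hb⟩ := hf.exists_bound' UpperHalfPlane.I.im_pos (‖z‖ + 1)
  have hinj : Function.Injective (fun v : L.dual => ((0, v) : ℕ × L.dual)) := fun a b hab =>
    (Prod.ext_iff.mp hab).2
  have : ContinuousOn (constTerm f) (ball z 1) := by
    refine continuousOn_tsum (fun v => ?_) (hu.comp_injective hinj) (fun v y hy => ?_)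
    · have hc : Continuous fun y => L.expTerm (0, v) UpperHalfPlane.I y := by
        simp only [expTerm, form_dualIncl]
        fun_prop
      exact (continuous_const.mul hc).continuousOn
    · refine hb (0, v) _ _ le_rfl fun i => ?_
      refine (Complex.abs_im_le_norm _).trans ((norm_le_pi_norm y i).trans ?_)
      have := mem_ball_iff_norm.1 hy
      linarith [norm_le_norm_add_norm_sub' y z]
  exact this.continuousAt (ball_mem_nhds z one_pos)

theorem differentiable_constTerm_line (hf : L.IsFourierExpansion f φ) (z v : Fin l → ℂ) :
    Differentiable ℂ (fun w : ℂ => constTerm f (z + w • v)) := by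
  intro w
  obtain ⟨u, hu, hb⟩ := hf.exists_bound' UpperHalfPlane.I.im_pos (‖z‖ + (‖w‖ + 1) * ‖v‖)
  have hinj : Function.Injective (fun v : L.dual => ((0, v) : ℕ × L.dual)) := fun a b hab =>
    (Prod.ext_iff.mp hab).2
  have := Complex.differentiableOn_tsum_of_summable_norm (U := ball w 1)
    (F := fun (x : L.dual) w => f 0 x * L.expTerm (0, x) UpperHalfPlane.I (z + w • v))
    (hu.comp_injective hinj)
    (fun x w _ => ((hasDerivAt_expTerm _ _ z v w).const_mul _).differentiableAt.differentiableWithinAt)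
    isOpen_ball
    (fun x y hy => hb (0, x) _ _ le_rfl fun i => abs_im_add_smul_le z v (by
      have := mem_ball_iff_norm.1 hy
      linarith [norm_le_norm_add_norm_sub' y w]) i)
  exact this.differentiableAt (ball_mem_nhds w one_pos)

theorem exists_constTerm_ne_zero (hf : L.IsFourierExpansion f φ) {v : L.dual} (hv : f 0 v ≠ 0) :
    ∃ z, constTerm f z ≠ 0 := by
  by_contra! h
  have hinj : Function.Injective (fun v : L.dual => ((0, v) : ℕ × L.dual)) := fun a b hab =>
    (Prod.ext_iff.mp hab).2
  have h0 := eq_zero_of_hasSum_torusExp (c := fun a => f 0 (L.dualEquiv.symm a)) fun x => by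
    have hs : HasSum (fun v => f 0 v * L.expTerm (0, v) UpperHalfPlane.I (fun i => (x i : ℂ)))
        (constTerm f fun i => (x i : ℂ)) :=
      ((hf UpperHalfPlane.I _).summable.comp_injective hinj).hasSum
    rw [h, ← L.dualEquiv.symm.hasSum_iff] at hs
    have he : (fun a => f 0 (L.dualEquiv.symm a) * torusExp a fun i => (x i : ℂ)) =
        (fun v => f 0 v * L.expTerm (0, v) UpperHalfPlane.I fun i => (x i : ℂ)) ∘
          L.dualEquiv.symm := by
      funext a
      simp [expTerm_eq, torusExp, Fin.sum_univ_succ]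
    rw [he]
    exact hs
  exact hv (by simpa using congrFun h0 (L.dualEquiv v))

/-- The line from z to a point where the q^0-term is nonzero carries isolated zeros only, so a small
circle around z avoids them. Compactness gives a lower bound on that circle, and it persists for
nearby centres. This makes division possible even where the q^0-term itself vanishes. -/
theorem exists_circle_constTerm (hf : L.IsFourierExpansion f φ) {v : L.dual} (hv : f 0 v ≠ 0)
    (z : Fin l → ℂ) : ∃ u : Fin l → ℂ, ∃ r > 0, ∃ c > 0, ∃ N ∈ 𝓝 z, ∀ y ∈ N,
      ∀ w ∈ sphere (0 : ℂ) r, c ≤ ‖constTerm f (y + w • u)‖ := by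
  obtain ⟨z₁, hz₁⟩ := exists_constTerm_ne_zero hf hv
  have hd := differentiable_constTerm_line hf z (z₁ - z)
  have han := (Complex.analyticOnNhd_univ_iff_differentiable.2 hd)
  have hev : ∀ᶠ w : ℂ in 𝓝[≠] 0, constTerm f (z + w • (z₁ - z)) ≠ 0 := by
    refine (han 0 trivial).eventually_eq_zero_or_eventually_ne_zero.resolve_left fun h => hz₁ ?_
    have := han.eqOn_zero_of_preconnected_of_eventuallyEq_zero isPreconnected_univ trivial h
      (Set.mem_univ 1)
    simpa using this
  rw [eventually_nhdsWithin_iff] at hev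
  obtain ⟨r, hr, hrs⟩ := Metric.nhds_basis_closedBall.mem_iff.1 hev
  have hne : ∀ w ∈ sphere (0 : ℂ) r, constTerm f (z + w • (z₁ - z)) ≠ 0 := fun w hw =>
    hrs (sphere_subset_closedBall hw) (by
      rintro rfl
      simp at hw
      exact hr.ne hw)
  have hc := continuous_constTerm hf
  obtain ⟨w₀, hw₀, hmin⟩ := (isCompact_sphere (0 : ℂ) r).exists_isMinOn
    (NormedSpace.sphere_nonempty.2 hr.le)
    (f := fun w : ℂ => ‖constTerm f (z + w • (z₁ - z))‖) (by fun_prop)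
  set c := ‖constTerm f (z + w₀ • (z₁ - z))‖ with hcdef
  have hcpos : 0 < c := norm_pos_iff.2 (hne w₀ hw₀)
  have hO : IsOpen {x : (Fin l → ℂ) × ℂ | c / 2 < ‖constTerm f (x.1 + x.2 • (z₁ - z))‖} :=
    isOpen_lt continuous_const (by fun_prop)
  obtain ⟨N, T, hN, -, hzN, hT, hNT⟩ := generalized_tube_lemma
    (isCompact_singleton (x := z)) (isCompact_sphere (0 : ℂ) r) hO (by
      rintro ⟨x, w⟩ ⟨rfl, hw⟩
      have : c ≤ _ := hmin hw
      simp only [Set.mem_ofPred_eq]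
      linarith)
  refine ⟨z₁ - z, r, hr, c / 2, by positivity, N, hN.mem_nhds (hzN rfl), fun y hy w hw => ?_⟩
  have : (y, w) ∈ {x : (Fin l → ℂ) × ℂ | c / 2 < ‖constTerm f (x.1 + x.2 • (z₁ - z))‖} :=
    hNT ⟨hy, hT hw⟩
  exact this.le

end FourierAnalysis

/-! ### Holomorphic functions on ℍ × ℂ^l and their behaviour at i∞. -/

/-- The half space `ℍ × ℂ^l` as a subset of `ℂ × ℂ^l`. -/
def halfSpace (l : ℕ) : Set (ℂ × (Fin l → ℂ)) := {p | 0 < p.1.im}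

theorem isOpen_halfSpace : IsOpen (halfSpace l) :=
  isOpen_lt continuous_const (by fun_prop)

theorem convex_halfSpace : Convex ℝ (halfSpace l) := by
  intro a ha b hb s t hs ht hst
  simp only [halfSpace, Set.mem_ofPred_eq, Prod.fst_add, Prod.smul_fst, Complex.add_im,
    Complex.real_smul, Complex.im_ofReal_mul] at *
  rcases hs.eq_or_lt with rfl | hs
  · have : t = 1 := by linarith
    subst this
    simpa using hb
  · have := mul_pos hs ha
    have := mul_nonneg ht hb.le
    linarith

/-- A function on `ℍ × ℂ^l` as a function on `ℂ × ℂ^l`. -/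
def extend (φ : ℍ → (Fin l → ℂ) → ℂ) (p : ℂ × (Fin l → ℂ)) : ℂ := φ (ofComplex p.1) p.2

theorem extend_coe (φ : ℍ → (Fin l → ℂ) → ℂ) (τ : ℍ) (z : Fin l → ℂ) :
    extend φ ((τ : ℂ), z) = φ τ z := by
  simp [extend]

theorem mem_halfSpace (τ : ℍ) (z : Fin l → ℂ) : ((τ : ℂ), z) ∈ halfSpace l := τ.im_pos

theorem extend_of_mem (φ : ℍ → (Fin l → ℂ) → ℂ) {p : ℂ × (Fin l → ℂ)} (hp : p ∈ halfSpace l) :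
    extend φ p = φ ⟨p.1, hp⟩ p.2 := by
  rw [extend, ofComplex_apply_of_im_pos hp]

/-- Holomorphy of functions on `ℍ × ℂ^l`. -/
def IsHolo (φ : ℍ → (Fin l → ℂ) → ℂ) : Prop := DifferentiableOn ℂ (extend φ) (halfSpace l)

theorem IsHolo.comp_line {φ : ℍ → (Fin l → ℂ) → ℂ} (h : IsHolo φ) (τ : ℍ) (z v : Fin l → ℂ) :
    Differentiable ℂ (fun w : ℂ => φ τ (z + w • v)) := by
  have h1 := DifferentiableOn.comp_line h ((τ : ℂ), z) (0, v)
  have h2 : {w : ℂ | ((τ : ℂ), z) + w • ((0 : ℂ), v) ∈ halfSpace l} = Set.univ := by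
    ext w
    simpa [halfSpace] using τ.im_pos
  rw [h2, differentiableOn_univ] at h1
  convert h1 using 2 with w
  have : ((τ : ℂ), z) + w • ((0 : ℂ), v) = ((τ : ℂ), z + w • v) := by simp
  rw [this, extend_coe]

theorem IsHolo.differentiable_apply {φ : ℍ → (Fin l → ℂ) → ℂ} (h : IsHolo φ) (τ : ℍ) :
    Differentiable ℂ (φ τ) := by
  intro z
  have h1 := h.differentiableAt (isOpen_halfSpace.mem_nhds (mem_halfSpace τ z))
  have h2 : DifferentiableAt ℂ (fun z : Fin l → ℂ => ((τ : ℂ), z)) z := by fun_prop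
  have h3 := h1.comp z h2
  have h4 : extend φ ∘ (fun z : Fin l → ℂ => ((τ : ℂ), z)) = φ τ := by
    ext z
    exact extend_coe φ τ z
  rwa [h4] at h3

/-- A holomorphic quotient of two functions with Fourier expansions is bounded at `i∞`. -/
theorem exists_norm_le_of_mul_eq {f g : ℕ → L.dual → ℂ} {h φ ψ : ℍ → (Fin l → ℂ) → ℂ}
    (hh : IsHolo h) (hf : L.IsFourierExpansion f φ) (hg : L.IsFourierExpansion g ψ)
    {v : L.dual} (hv : f 0 v ≠ 0) (hmul : ∀ τ z, h τ z * φ τ z = ψ τ z) (z₀ : Fin l → ℂ) :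
    ∃ N ∈ 𝓝 z₀, ∃ Y C : ℝ, ∀ (τ : ℍ) (z : Fin l → ℂ), Y ≤ τ.im → z ∈ N → ‖h τ z‖ ≤ C := by
  obtain ⟨u, r, hr, c, hc, N, hN, hcN⟩ := exists_circle_constTerm hf hv z₀
  obtain ⟨C₁, hC₁⟩ := hf.exists_norm_sub_constTerm_le one_pos (‖z₀‖ + 1 + r * ‖u‖)
  obtain ⟨C₂, hC₂⟩ := hg.exists_norm_le one_pos (‖z₀‖ + 1 + r * ‖u‖)
  obtain ⟨Y, hY1, hY⟩ : ∃ Y : ℝ, 1 ≤ Y ∧ ∀ y, Y ≤ y → C₁ * Real.exp (-2 * Real.pi * (y - 1)) ≤ c / 2 := by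
    have ht : Tendsto (fun y : ℝ => C₁ * Real.exp (-2 * Real.pi * (y - 1))) atTop (𝓝 (C₁ * 0)) := by
      refine Tendsto.const_mul _ (Real.tendsto_exp_atBot.comp ?_)
      refine Tendsto.const_mul_atTop_of_neg (by linarith [Real.pi_pos]) ?_
      exact tendsto_atTop_add_const_right _ _ tendsto_id
    rw [mul_zero] at ht
    obtain ⟨Y, hY⟩ := eventually_atTop.1 (ht.eventually_le_const (half_pos hc))
    exact ⟨max 1 Y, le_max_left _ _, fun y hy => hY y ((le_max_right _ _).trans hy)⟩
  refine ⟨N ∩ ball z₀ 1, inter_mem hN (ball_mem_nhds _ one_pos), Y, C₂ / (c / 2), ?_⟩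
  rintro τ z hτ ⟨hzN, hz⟩
  have hzn : ‖z‖ ≤ ‖z₀‖ + 1 := by
    have := mem_ball_iff_norm.1 hz
    linarith [norm_le_norm_add_norm_sub' z z₀]
  have hbd : ∀ w ∈ sphere (0 : ℂ) r, ‖h τ (z + w • u)‖ ≤ C₂ / (c / 2) := by
    intro w hw
    have hwr : ‖w‖ ≤ r := by simpa using hw.le
    have him : ∀ i, |((z + w • u) i).im| ≤ ‖z₀‖ + 1 + r * ‖u‖ := fun i =>
      (abs_im_add_smul_le z u hwr i).trans (by linarith)
    have h1 := hC₁ τ _ (hY1.trans hτ) him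
    have h2 := hC₂ τ _ (hY1.trans hτ) him
    have h3 := hcN z hzN w hw
    -- High up, φ differs from its q^0-term by at most c / 2, while that term is at least c on the
    -- circle.
    have h4 : c / 2 ≤ ‖φ τ (z + w • u)‖ := by
      have := norm_sub_norm_le (constTerm f (z + w • u)) (φ τ (z + w • u))
      rw [norm_sub_rev] at this
      linarith [hY _ hτ]
    rw [← hmul, norm_mul] at h2
    rw [le_div_iff₀ (half_pos hc)]
    exact (mul_le_mul_of_nonneg_left h4 (norm_nonneg _)).trans h2
  -- The maximum principle carries the bound from the circle to its centre, where φ may vanish.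
  have := Complex.norm_le_of_forall_mem_frontier_norm_le (isBounded_ball (x := (0 : ℂ)) (r := r))
    (hh.comp_line τ z u).diffContOnCl (fun w hw => hbd w (frontier_ball_subset_sphere hw))
    (z := 0) (subset_closure (mem_ball_self hr))
  simpa using this

/-- A periodic holomorphic function on `ℍ × ℂ^l` which is bounded at `i∞`, locally uniformly in
`z`, has a Fourier expansion. -/
theorem exists_isFourierExpansion {h : ℍ → (Fin l → ℂ) → ℂ} (hh : IsHolo h)
    (hτ : ∀ (n : ℤ) (τ : ℍ) z, h ((n : ℝ) +ᵥ τ) z = h τ z)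
    (hz : ∀ (k : Fin l → ℤ) (τ : ℍ) z, h τ (z + incl ℂ k) = h τ z)
    (hb : ∀ z₀ : Fin l → ℂ, ∃ N ∈ 𝓝 z₀, ∃ Y C : ℝ, ∀ (τ : ℍ) (z : Fin l → ℂ), Y ≤ τ.im → z ∈ N →
      ‖h τ z‖ ≤ C) : ∃ f, L.IsFourierExpansion f h := by
  set H : (Fin (l + 1) → ℂ) → ℂ := fun w => extend h (w 0, fun i => w i.succ) with hH
  set B : Set (Fin (l + 1) → ℝ) := {y | 0 < y 0} with hBdef
  have hB : IsOpen B := isOpen_lt continuous_const (by fun_prop)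
  have hBc : Convex ℝ B := convex_halfSpace_gt (IsLinearMap.mk (fun _ _ => rfl) (fun _ _ => rfl)) 0
  have hHd : DifferentiableOn ℂ H (tube B) :=
    hh.comp (f := fun w : Fin (l + 1) → ℂ => (w 0, fun i : Fin l => w i.succ)) (by fun_prop)
      (fun w hw => hw)
  have hper : ∀ w ∈ tube B, ∀ k : Fin (l + 1) → ℤ, H (w + fun i => (k i : ℂ)) = H w := by
    intro w hw k
    have hw0 : 0 < (w 0).im := hw
    have e : ofComplex (w 0 + k 0) = ((k 0 : ℤ) : ℝ) +ᵥ (⟨w 0, hw0⟩ : ℍ) := by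
      rw [ofComplex_apply_of_im_pos (by simpa using hw0)]
      ext
      simp [add_comm]
    simp only [hH, extend, Pi.add_apply]
    rw [e, hτ, ofComplex_apply_of_im_pos hw0]
    exact hz (fun i => k i.succ) _ _
  have hunif : ∃ Y C : ℝ, ∀ (τ : ℍ) (x : Fin l → ℝ), Y ≤ τ.im → ‖h τ (fun i => (x i : ℂ))‖ ≤ C := by
    have hK : IsCompact ((fun (x : Fin l → ℝ) (i : Fin l) => (x i : ℂ)) '' Set.Icc 0 1) :=
      isCompact_Icc.image (by fun_prop)
    obtain ⟨Y, C, hYC⟩ := hK.induction_on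
      (p := fun S => ∃ Y C : ℝ, ∀ (τ : ℍ) (z : Fin l → ℂ), Y ≤ τ.im → z ∈ S → ‖h τ z‖ ≤ C)
      ⟨0, 0, by simp⟩
      (fun S T hST ⟨Y, C, hT⟩ => ⟨Y, C, fun τ z hY hz => hT τ z hY (hST hz)⟩)
      (by
        rintro S T ⟨Y, C, hS⟩ ⟨Y', C', hT⟩
        refine ⟨max Y Y', max C C', fun τ z hY hz => ?_⟩
        rcases hz with hz | hz
        · exact (hS τ z ((le_max_left _ _).trans hY) hz).trans (le_max_left _ _)
        · exact (hT τ z ((le_max_right _ _).trans hY) hz).trans (le_max_right _ _))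
      (fun z _ => by
        obtain ⟨N, hN, Y, C, hNb⟩ := hb z
        exact ⟨N, mem_nhdsWithin_of_mem_nhds hN, Y, C, hNb⟩)
    refine ⟨Y, C, fun τ x hY => ?_⟩
    rw [← hz (fun i => -⌊x i⌋)]
    refine hYC τ _ hY ⟨fun i => Int.fract (x i),
      ⟨fun i => Int.fract_nonneg _, fun i => (Int.fract_lt_one _).le⟩, ?_⟩
    ext i
    simp [incl, Int.fract, sub_eq_add_neg]
  obtain ⟨Y, C, hYC⟩ := hunif
  set w₀ : Fin (l + 1) → ℂ := Fin.cons Complex.I 0 with hw₀def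
  have hmem : ∀ y : ℝ, 0 < y → (Fin.cons (y * Complex.I) 0 : Fin (l + 1) → ℂ) ∈ tube B := by
    intro y hy
    simpa [tube, hBdef] using hy
  have hw₀ : w₀ ∈ tube B := by simpa using hmem 1 one_pos
  -- The coefficient can be computed at any height y, with real z. For N 0 < 0 its bound is a
  -- constant times exp(2π (N 0) y), which tends to zero.
  have hneg : ∀ N : Fin (l + 1) → ℤ, N 0 < 0 → tubeCoeff H N w₀ = 0 := by
    intro N hN
    have hlim : Tendsto (fun y : ℝ => C * Real.exp (2 * Real.pi * (N 0 * y))) atTop (𝓝 (C * 0)) := by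
      refine Tendsto.const_mul _ (Real.tendsto_exp_atBot.comp ?_)
      refine Tendsto.const_mul_atBot (by positivity) ?_
      exact Tendsto.const_mul_atTop_of_neg (by exact_mod_cast hN) tendsto_id
    rw [mul_zero] at hlim
    refine norm_le_zero_iff.1 (ge_of_tendsto hlim ?_)
    filter_upwards [eventually_ge_atTop Y, eventually_gt_atTop 0] with y hyY hy0
    rw [tubeCoeff_eq hB hBc hHd hper N hw₀ (hmem y hy0)]
    refine (norm_tubeCoeff_le (C := C) N fun x => ?_).trans (le_of_eq ?_)
    · have hpos : 0 < ((x 0 : ℂ) + y * Complex.I).im := by simpa using hy0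
      have := hYC ⟨(x 0 : ℂ) + y * Complex.I, hpos⟩ (fun i => x i.succ) (by
        change Y ≤ ((x 0 : ℂ) + y * Complex.I).im
        simpa using hyY)
      simpa [hH, extend, ofComplex_apply_of_im_pos hpos] using this
    · rw [Fin.sum_univ_succ]
      simp
  refine ⟨fun n v => tubeCoeff H (Fin.cons (n : ℤ) (L.dualEquiv v)) w₀, fun τ z => ?_⟩
  have hs := hasSum_tubeCoeff hB hBc hHd hper hw₀ (w := Fin.cons (τ : ℂ) z) (by
    simpa [tube, hBdef] using τ.im_pos)
  have hHτ : H (Fin.cons (τ : ℂ) z) = h τ z := by simp [hH, extend]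
  rw [hHτ] at hs
  have hinj : Function.Injective (fun p : ℕ × L.dual =>
      (Fin.cons (p.1 : ℤ) (L.dualEquiv p.2) : Fin (l + 1) → ℤ)) := by
    intro p q hpq
    obtain ⟨h1, h2⟩ := Fin.cons_inj.1 hpq
    exact Prod.ext (by exact_mod_cast h1) (L.dualEquiv.injective h2)
  rw [← hinj.hasSum_iff] at hs
  · simpa only [Function.comp_def, ← expTerm_eq] using hs
  · intro N hN
    rw [hneg N, zero_mul]
    by_contra hge
    refine hN ⟨((N 0).toNat, L.dualEquiv.symm (fun i => N i.succ)), ?_⟩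
    ext i
    refine Fin.cases ?_ (fun i => ?_) i
    · simpa using not_lt.1 hge
    · simp

end EvenLattice

end

noncomputable section

/-! ### Functions with the transformation laws of Jacobi forms. -/

namespace EvenLattice

open Metric Topology Filter

variable {l : ℕ} (L : EvenLattice l)

/-- The algebra of holomorphic functions on `ℍ × ℂ^l`. -/
def holoAlgebra (l : ℕ) : Subalgebra ℂ (ℍ → (Fin l → ℂ) → ℂ) where
  carrier := {φ | IsHolo φ}
  mul_mem' := fun ha hb => DifferentiableOn.mul ha hb
  add_mem' := fun ha hb => DifferentiableOn.add ha hb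
  algebraMap_mem' := fun c => differentiableOn_const c

/-- The algebra of functions with a Fourier expansion. -/
def fourierAlgebra : Subalgebra ℂ (ℍ → (Fin l → ℂ) → ℂ) where
  carrier := {φ | ∃ f, L.IsFourierExpansion f φ}
  mul_mem' := fun ⟨_, hf⟩ ⟨_, hg⟩ => hf.exists_mul L hg
  add_mem' := fun ⟨f, hf⟩ ⟨g, hg⟩ => ⟨fun n v => f n v + g n v, fun τ z => by
    simpa [add_mul] using (hf τ z).add (hg τ z)⟩
  algebraMap_mem' := fun c => by
    obtain ⟨f, hf⟩ := IsWeakJacobiForm.fourier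
      (SetLike.GradedOne.one_mem (A := L.jacobiPiece ⊥))
    refine ⟨fun n v => c * f n v, fun τ z => ?_⟩
    simpa [mul_assoc] using (hf τ z).mul_left c

theorem IsHolo.lineDeriv {φ : ℍ → (Fin l → ℂ) → ℂ} (h : IsHolo φ) (v : Fin l → ℂ) :
    IsHolo (fun τ z => _root_.lineDeriv ℂ (φ τ) z v) := by
  refine (DifferentiableOn.lineDeriv h isOpen_halfSpace (0, v)).congr fun p hp => ?_
  simp [extend, _root_.lineDeriv]

theorem jacobian_mem (S : Subalgebra ℂ (ℍ → (Fin l → ℂ) → ℂ))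
    {e : Module.Basis (Fin l) ℂ (Fin l → ℂ)} {m : Fin (l + 1) → ℕ}
    {φ : Fin (l + 1) → ℍ → (Fin l → ℂ) → ℂ} (h : ∀ j, φ j ∈ S)
    (h' : ∀ j i, (fun τ z => lineDeriv ℂ (φ j τ) z (e i)) ∈ S) : jacobian e m φ ∈ S := by
  have heq : jacobian e m φ = Matrix.det (Matrix.of fun (i j : Fin (l + 1)) =>
      (Fin.cases ((m j : ℂ) • φ j) (fun i' τ z => lineDeriv ℂ (φ j τ) z (e i')) i :
        ℍ → (Fin l → ℂ) → ℂ)) := by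
    funext τ z
    have := ((Pi.evalRingHom (fun _ : Fin l → ℂ => ℂ) z).comp
      (Pi.evalRingHom (fun _ : ℍ => (Fin l → ℂ) → ℂ) τ)).map_det
      (Matrix.of fun (i j : Fin (l + 1)) =>
      (Fin.cases ((m j : ℂ) • φ j) (fun i' τ z => lineDeriv ℂ (φ j τ) z (e i')) i :
        ℍ → (Fin l → ℂ) → ℂ))
    refine Eq.trans ?_ this.symm
    rw [jacobian]
    congr 1
    ext i j
    refine Fin.cases ?_ (fun i' => ?_) i <;> simp
  rw [heq, Matrix.det_apply]
  refine S.sum_mem fun σ _ => ?_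
  rw [Units.smul_def]
  refine S.zsmul_mem (S.prod_mem fun j _ => ?_) _
  rw [Matrix.of_apply]
  refine Fin.cases ?_ (fun i' => ?_) (σ j)
  · exact S.smul_mem (h j) _
  · exact h' j i'

theorem prod_zpow_eq_zpow_sum {ι : Type*} {s : Finset ι} {k : ι → ℤ} {a : ℂ} (ha : a ≠ 0) :
    ∏ j ∈ s, a ^ k j = a ^ ∑ j ∈ s, k j := by
  classical
  induction s using Finset.induction_on with
  | empty => simp
  | insert i s hi ih => rw [Finset.prod_insert hi, Finset.sum_insert hi, zpow_add₀ ha, ih]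

/-- M' = P M diag(a), where P is block lower triangular with blocks 1 and T. Every symmetry acts on
the Jacobian matrix in this way: columns are scaled by automorphy factors, derivative rows are mixed
by T, and multiples of the first row are added. -/
theorem det_affine_transform {R : Type*} [CommRing R] {M M' : Matrix (Fin (l + 1)) (Fin (l + 1)) R}
    {a : Fin (l + 1) → R} {T : Matrix (Fin l) (Fin l) R} {c : Fin l → R}
    (h0 : ∀ j, M' 0 j = a j * M 0 j)
    (hs : ∀ i j, M' i.succ j = a j * (∑ k, T i k * M k.succ j + c i * M 0 j)) :
    M'.det = (∏ j, a j) * T.det * M.det := by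
  set P : Matrix (Fin (l + 1)) (Fin (l + 1)) R :=
    Matrix.of (Fin.cons (Fin.cons 1 0) fun i => Fin.cons (c i) (T i)) with hP
  have hM : M' = P * M * Matrix.diagonal a := by
    ext i j
    rw [Matrix.mul_diagonal, Matrix.mul_apply, Fin.sum_univ_succ]
    refine Fin.cases ?_ (fun i' => ?_) i
    · rw [h0]
      simp [hP, mul_comm]
    · rw [hs]
      simp [hP]
      ring
  have hdet : P.det = T.det := by
    rw [Matrix.det_succ_row_zero, Fin.sum_univ_succ]
    have h1 : P.submatrix Fin.succ (Fin.succAbove 0) = T := by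
      ext i j
      simp [hP]
    rw [h1]
    simp [hP]
  rw [hM, Matrix.det_mul, Matrix.det_mul, hdet, Matrix.det_diagonal]
  ring

/-- Holomorphic functions with the transformation laws of Jacobi forms of weight `k` and index
`t`. -/
structure IsJacobiLike (k t : ℤ) (φ : ℍ → (Fin l → ℂ) → ℂ) : Prop where
  holo : IsHolo φ
  modular : ∀ (γ : SL(2, ℤ)) (τ : ℍ) (z : Fin l → ℂ),
    φ (γ • τ) ((((γ 1 0 : ℤ) : ℂ) * τ + ((γ 1 1 : ℤ) : ℂ))⁻¹ • z) =
      (((γ 1 0 : ℤ) : ℂ) * τ + ((γ 1 1 : ℤ) : ℂ)) ^ k *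
      Complex.exp (t * (Real.pi * Complex.I * (((γ 1 0 : ℤ) : ℂ) * L.form z z /
        (((γ 1 0 : ℤ) : ℂ) * τ + ((γ 1 1 : ℤ) : ℂ))))) * φ τ z
  elliptic : ∀ (x y : Fin l → ℤ) (τ : ℍ) (z : Fin l → ℂ),
    φ τ (z + (τ : ℂ) • incl ℂ x + incl ℂ y) =
      Complex.exp (t * -(Real.pi * Complex.I *
        (L.form (incl ℂ x) (incl ℂ x) * τ + 2 * L.form (incl ℂ x) z))) * φ τ z

variable {L}

theorem IsWeakJacobiForm.isJacobiLike {G : Subgroup L.orthogonalGroup} {k : ℤ} {t : ℕ}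
    {φ : ℍ → (Fin l → ℂ) → ℂ} (h : L.IsWeakJacobiForm G k t φ) : L.IsJacobiLike k t φ := by
  refine ⟨h.holomorphic, fun γ τ z => ?_, fun x y τ z => ?_⟩
  · rw [h.modular]
    push_cast
    ring_nf
  · rw [h.elliptic]
    push_cast
    ring_nf

theorem IsJacobiLike.isWeakJacobiForm {G : Subgroup L.orthogonalGroup} {k : ℤ} {t : ℕ}
    {φ : ℍ → (Fin l → ℂ) → ℂ} (h : L.IsJacobiLike k t φ) (hF : ∃ f, L.IsFourierExpansion f φ)
    (hG : ∀ σ ∈ G, ∀ τ z, φ τ (L.act σ z) = φ τ z) : L.IsWeakJacobiForm G k t φ := by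
  refine ⟨h.holo, fun γ τ z => ?_, fun x y τ z => ?_, hF, hG⟩
  · rw [h.modular]
    push_cast
    ring_nf
  · rw [h.elliptic]
    push_cast
    ring_nf

/-! ### Transformation laws of the Jacobian. -/

section Jacobian

variable {e : Module.Basis (Fin l) ℂ (Fin l → ℂ)} {k : Fin (l + 1) → ℤ} {m : Fin (l + 1) → ℕ}
  {φ : Fin (l + 1) → ℍ → (Fin l → ℂ) → ℂ}

theorem IsHolo.hasDerivAt_line {φ : ℍ → (Fin l → ℂ) → ℂ} (h : IsHolo φ) (τ : ℍ)
    (z v : Fin l → ℂ) :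
    HasDerivAt (fun w : ℂ => φ τ (z + w • v)) (_root_.lineDeriv ℂ (φ τ) z v) 0 :=
  (h.comp_line τ z v 0).hasDerivAt

theorem IsHolo.lineDeriv_eq_sum {φ : ℍ → (Fin l → ℂ) → ℂ} (h : IsHolo φ) (τ : ℍ)
    (z v : Fin l → ℂ) (e : Module.Basis (Fin l) ℂ (Fin l → ℂ)) :
    _root_.lineDeriv ℂ (φ τ) z v = ∑ i, e.repr v i * _root_.lineDeriv ℂ (φ τ) z (e i) := by
  have hd := h.differentiable_apply τ z
  simp only [hd.lineDeriv_eq_fderiv]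
  have := congrArg (fderiv ℂ (φ τ) z) (e.sum_repr v).symm
  rw [map_sum] at this
  simpa only [map_smul, smul_eq_mul] using this

/-- The derivative of the automorphy factor contributes a multiple of t φ in which only t φ depends
on the form. This is why the first row of the Jacobian has the weights m_j. -/
theorem IsJacobiLike.lineDeriv_elliptic {k t : ℤ} {φ : ℍ → (Fin l → ℂ) → ℂ}
    (h : L.IsJacobiLike k t φ) (x y : Fin l → ℤ) (τ : ℍ) (z v : Fin l → ℂ) :
    _root_.lineDeriv ℂ (φ τ) (z + (τ : ℂ) • incl ℂ x + incl ℂ y) v =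
      Complex.exp (t * -(Real.pi * Complex.I *
        (L.form (incl ℂ x) (incl ℂ x) * τ + 2 * L.form (incl ℂ x) z))) *
      (_root_.lineDeriv ℂ (φ τ) z v + -(2 * Real.pi * Complex.I * L.form (incl ℂ x) v) * (t * φ τ z)) := by
  have h1 : (fun w : ℂ => φ τ (z + (τ : ℂ) • incl ℂ x + incl ℂ y + w • v)) = fun w =>
      Complex.exp (t * -(Real.pi * Complex.I *
        (L.form (incl ℂ x) (incl ℂ x) * τ + 2 * (L.form (incl ℂ x) z + w * L.form (incl ℂ x) v)))) *
        φ τ (z + w • v) := by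
    funext w
    have : z + (τ : ℂ) • incl ℂ x + incl ℂ y + w • v =
        (z + w • v) + (τ : ℂ) • incl ℂ x + incl ℂ y := by abel
    rw [this, h.elliptic, form_add_right, form_smul_right]
  have h2 : HasDerivAt (fun w : ℂ => Complex.exp (t * -(Real.pi * Complex.I *
        (L.form (incl ℂ x) (incl ℂ x) * τ + 2 * (L.form (incl ℂ x) z + w * L.form (incl ℂ x) v)))))
      (Complex.exp (t * -(Real.pi * Complex.I *
        (L.form (incl ℂ x) (incl ℂ x) * τ + 2 * (L.form (incl ℂ x) z + 0 * L.form (incl ℂ x) v)))) *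
        (t * -(Real.pi * Complex.I * (2 * (1 * L.form (incl ℂ x) v))))) 0 :=
    (((((((hasDerivAt_id (0 : ℂ)).mul_const (L.form (incl ℂ x) v)).const_add _).const_mul
      2).const_add _).const_mul (Real.pi * Complex.I : ℂ)).neg.const_mul (t : ℂ)).cexp
  have h3 := h2.mul (h.holo.hasDerivAt_line τ z v)
  rw [_root_.lineDeriv, h1]
  refine h3.deriv.trans ?_
  simp only [zero_mul, add_zero, zero_smul]
  ring

/-- As in the elliptic case, with an additional factor cτ + d from the rescaling of z. Each of the l
derivative rows contributes one such factor, which explains the summand l in the weight of the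
Jacobian. -/
theorem IsJacobiLike.lineDeriv_modular {k t : ℤ} {φ : ℍ → (Fin l → ℂ) → ℂ}
    (h : L.IsJacobiLike k t φ) (γ : SL(2, ℤ)) (τ : ℍ) (z v : Fin l → ℂ) :
    _root_.lineDeriv ℂ (φ (γ • τ)) ((((γ 1 0 : ℤ) : ℂ) * τ + ((γ 1 1 : ℤ) : ℂ))⁻¹ • z) v =
      (((γ 1 0 : ℤ) : ℂ) * τ + ((γ 1 1 : ℤ) : ℂ)) ^ k *
      Complex.exp (t * (Real.pi * Complex.I * (((γ 1 0 : ℤ) : ℂ) * L.form z z /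
        (((γ 1 0 : ℤ) : ℂ) * τ + ((γ 1 1 : ℤ) : ℂ))))) *
      ((((γ 1 0 : ℤ) : ℂ) * τ + ((γ 1 1 : ℤ) : ℂ)) * _root_.lineDeriv ℂ (φ τ) z v +
        (2 * Real.pi * Complex.I * ((γ 1 0 : ℤ) : ℂ) * L.form z v) * (t * φ τ z)) := by
  have hD := denomSL_ne_zero γ τ
  set D := ((γ 1 0 : ℤ) : ℂ) * τ + ((γ 1 1 : ℤ) : ℂ) with hDdef
  set c := ((γ 1 0 : ℤ) : ℂ)
  have h1 : (fun w : ℂ => φ (γ • τ) (D⁻¹ • z + w • v)) = fun w => D ^ k *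
      Complex.exp (t * (Real.pi * Complex.I * (c * (L.form z z + 2 * (w * (D * L.form z v)) +
        w * w * (D * D * L.form v v)) / D))) * φ τ (z + w • (D • v)) := by
    funext w
    have : D⁻¹ • z + w • v = D⁻¹ • (z + w • (D • v)) := by
      rw [smul_add, smul_comm w D v, inv_smul_smul₀ hD]
    rw [this, h.modular, form_add_right, form_add_left, form_add_left]
    simp only [form_smul_right, form_smul_left, L.form_comm v z]
    congr 5
    ring
  have h2 : HasDerivAt (fun w : ℂ => L.form z z + 2 * (w * (D * L.form z v)) +
        w * w * (D * D * L.form v v)) (2 * (D * L.form z v)) 0 := by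
    have := (((((hasDerivAt_id (0 : ℂ)).mul_const (D * L.form z v)).const_mul 2).const_add
      (L.form z z)).add (((hasDerivAt_id (0 : ℂ)).mul (hasDerivAt_id (0 : ℂ))).mul_const
        (D * D * L.form v v)))
    simp only [id, one_mul, zero_mul, mul_zero, mul_one, add_zero] at this
    exact this
  have h3 := ((((((h2.const_mul c).div_const D).const_mul (Real.pi * Complex.I : ℂ)).const_mul
    (t : ℂ)).cexp.const_mul (D ^ k)).mul (h.holo.hasDerivAt_line τ z (D • v)))
  have h4 : _root_.lineDeriv ℂ (φ τ) z (D • v) = D * _root_.lineDeriv ℂ (φ τ) z v := by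
    have hd := h.holo.differentiable_apply τ z
    rw [hd.lineDeriv_eq_fderiv, hd.lineDeriv_eq_fderiv, map_smul, smul_eq_mul]
  rw [_root_.lineDeriv, h1]
  refine h3.deriv.trans ?_
  rw [h4]
  simp only [zero_mul, mul_zero, add_zero, zero_smul]
  field_simp
  ring

theorem lineDeriv_invariant {φ : ℍ → (Fin l → ℂ) → ℂ} {σ : L.orthogonalGroup}
    (h : ∀ τ z, φ τ (L.act σ z) = φ τ z) (τ : ℍ) (z v : Fin l → ℂ) :
    _root_.lineDeriv ℂ (φ τ) z v = _root_.lineDeriv ℂ (φ τ) (L.act σ z) (L.act σ v) := by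
  have : ∀ w : ℂ, L.act σ z + w • L.act σ v = L.act σ (z + w • v) := fun w => by
    simp [act, mulVec_add, mulVec_smul]
  simp only [_root_.lineDeriv, this, h]

/-- The Jacobian of Jacobi forms is Jacobi-like. -/
theorem isJacobiLike_jacobian (h : ∀ j, L.IsJacobiLike (k j) (m j) (φ j)) :
    L.IsJacobiLike (l + ∑ j, k j) (∑ j, m j : ℕ) (jacobian e m φ) := by
  refine ⟨jacobian_mem (holoAlgebra l) (fun j => (h j).holo) fun j i => (h j).holo.lineDeriv _,
    fun γ τ z => ?_, fun x y τ z => ?_⟩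
  · have hD := denomSL_ne_zero γ τ
    rw [jacobian, jacobian]
    rw [det_affine_transform (a := fun j => (((γ 1 0 : ℤ) : ℂ) * τ + ((γ 1 1 : ℤ) : ℂ)) ^ k j *
      Complex.exp ((m j : ℤ) * (Real.pi * Complex.I * (((γ 1 0 : ℤ) : ℂ) * L.form z z /
        (((γ 1 0 : ℤ) : ℂ) * τ + ((γ 1 1 : ℤ) : ℂ))))))
      (T := (((γ 1 0 : ℤ) : ℂ) * τ + ((γ 1 1 : ℤ) : ℂ)) • (1 : Matrix (Fin l) (Fin l) ℂ))
      (c := fun i => 2 * Real.pi * Complex.I * ((γ 1 0 : ℤ) : ℂ) * L.form z (e i))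
      (M := Matrix.of fun (i j : Fin (l + 1)) =>
        (Fin.cases ((m j : ℂ) * φ j τ z) (fun i' => _root_.lineDeriv ℂ (φ j τ) z (e i')) i : ℂ))]
    · rw [Finset.prod_mul_distrib, ← Complex.exp_sum, ← Finset.sum_mul, Matrix.det_smul,
        Matrix.det_one, zpow_add₀ hD, zpow_natCast]
      rw [prod_zpow_eq_zpow_sum hD]
      push_cast
      rw [Fintype.card_fin]
      ring
    · intro j
      simp only [of_apply, Fin.cases_zero]
      rw [(h j).modular]
      ring
    · intro i j
      simp only [of_apply, Fin.cases_zero, Fin.cases_succ]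
      rw [(h j).lineDeriv_modular]
      simp [Matrix.smul_apply, Matrix.one_apply]
  · rw [jacobian, jacobian]
    rw [det_affine_transform (a := fun j => Complex.exp ((m j : ℤ) * -(Real.pi * Complex.I *
        (L.form (incl ℂ x) (incl ℂ x) * τ + 2 * L.form (incl ℂ x) z))))
      (T := 1) (c := fun i => -(2 * Real.pi * Complex.I * L.form (incl ℂ x) (e i)))
      (M := Matrix.of fun (i j : Fin (l + 1)) =>
        (Fin.cases ((m j : ℂ) * φ j τ z) (fun i' => _root_.lineDeriv ℂ (φ j τ) z (e i')) i : ℂ))]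
    · rw [← Complex.exp_sum, ← Finset.sum_mul, Matrix.det_one]
      push_cast
      ring
    · intro j
      simp only [of_apply, Fin.cases_zero]
      rw [(h j).elliptic]
      ring
    · intro i j
      simp only [of_apply, Fin.cases_zero, Fin.cases_succ]
      rw [(h j).lineDeriv_elliptic]
      simp [Matrix.one_apply]

/-- The determinant of `σ ∈ O(L)`. -/
def sgn (σ : L.orthogonalGroup) : ℂ :=
  (((σ : GL (Fin l) ℤ) : Matrix (Fin l) (Fin l) ℤ).det : ℤ)

theorem sgn_mul_self (σ : L.orthogonalGroup) : sgn σ * sgn σ = 1 := by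
  have : IsUnit ((σ : GL (Fin l) ℤ) : Matrix (Fin l) (Fin l) ℤ).det :=
    (Matrix.isUnit_iff_isUnit_det _).1 (Units.isUnit _)
  rw [sgn]
  exact_mod_cast Int.isUnit_mul_self this

/-- By the chain rule the derivative rows are mixed by the transposed matrix of σ in the basis e,
whose determinant is that of σ in any basis. -/
theorem jacobian_act (hφ : ∀ j, IsHolo (φ j)) {σ : L.orthogonalGroup}
    (h : ∀ j τ z, φ j τ (L.act σ z) = φ j τ z) (τ : ℍ) (z : Fin l → ℂ) :
    jacobian e m φ τ (L.act σ z) = sgn σ * jacobian e m φ τ z := by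
  have key : jacobian e m φ τ z = sgn σ * jacobian e m φ τ (L.act σ z) := by
    rw [jacobian, jacobian]
    set A : Matrix (Fin l) (Fin l) ℂ :=
      ((σ : GL (Fin l) ℤ) : Matrix (Fin l) (Fin l) ℤ).map (Int.cast : ℤ → ℂ) with hA
    rw [det_affine_transform (a := fun j => 1) (c := 0)
      (T := (LinearMap.toMatrix e e (Matrix.mulVecLin A))ᵀ)
      (M := Matrix.of fun (i j : Fin (l + 1)) => (Fin.cases ((m j : ℂ) * φ j τ (L.act σ z))
        (fun i' => _root_.lineDeriv ℂ (φ j τ) (L.act σ z) (e i')) i : ℂ))]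
    · rw [det_transpose, LinearMap.det_toMatrix, ← Matrix.toLin'_apply', LinearMap.det_toLin']
      have : A.det = sgn σ := by
        rw [sgn, hA]
        have := (Int.castRingHom ℂ).map_det ((σ : GL (Fin l) ℤ) : Matrix (Fin l) (Fin l) ℤ)
        simpa [RingHom.mapMatrix_apply] using this.symm
      rw [this]
      simp
    · intro j
      simp [h]
    · intro i j
      simp only [of_apply, Fin.cases_zero, Fin.cases_succ]
      rw [lineDeriv_invariant (h j), (hφ j).lineDeriv_eq_sum τ _ _ e]
      simp [LinearMap.toMatrix_apply, act, hA]
  rw [key, ← mul_assoc, sgn_mul_self, one_mul]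

end Jacobian

end EvenLattice

end

noncomputable section

namespace EvenLattice

open Metric Topology Filter

variable {l : ℕ} {L : EvenLattice l}

/-! ### Density of the nonvanishing locus and quotients. -/

section Density

theorem continuous_SL_smul (γ : SL(2, ℤ)) : Continuous (fun τ : ℍ => γ • τ) :=
  continuous_const_smul (γ : GL (Fin 2) ℝ)

theorem IsHolo.continuous {φ : ℍ → (Fin l → ℂ) → ℂ} (h : IsHolo φ) :
    Continuous (fun p : ℍ × (Fin l → ℂ) => φ p.1 p.2) := by
  have := h.continuousOn.comp_continuous
    (f := fun p : ℍ × (Fin l → ℂ) => ((p.1 : ℂ), p.2)) (by fun_prop) (fun p => mem_halfSpace _ _)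
  have h2 : extend φ ∘ (fun p : ℍ × (Fin l → ℂ) => ((p.1 : ℂ), p.2)) = fun p => φ p.1 p.2 :=
    funext fun p => extend_coe φ p.1 p.2
  rwa [h2] at this

theorem IsHolo.dense_ne_zero {φ : ℍ → (Fin l → ℂ) → ℂ} (h : IsHolo φ) (hne : φ ≠ 0) :
    Dense {p : ℍ × (Fin l → ℂ) | φ p.1 p.2 ≠ 0} := by
  obtain ⟨τ₁, h1⟩ := Function.ne_iff.1 hne
  obtain ⟨z₁, h1⟩ := Function.ne_iff.1 h1
  rintro ⟨τ, z⟩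
  have hf := DifferentiableOn.frequently_ne_zero h isOpen_halfSpace convex_halfSpace
    (mem_halfSpace τ₁ z₁) (by rw [extend_coe]; exact h1) (mem_halfSpace τ z)
  have ht : Tendsto (fun p : ℂ × (Fin l → ℂ) => (ofComplex p.1, p.2)) (𝓝 ((τ : ℂ), z))
      (𝓝 (τ, z)) := by
    rw [nhds_prod_eq, nhds_prod_eq]
    refine Tendsto.prodMap ?_ tendsto_id
    have := (contMDiffAt_ofComplex (n := 0) τ.im_pos).continuousAt
    simpa [ContinuousAt, ofComplex_apply] using this
  exact mem_closure_iff_frequently.2 (ht.frequently hf)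

/-- The cancellation rule used throughout: a nonzero holomorphic factor may be divided out of an
identity of continuous functions, because its nonvanishing locus is dense. -/
theorem eq_of_eq_on_ne_zero {φ a b : ℍ → (Fin l → ℂ) → ℂ} (h : IsHolo φ) (hne : φ ≠ 0)
    (ha : Continuous (fun p : ℍ × (Fin l → ℂ) => a p.1 p.2))
    (hb : Continuous (fun p : ℍ × (Fin l → ℂ) => b p.1 p.2))
    (hab : ∀ τ z, φ τ z ≠ 0 → a τ z = b τ z) : a = b := by
  have := Continuous.ext_on (h.dense_ne_zero hne) ha hb fun p hp => hab p.1 p.2 hp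
  funext τ z
  exact congrFun this (τ, z)

/-- The transformation laws of a quotient. -/
theorem IsJacobiLike.quotient {k t k' t' : ℤ} {φ ψ h : ℍ → (Fin l → ℂ) → ℂ}
    (hφ : L.IsJacobiLike k t φ) (hψ : L.IsJacobiLike k' t' ψ) (hne : φ ≠ 0) (hh : IsHolo h)
    (hmul : ∀ τ z, h τ z * φ τ z = ψ τ z) : L.IsJacobiLike (k' - k) (t' - t) h := by
  have hform : Continuous fun z : Fin l → ℂ => L.form z z := by
    unfold form
    fun_prop
  have hform' : ∀ x, Continuous fun z : Fin l → ℂ => L.form x z := fun x => by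
    unfold form
    fun_prop
  refine ⟨hh, fun γ => ?_, fun x y => ?_⟩
  · have hD : ∀ p : ℍ × (Fin l → ℂ), ((γ 1 0 : ℤ) : ℂ) * p.1 + ((γ 1 1 : ℤ) : ℂ) ≠ 0 :=
      fun p => denomSL_ne_zero γ p.1
    have hDc : Continuous fun p : ℍ × (Fin l → ℂ) => ((γ 1 0 : ℤ) : ℂ) * p.1 + ((γ 1 1 : ℤ) : ℂ) := by
      fun_prop
    have key := eq_of_eq_on_ne_zero (a := fun τ z =>
        h (γ • τ) ((((γ 1 0 : ℤ) : ℂ) * τ + ((γ 1 1 : ℤ) : ℂ))⁻¹ • z))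
      (b := fun τ z => (((γ 1 0 : ℤ) : ℂ) * τ + ((γ 1 1 : ℤ) : ℂ)) ^ (k' - k) *
      Complex.exp ((t' - t : ℤ) * (Real.pi * Complex.I * (((γ 1 0 : ℤ) : ℂ) * L.form z z /
        (((γ 1 0 : ℤ) : ℂ) * τ + ((γ 1 1 : ℤ) : ℂ))))) * h τ z) hφ.holo hne ?_ ?_ ?_
    · exact fun τ z => congrFun (congrFun key τ) z
    · exact hh.continuous.comp (f := fun p : ℍ × (Fin l → ℂ) =>
        (γ • p.1, (((γ 1 0 : ℤ) : ℂ) * p.1 + ((γ 1 1 : ℤ) : ℂ))⁻¹ • p.2))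
        (((continuous_SL_smul γ).comp continuous_fst).prodMk
          ((hDc.inv₀ hD).smul continuous_snd))
    · refine ((hDc.zpow₀ _ fun p => Or.inl (hD p)).mul (Complex.continuous_exp.comp ?_)).mul
        hh.continuous
      refine continuous_const.mul (continuous_const.mul (Continuous.div ?_ hDc hD))
      exact continuous_const.mul (hform.comp continuous_snd)
    · intro τ z hz
      have h1 := hmul (γ • τ) ((((γ 1 0 : ℤ) : ℂ) * τ + ((γ 1 1 : ℤ) : ℂ))⁻¹ • z)
      rw [hφ.modular, hψ.modular, ← hmul τ z] at h1
      have hD := denomSL_ne_zero γ τ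
      rw [zpow_sub₀ hD, Int.cast_sub, sub_mul, Complex.exp_sub]
      have hk := zpow_ne_zero k hD
      have he := Complex.exp_ne_zero (t * (Real.pi * Complex.I * (((γ 1 0 : ℤ) : ℂ) * L.form z z /
        (((γ 1 0 : ℤ) : ℂ) * τ + ((γ 1 1 : ℤ) : ℂ)))))
      refine mul_right_cancel₀ (mul_ne_zero (mul_ne_zero hk he) hz) (h1.trans ?_)
      field_simp
  · have key := eq_of_eq_on_ne_zero (a := fun τ z => h τ (z + (τ : ℂ) • incl ℂ x + incl ℂ y))
      (b := fun τ z => Complex.exp ((t' - t : ℤ) * -(Real.pi * Complex.I *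
        (L.form (incl ℂ x) (incl ℂ x) * τ + 2 * L.form (incl ℂ x) z))) * h τ z) hφ.holo hne ?_ ?_ ?_
    · exact fun τ z => congrFun (congrFun key τ) z
    · exact hh.continuous.comp (f := fun p : ℍ × (Fin l → ℂ) =>
        (p.1, p.2 + (p.1 : ℂ) • incl ℂ x + incl ℂ y)) (by fun_prop)
    · refine (Complex.continuous_exp.comp (continuous_const.mul (Continuous.neg
        (continuous_const.mul (Continuous.add (by fun_prop) ?_))))).mul hh.continuous
      exact continuous_const.mul ((hform' _).comp continuous_snd)
    · intro τ z hz
      have h1 := hmul τ (z + (τ : ℂ) • incl ℂ x + incl ℂ y)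
      rw [hφ.elliptic, hψ.elliptic, ← hmul τ z] at h1
      rw [Int.cast_sub, sub_mul, Complex.exp_sub]
      have he := Complex.exp_ne_zero (t * -(Real.pi * Complex.I *
        (L.form (incl ℂ x) (incl ℂ x) * τ + 2 * L.form (incl ℂ x) z)))
      refine mul_right_cancel₀ (mul_ne_zero he hz) (h1.trans ?_)
      field_simp

end Density

/-! ### Vanishing on mirrors and division by a function with simple zeros there. -/

section Mirrors

variable {G : Subgroup L.orthogonalGroup}

theorem corootPairing_add (r : Fin l → ℤ) (z w : Fin l → ℂ) :
    L.corootPairing r (z + w) = L.corootPairing r z + L.corootPairing r w := by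
  rw [corootPairing, form_add_right, corootPairing, corootPairing]
  ring

theorem form_sub_left {R : Type} [CommRing R] (x y z : Fin l → R) :
    L.form (x - y) z = L.form x z - L.form y z :=
  sub_dotProduct ..

theorem corootPairing_smul (r : Fin l → ℤ) (c : ℂ) (z : Fin l → ℂ) :
    L.corootPairing r (c • z) = c * L.corootPairing r z := by
  rw [corootPairing, form_smul_right, corootPairing]
  ring

theorem corootPairing_sub (r : Fin l → ℤ) (z w : Fin l → ℂ) :
    L.corootPairing r (z - w) = L.corootPairing r z - L.corootPairing r w := by
  have := corootPairing_add (L := L) r (z - w) w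
  rw [sub_add_cancel] at this
  rw [this, add_sub_cancel_right]

theorem IsPrimitive.ne_zero {r : Fin l → ℤ} (h : IsPrimitive r) : r ≠ 0 := by
  rintro rfl
  simpa using h 0 0 (by simp)

theorem form_self_ne_zero {r : Fin l → ℤ} (h : r ≠ 0) :
    L.form (incl ℂ r) (incl ℂ r) ≠ 0 := by
  rw [form_incl]
  exact_mod_cast (L.posDef r h).ne'

theorem corootPairing_self {r : Fin l → ℤ} (h : r ≠ 0) : L.corootPairing r (incl ℂ r) = 2 := by
  rw [corootPairing, mul_div_assoc, div_self (form_self_ne_zero h), mul_one]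

/-- A reflection is the identity plus a matrix of rank one, so its determinant is 1 - ⟨r^∨, r⟩ = -1.
-/
theorem sgn_reflection {r : Fin l → ℤ} (h : r ≠ 0) {σ : L.orthogonalGroup}
    (hσ : ∀ v : Fin l → ℂ, L.act σ v = v - L.corootPairing r v • incl ℂ r) : sgn σ = -1 := by
  set A : Matrix (Fin l) (Fin l) ℂ :=
    ((σ : GL (Fin l) ℤ) : Matrix (Fin l) (Fin l) ℤ).map (Int.cast : ℤ → ℂ) with hA
  have hA1 : A = 1 + replicateCol Unit (incl ℂ r) *
      replicateRow Unit (fun i => -L.corootPairing r (Pi.single i 1)) := by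
    ext i j
    have := congrFun (hσ (Pi.single j 1)) i
    rw [act, ← hA, mulVec_single_one] at this
    rw [Matrix.add_apply, Matrix.mul_apply]
    simp only [col_apply] at this
    rw [this]
    simp [Matrix.one_apply, Pi.single_apply, mul_comm, sub_eq_add_neg]
  have hdet : A.det = sgn σ := by
    rw [sgn, hA]
    have := (Int.castRingHom ℂ).map_det ((σ : GL (Fin l) ℤ) : Matrix (Fin l) (Fin l) ℤ)
    simpa [RingHom.mapMatrix_apply] using this.symm
  rw [← hdet, hA1, det_one_add_replicateCol_mul_replicateRow]
  have hsum : L.corootPairing r (incl ℂ r) =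
      ∑ i, incl ℂ r i * L.corootPairing r (Pi.single i 1) := by
    conv_lhs => rw [pi_eq_sum_univ' (incl ℂ r)]
    have : ∀ s : Finset (Fin l), L.corootPairing r (∑ i ∈ s, incl ℂ r i • Pi.single i 1) =
        ∑ i ∈ s, incl ℂ r i * L.corootPairing r (Pi.single i 1) := by
      intro s
      induction s using Finset.induction_on with
      | empty => simp [corootPairing, form]
      | insert i s hi ih =>
        rw [Finset.sum_insert hi, Finset.sum_insert hi, corootPairing_add, corootPairing_smul, ih]
    convert this Finset.univ using 3 with i
  rw [corootPairing_self h] at hsum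
  simp only [dotProduct, neg_mul, Finset.sum_neg_distrib]
  simp only [mul_comm (L.corootPairing r _)]
  rw [← hsum]
  norm_num

/-- Anti-invariant Jacobi forms vanish on the mirrors. -/
theorem IsJacobiLike.eq_zero_of_mem_mirror {k t : ℤ} {φ : ℍ → (Fin l → ℂ) → ℂ}
    (hφ : L.IsJacobiLike k t φ) (hG : ∀ σ ∈ G, ∀ τ z, φ τ (L.act σ z) = sgn σ * φ τ z)
    {r : Fin l → ℤ} (hr : L.IsMirrorVector G r) {τ : ℍ} {z : Fin l → ℂ}
    (hz : (τ, z) ∈ L.mirror r) : φ τ z = 0 := by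
  obtain ⟨hprim, σ, hσG, hσ⟩ := hr
  obtain ⟨a, b, hab⟩ := hz
  simp only at hab
  have hr0 := hprim.ne_zero
  have hQ := form_self_ne_zero (L := L) hr0
  have h1 := hG σ hσG τ z
  rw [sgn_reflection hr0 hσ, hσ, hab] at h1
  -- On the mirror the reflection of z is its translate by the lattice vectors -a r and -b r, so the
  -- elliptic law gives a second formula for the reflected value.
  have h2 : z - (a * (τ : ℂ) + b) • incl ℂ r =
      z + (τ : ℂ) • incl ℂ (-a • r) + incl ℂ (-b • r) := by
    ext i
    simp [incl]
    ring
  have h3 : incl ℂ (-a • r) = (-(a : ℂ)) • incl ℂ r := by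
    ext i
    simp [incl]
  have h4 : L.form (incl ℂ r) z = L.form (incl ℂ r) (incl ℂ r) * (a * (τ : ℂ) + b) / 2 := by
    rw [← hab, corootPairing]
    field_simp
  obtain ⟨q, hq⟩ := L.even r
  have h5 : L.form (incl ℂ r) (incl ℂ r) = 2 * (q : ℂ) := by
    rw [form_incl, hq]
    push_cast
    ring
  rw [h2, hφ.elliptic, h3, form_smul_left, form_smul_right, form_smul_left, h4, h5] at h1
  -- The exponent is 2πi t a b q. Evenness of L enters through ⟨r, r⟩ = 2q with q an integer.
  have h6 : Complex.exp (t * -(Real.pi * Complex.I * (-(a : ℂ) * (-(a : ℂ) * (2 * q)) * τ +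
      2 * (-(a : ℂ) * (2 * q * (a * (τ : ℂ) + b) / 2))))) = 1 := by
    rw [Complex.exp_eq_one_iff]
    refine ⟨t * a * b * q, ?_⟩
    push_cast
    ring
  rw [h6] at h1
  linear_combination h1 / 2

/-- The coordinates of r generate the unit ideal, so a Bézout relation makes r' an integer multiple
of r, and primitivity of r' makes the multiplier a unit. -/
theorem IsPrimitive.eq_or_eq_neg {r r' : Fin l → ℤ} (hr : IsPrimitive r) (hr' : IsPrimitive r')
    (h : ∀ i j, r i * r' j = r j * r' i) : r' = r ∨ r' = -r := by
  obtain ⟨d, hd⟩ := (IsPrincipalIdealRing.principal (Submodule.span ℤ (Set.range r))).principal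
  have hdvd : ∀ i, ∃ s, s * d = r i := fun i => by
    have : r i ∈ Submodule.span ℤ (Set.range r) := Submodule.subset_span ⟨i, rfl⟩
    rw [hd] at this
    exact Submodule.mem_span_singleton.1 this
  choose s hs using hdvd
  have hunit : IsUnit d := hr d s (funext fun i => by simp [← hs i, mul_comm])
  have hmem : d ∈ Submodule.span ℤ (Set.range r) := hd ▸ Submodule.mem_span_singleton_self d
  obtain ⟨u, hu⟩ := (Submodule.mem_span_range_iff_exists_fun ℤ).1 hmem
  have hdd := Int.isUnit_mul_self hunit
  have hr'r : r' = (d * ∑ i, u i * r' i) • r := by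
    funext j
    have h1 : d * r' j = (∑ i, u i * r' i) * r j := by
      rw [← hu, Finset.sum_mul, Finset.sum_mul]
      refine Finset.sum_congr rfl fun i _ => ?_
      rw [smul_eq_mul, mul_assoc, h i j]
      ring
    rw [Pi.smul_apply, smul_eq_mul, mul_assoc, ← h1, ← mul_assoc, hdd, one_mul]
  rcases Int.isUnit_iff.1 (hr' _ _ hr'r) with h1 | h1
  · left
    rw [hr'r, h1, one_smul]
  · right
    rw [hr'r, h1, neg_one_smul]

theorem isOpen_form_ne (x : Fin l → ℂ) (α : ℂ) : IsOpen {z | L.form x z ≠ α} := by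
  have : Continuous fun z : Fin l → ℂ => L.form x z := by
    unfold form
    fun_prop
  exact isOpen_ne_fun this continuous_const

theorem dense_form_ne {x : Fin l → ℂ} (hx : x ≠ 0) (α : ℂ) : Dense {z | L.form x z ≠ α} := by
  obtain ⟨y, hy⟩ := L.exists_form_ne_zero hx
  intro z
  by_cases hz : L.form x z = α
  · have ht : Tendsto (fun w : ℂ => z + w • y) (𝓝[≠] 0) (𝓝 z) := by
      have : Continuous fun w : ℂ => z + w • y := by fun_prop
      have := this.tendsto 0
      rw [zero_smul, add_zero] at this
      exact this.mono_left nhdsWithin_le_nhds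
    refine mem_closure_of_tendsto ht ?_
    filter_upwards [self_mem_nhdsWithin] with w hw
    simp only [form_add_right, form_smul_right, hz]
    simpa using ⟨hw, hy⟩
  · exact subset_closure hz

/-- There is a direction which is not parallel to any mirror. -/
theorem exists_generic_direction (L : EvenLattice l) :
    ∃ v : Fin l → ℂ, ∀ r : Fin l → ℤ, r ≠ 0 → L.corootPairing r v ≠ 0 := by
  have := dense_iInter_of_isOpen (f := fun r : {r : Fin l → ℤ // r ≠ 0} =>
    {z | L.form (incl ℂ r.1) z ≠ 0}) (fun r => isOpen_form_ne _ _) (fun r => dense_form_ne (by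
      intro h
      exact r.2 (incl_injective ℂ (h.trans (by ext; simp [incl])))) 0)
  obtain ⟨v, hv⟩ := this.nonempty
  refine ⟨v, fun r hr => ?_⟩
  have := Set.mem_iInter.1 hv ⟨r, hr⟩
  rw [corootPairing]
  exact div_ne_zero (mul_ne_zero two_ne_zero this) (form_self_ne_zero hr)

/-- Almost all lines in a generic direction meet the mirrors only in points that lie on a single
mirror. -/
theorem dense_good_lines {v : Fin l → ℂ} (hv : ∀ r : Fin l → ℤ, r ≠ 0 → L.corootPairing r v ≠ 0)
    (τ : ℍ) : Dense {z : Fin l → ℂ | ∀ (w : ℂ) (r r' : Fin l → ℤ), IsPrimitive r → IsPrimitive r' →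
      (τ, z + w • v) ∈ L.mirror r → (τ, z + w • v) ∈ L.mirror r' → r' = r ∨ r' = -r} := by
  -- Eliminating w from the two mirror equations leaves one affine condition ⟨X, z⟩ = const on z. It
  -- is a proper condition unless r and r' are proportional, and there are countably many of them,
  -- so Baire's theorem applies.
  set X : (Fin l → ℤ) → (Fin l → ℤ) → Fin l → ℂ := fun r r' =>
    (L.corootPairing r' v * (2 / L.form (incl ℂ r) (incl ℂ r))) • incl ℂ r -
      (L.corootPairing r v * (2 / L.form (incl ℂ r') (incl ℂ r'))) • incl ℂ r' with hX
  have hform : ∀ r r' z, L.form (X r r') z =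
      L.corootPairing r' v * L.corootPairing r z - L.corootPairing r v * L.corootPairing r' z := by
    intro r r' z
    rw [hX]
    simp only [form_sub_left, form_smul_left]
    simp only [corootPairing]
    ring
  have key : Dense (⋂ q : {q : (Fin l → ℤ) × (Fin l → ℤ) // X q.1 q.2 ≠ 0} × (ℤ × ℤ × ℤ × ℤ),
      {z | L.form (X q.1.1.1 q.1.1.2) z ≠ L.corootPairing q.1.1.2 v * (q.2.1 * τ + q.2.2.1) -
        L.corootPairing q.1.1.1 v * (q.2.2.2.1 * τ + q.2.2.2.2)}) :=
    dense_iInter_of_isOpen (fun q => isOpen_form_ne _ _) (fun q => dense_form_ne q.1.2 _)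
  refine key.mono fun z hz w r r' hr hr' h1 h2 => ?_
  by_contra hne
  have hX0 : X r r' ≠ 0 := by
    intro h0
    apply hne
    refine hr.eq_or_eq_neg hr' fun i j => ?_
    have e : ∀ i, (L.corootPairing r' v * (2 / L.form (incl ℂ r) (incl ℂ r))) * (r i : ℂ) =
        (L.corootPairing r v * (2 / L.form (incl ℂ r') (incl ℂ r'))) * (r' i : ℂ) := by
      intro i
      have := congrFun h0 i
      simpa [hX, incl, sub_eq_zero] using this
    have hβ : L.corootPairing r' v * (2 / L.form (incl ℂ r) (incl ℂ r)) ≠ 0 :=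
      mul_ne_zero (hv r' hr'.ne_zero) (div_ne_zero two_ne_zero (form_self_ne_zero hr.ne_zero))
    have : (r i : ℂ) * r' j = r j * r' i := by
      refine mul_left_cancel₀ hβ ?_
      linear_combination (r' j : ℂ) * e i - (r' i : ℂ) * e j
    exact_mod_cast this
  obtain ⟨a, b, hab⟩ := h1
  obtain ⟨a', b', hab'⟩ := h2
  have := Set.mem_iInter.1 hz (⟨(r, r'), hX0⟩, (a, b, a', b'))
  apply this
  simp only at hab hab'
  rw [corootPairing_add, corootPairing_smul] at hab hab'
  simp only
  rw [hform, ← hab, ← hab']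
  ring

variable {F : ℍ → (Fin l → ℂ) → ℂ}

/-- F vanishes along the mirror, so its derivative sees only the component of v in the direction r,
where the zero has order one. -/
theorem VanishesSimplyOnMirrors.lineDeriv_ne_zero (hF : L.VanishesSimplyOnMirrors G F)
    (hh : IsHolo F) {v : Fin l → ℂ} {r : Fin l → ℤ} (hv : L.corootPairing r v ≠ 0)
    (hr : L.IsMirrorVector G r) {τ : ℍ} {z : Fin l → ℂ} (hz : (τ, z) ∈ L.mirror r)
    (huniq : ∀ r', L.IsMirrorVector G r' → (τ, z) ∈ L.mirror r' → r' = r ∨ r' = -r) :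
    _root_.lineDeriv ℂ (F τ) z v ≠ 0 := by
  have hr0 := hr.1.ne_zero
  have h1 := hF.order_eq_one r τ z hr hz huniq
  have hd := hh.differentiable_apply τ z
  have hr1 : _root_.lineDeriv ℂ (F τ) z (incl ℂ r) ≠ 0 := by
    have han : AnalyticAt ℂ (fun w : ℂ => F τ (z + w • incl ℂ r)) 0 :=
      (hh.comp_line τ z (incl ℂ r)).analyticAt 0
    obtain ⟨g, hg, hg0, hev⟩ := (han.analyticOrderAt_eq_natCast (n := 1)).1 (by simpa using h1)
    have : HasDerivAt (fun w : ℂ => (w - 0) ^ 1 • g w) (g 0) 0 := by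
      have := ((hasDerivAt_id (0 : ℂ)).mul hg.differentiableAt.hasDerivAt)
      simp only [id, one_mul, zero_mul, add_zero] at this
      refine this.congr_of_eventuallyEq (Eventually.of_forall fun w => ?_)
      simp
    have h2 := this.congr_of_eventuallyEq hev
    rw [_root_.lineDeriv, h2.deriv]
    exact hg0
  set u := v - (L.corootPairing r v / 2) • incl ℂ r with hu
  have hu0 : _root_.lineDeriv ℂ (F τ) z u = 0 := by
    have : (fun w : ℂ => F τ (z + w • u)) = fun _ => 0 := by
      funext w
      rw [hF.zero_iff]
      refine ⟨r, hr, ?_⟩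
      obtain ⟨a, b, hab⟩ := hz
      refine ⟨a, b, ?_⟩
      simp only at hab ⊢
      have : L.corootPairing r u = 0 := by
        rw [hu, corootPairing_sub, corootPairing_smul, corootPairing_self hr0]
        ring
      rw [corootPairing_add, corootPairing_smul, this, hab]
      ring
    rw [_root_.lineDeriv, this, deriv_const]
  rw [hd.lineDeriv_eq_fderiv] at hr1 hu0 ⊢
  have : v = u + (L.corootPairing r v / 2) • incl ℂ r := by
    rw [hu]
    abel
  rw [this, map_add, hu0, zero_add, map_smul]
  exact mul_ne_zero (div_ne_zero hv two_ne_zero) hr1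

/-- A holomorphic function vanishing on the mirrors is divisible by a function with simple zeros
on the mirrors. -/
theorem VanishesSimplyOnMirrors.exists_quotient (hF : L.VanishesSimplyOnMirrors G F)
    (hh : IsHolo F) (hne : F ≠ 0) {f : ℍ → (Fin l → ℂ) → ℂ} (hf : IsHolo f)
    (hf0 : ∀ r, L.IsMirrorVector G r → ∀ τ z, (τ, z) ∈ L.mirror r → f τ z = 0) :
    ∃ h, IsHolo h ∧ ∀ τ z, h τ z * F τ z = f τ z := by
  obtain ⟨v, hv⟩ := exists_generic_direction L
  obtain ⟨τ₁, h1⟩ := Function.ne_iff.1 hne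
  obtain ⟨z₁, h1⟩ := Function.ne_iff.1 h1
  have hline : ∀ (τ : ℍ) (z : Fin l → ℂ) (w : ℂ), ((τ : ℂ), z) + w • ((0 : ℂ), v) =
      ((τ : ℂ), z + w • v) := fun τ z w => by simp
  have hloc : ∀ p ∈ halfSpace l, ∃ V ∈ 𝓝 p, ∃ h : ℂ × (Fin l → ℂ) → ℂ,
      DifferentiableOn ℂ h V ∧ ∀ x ∈ V, h x * extend F x = extend f x := by
    rintro ⟨τ', z⟩ hp
    obtain ⟨τ, rfl⟩ : ∃ τ : ℍ, (τ : ℂ) = τ' := ⟨⟨τ', hp⟩, rfl⟩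
    refine exists_local_quotient (v := ((0 : ℂ), v)) isOpen_halfSpace hf hh hp ?_ ?_
    · intro hev
      simp only [hline, extend_coe] at hev
      -- The parameters at which the line meets a mirror form a countable set, which contains no
      -- neighbourhood of 0.
      set S : Set ℂ := Set.range fun q : {r : Fin l → ℤ // r ≠ 0} × ℤ × ℤ =>
        (q.2.1 * (τ : ℂ) + q.2.2 - L.corootPairing q.1.1 z) / L.corootPairing q.1.1 v with hS
      have hSd : Dense Sᶜ := (Set.countable_range _).dense_compl ℂ
      obtain ⟨O, hOs, hO, h0O⟩ := _root_.mem_nhds_iff.1 hev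
      obtain ⟨w, hwS, hwO⟩ := hSd.exists_mem_open hO ⟨0, h0O⟩
      obtain ⟨r, hr, a, b, hab⟩ := (hF.zero_iff _ _).1 (hOs hwO)
      refine hwS ⟨(⟨r, hr.1.ne_zero⟩, a, b), ?_⟩
      simp only at hab ⊢
      rw [← hab, corootPairing_add, corootPairing_smul]
      have := hv r hr.1.ne_zero
      field_simp
      ring
    · rintro V hVU hVo ⟨⟨τ', z'⟩, hz'⟩
      obtain ⟨τ', rfl⟩ : ∃ τ : ℍ, (τ : ℂ) = τ' := ⟨⟨τ', hVU hz'⟩, rfl⟩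
      obtain ⟨y, hy, hyV⟩ := (dense_good_lines hv τ').exists_mem_open
        (hVo.preimage (f := fun y : Fin l → ℂ => ((τ' : ℂ), y)) (by fun_prop)) ⟨z', hz'⟩
      refine ⟨_, hyV, fun w _ hw0 => ?_⟩
      rw [hline, extend_coe] at hw0 ⊢
      obtain ⟨r, hr, hrm⟩ := (hF.zero_iff _ _).1 hw0
      refine ⟨hf0 r hr _ _ hrm, ?_⟩
      simp only [hline, extend_coe]
      have hne := hF.lineDeriv_ne_zero hh (hv r hr.1.ne_zero) hr hrm
        fun r' hr' hrm' => hy w r r' hr.1 hr'.1 hrm hrm'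
      have h2 := hh.hasDerivAt_line τ' (y + w • v) v
      have h3 : HasDerivAt (fun s : ℂ => F τ' (y + s • v))
          (_root_.lineDeriv ℂ (F τ') (y + w • v) v) w := by
        have h4 := HasDerivAt.comp_sub_const (f := fun s : ℂ => F τ' (y + w • v + s • v)) w w
          (by rwa [sub_self])
        refine h4.congr_of_eventuallyEq (Eventually.of_forall fun s => ?_)
        simp only
        congr 1
        rw [sub_smul]
        abel
      rw [h3.deriv]
      exact hne
  obtain ⟨h, hhd, hmul⟩ := exists_quotient_of_forall_exists_local (f := extend f) (F := extend F)
    isOpen_halfSpace convex_halfSpace hh (mem_halfSpace τ₁ z₁) (by rw [extend_coe]; exact h1) hloc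
  refine ⟨fun τ z => h ((τ : ℂ), z), ?_, fun τ z => ?_⟩
  · refine DifferentiableOn.congr hhd fun p hp => ?_
    rw [extend_of_mem _ hp]
  · have := hmul _ (mem_halfSpace τ z)
    rwa [extend_coe, extend_coe] at this

end Mirrors

end EvenLattice

end

/-! ### Forms of index at most zero. -/

noncomputable section

open Metric Topology Filter

/-- Entire functions which are almost doubly periodic are constant. -/
theorem Differentiable.apply_eq_apply_of_quasiperiodic {f : ℂ → ℂ} (hf : Differentiable ℂ f)
    {τ : ℍ} {C : ℝ} (h1 : ∀ (n : ℤ) w, f (w + n) = f w)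
    (h2 : ∀ (n : ℤ) (w : ℂ), |w.im| ≤ τ.im → ‖f (w + n * τ)‖ ≤ C * ‖f w‖) (w w' : ℂ) :
    f w = f w' := by
  refine hf.apply_eq_apply_of_bounded ?_ w w'
  have hK : IsCompact (Set.Icc (0 : ℝ) 1 ×ℂ Set.Icc 0 τ.im) := isCompact_Icc.reProdIm isCompact_Icc
  obtain ⟨B, hB⟩ := hK.exists_bound_of_continuousOn hf.continuous.continuousOn
  refine (isBounded_iff_forall_norm_le).2 ⟨|C| * B, ?_⟩
  rintro _ ⟨w, rfl⟩
  have hy := τ.im_pos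
  set n := ⌊w.im / τ.im⌋ with hn
  have e1 := Int.floor_le (w.im / τ.im)
  have e2 := Int.lt_floor_add_one (w.im / τ.im)
  rw [le_div_iff₀ hy] at e1
  rw [div_lt_iff₀ hy] at e2
  set u := w - n * τ with hu
  have him : u.im = w.im - n * τ.im := by simp [hu]
  have hw : w = u + n * τ := by rw [hu]; ring
  have h3 := h2 n u (by rw [him, abs_of_nonneg (by linarith)]; rw [← hn] at e2; linarith)
  rw [← hw] at h3
  set v := u + ((-⌊u.re⌋ : ℤ) : ℂ) with hv
  have h4 : f v = f u := h1 _ _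
  have h5 := hB v (by
    rw [Complex.mem_reProdIm]
    have := Int.floor_le u.re
    have := Int.lt_floor_add_one u.re
    have hre : v.re = u.re - ⌊u.re⌋ := by simp [hv, sub_eq_add_neg]
    have hvim : v.im = w.im - n * τ.im := by simp [hv, him]
    rw [hre, hvim]
    rw [← hn] at e1 e2
    refine ⟨⟨?_, ?_⟩, ⟨?_, ?_⟩⟩ <;> linarith)
  rw [h4] at h5
  calc ‖f w‖ ≤ C * ‖f u‖ := h3
    _ ≤ |C| * ‖f u‖ := by gcongr; exact le_abs_self C
    _ ≤ |C| * B := by gcongr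

namespace EvenLattice

variable {l : ℕ} {L : EvenLattice l} {k t : ℤ} {φ : ℍ → (Fin l → ℂ) → ℂ}

theorem gram_diag_pos (L : EvenLattice l) (i : Fin l) : 0 < L.gram i i := by
  have := L.posDef (Pi.single i 1) (by simp)
  simpa using this

theorem form_single_single (i : Fin l) :
    L.form (Pi.single i (1 : ℂ)) (Pi.single i 1) = L.gram i i := by
  simp [form]

theorem IsJacobiLike.apply_add_int_mul (h : L.IsJacobiLike k t φ) (i : Fin l) (n : ℤ) (τ : ℍ)
    (z : Fin l → ℂ) (w : ℂ) :
    φ τ (z + (w + n * τ) • Pi.single i 1) = Complex.exp (t * -(Real.pi * Complex.I *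
      (n ^ 2 * L.gram i i * τ + 2 * n * (L.form (Pi.single i 1) z + w * L.gram i i)))) *
      φ τ (z + w • Pi.single i 1) := by
  have h1 : incl ℂ (Pi.single i n) = (n : ℂ) • Pi.single i 1 := by
    ext j
    by_cases hj : j = i
    · subst hj; simp [incl]
    · simp [incl, hj]
  have h2 := h.elliptic (Pi.single i n) 0 τ (z + w • Pi.single i 1)
  have h3 : z + w • Pi.single i 1 + (τ : ℂ) • incl ℂ (Pi.single i n) + incl ℂ 0 =
      z + (w + n * τ) • Pi.single i 1 := by
    rw [h1]
    ext j
    simp [incl]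
    ring
  rw [h3, h1, form_smul_left, form_smul_right, form_smul_left, form_add_right, form_smul_right,
    form_single_single] at h2
  rw [h2]
  ring_nf

theorem IsJacobiLike.apply_add_incl (h : L.IsJacobiLike k t φ) (y : Fin l → ℤ) (τ : ℍ)
    (z : Fin l → ℂ) : φ τ (z + incl ℂ y) = φ τ z := by
  have h2 := h.elliptic 0 y τ z
  have h0 : incl ℂ (0 : Fin l → ℤ) = 0 := by
    ext
    simp [incl]
  simpa [h0, form] using h2

/-- For t ≤ 0 the automorphy factors of the translations nτ are bounded uniformly in n, so the
restriction to a line is a bounded entire function and Liouville's theorem applies. -/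
theorem IsJacobiLike.apply_add_smul_single (h : L.IsJacobiLike k t φ) (ht : t ≤ 0) (i : Fin l)
    (τ : ℍ) (z : Fin l → ℂ) (w : ℂ) : φ τ (z + w • Pi.single i 1) = φ τ z := by
  have hQ : (0 : ℝ) < L.gram i i := by exact_mod_cast L.gram_diag_pos i
  have hy := τ.im_pos
  set β := L.form (Pi.single i 1) z with hβ
  set D : ℝ := |β.im| + τ.im * L.gram i i with hD
  have key := (h.holo.comp_line τ z (Pi.single i 1)).apply_eq_apply_of_quasiperiodic (τ := τ)
    (C := Real.exp (-t * Real.pi * (D ^ 2 / (L.gram i i * τ.im)))) ?_ ?_ w 0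
  · simpa using key
  · intro n w
    have h1 : z + (w + n) • Pi.single i 1 = z + w • Pi.single i 1 + incl ℂ (Pi.single i n) := by
      ext j
      by_cases hj : j = i
      · subst hj; simp [incl]; ring
      · simp [incl, hj]
    rw [h1, h.apply_add_incl]
  · intro n w hw
    rw [h.apply_add_int_mul, norm_mul, Complex.norm_exp]
    refine mul_le_mul_of_nonneg_right (Real.exp_le_exp.2 ?_) (norm_nonneg _)
    have hre : (t * -(Real.pi * Complex.I *
      (n ^ 2 * L.gram i i * τ + 2 * n * (β + w * L.gram i i))) : ℂ).re =
        t * Real.pi * (n ^ 2 * L.gram i i * τ.im + 2 * n * (β.im + w.im * L.gram i i)) := by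
      have : (t * -(Real.pi * Complex.I *
        (n ^ 2 * L.gram i i * τ + 2 * n * (β + w * L.gram i i))) : ℂ) =
        ((-t * Real.pi : ℝ) : ℂ) * (((n ^ 2 * L.gram i i : ℝ) : ℂ) * τ +
          ((2 * n : ℝ) : ℂ) * (β + w * ((L.gram i i : ℝ) : ℂ))) * Complex.I := by
        push_cast
        ring
      rw [this, Complex.mul_I_re, Complex.im_ofReal_mul, Complex.add_im, Complex.im_ofReal_mul,
        Complex.im_ofReal_mul, Complex.add_im, Complex.im_mul_ofReal]
      simp only [coe_im]
      ring
    rw [hre]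
    set b := β.im + w.im * L.gram i i with hb
    have hbD : b ^ 2 ≤ D ^ 2 := by
      refine sq_le_sq' ?_ ?_
      · have h1 := neg_abs_le β.im
        have h2 := (abs_le.1 hw).1
        rw [hb, hD]
        nlinarith
      · have h1 := le_abs_self β.im
        have h2 := (abs_le.1 hw).2
        rw [hb, hD]
        nlinarith
    -- Completing the square in n, with |b| ≤ D on the strip.
    have hlow : -(D ^ 2 / (L.gram i i * τ.im)) ≤ n ^ 2 * L.gram i i * τ.im + 2 * n * b := by
      rw [neg_le_iff_add_nonneg, ← sub_nonneg]
      have : 0 ≤ (n * (L.gram i i * τ.im) + b) ^ 2 / (L.gram i i * τ.im) := by positivity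
      have h3 : b ^ 2 / (L.gram i i * τ.im) ≤ D ^ 2 / (L.gram i i * τ.im) := by gcongr
      have h4 : (n * (L.gram i i * τ.im) + b) ^ 2 / (L.gram i i * τ.im) =
          n ^ 2 * L.gram i i * τ.im + 2 * n * b + b ^ 2 / (L.gram i i * τ.im) := by
        field_simp
        ring
      linarith
    have htp : 0 ≤ -(t : ℝ) * Real.pi := by
      have : (t : ℝ) ≤ 0 := by exact_mod_cast ht
      have := Real.pi_pos
      nlinarith
    nlinarith

/-- Jacobi forms of negative index vanish. -/
theorem IsJacobiLike.eq_zero_of_neg (h : L.IsJacobiLike k t φ) (hl : 0 < l) (ht : t < 0) :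
    φ = 0 := by
  funext τ z
  let i : Fin l := ⟨0, hl⟩
  have hQ : (L.gram i i : ℂ) ≠ 0 := by exact_mod_cast (L.gram_diag_pos i).ne'
  have htc : (t : ℂ) ≠ 0 := by exact_mod_cast ht.ne
  have hconst := h.apply_add_smul_single ht.le i τ z
  have h1 : ∀ w : ℂ, φ τ z = Complex.exp (t * -(Real.pi * Complex.I *
      (L.gram i i * τ + 2 * (L.form (Pi.single i 1) z + w * L.gram i i)))) * φ τ z := fun w => by
    have := h.apply_add_int_mul i 1 τ z w
    rw [hconst, hconst] at this
    simpa using this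
  by_contra hne
  simp only [Pi.zero_apply] at hne
  have h2 : ∀ w : ℂ, Complex.exp (t * -(Real.pi * Complex.I *
      (L.gram i i * τ + 2 * (L.form (Pi.single i 1) z + w * L.gram i i)))) = 1 := fun w =>
    mul_right_cancel₀ hne ((h1 w).symm.trans (one_mul _).symm)
  -- This shift of w raises the exponent by 1, so both exp(x) = 1 and exp(x + 1) = 1 would hold.
  have h3 := h2 (-1 / (2 * Real.pi * Complex.I * t * L.gram i i))
  have hpi : (Real.pi : ℂ) ≠ 0 := by exact_mod_cast Real.pi_ne_zero
  have h4 : (t * -(Real.pi * Complex.I * (L.gram i i * τ + 2 * (L.form (Pi.single i 1) z +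
      -1 / (2 * Real.pi * Complex.I * t * L.gram i i) * L.gram i i))) : ℂ) =
      t * -(Real.pi * Complex.I * (L.gram i i * τ + 2 * (L.form (Pi.single i 1) z +
        0 * L.gram i i))) + 1 := by
    have := Complex.I_ne_zero
    field_simp
    ring
  rw [h4, Complex.exp_add, h2 0, one_mul] at h3
  have h5 := congrArg norm h3
  rw [Complex.norm_exp] at h5
  simp at h5

/-- Jacobi forms of index zero do not depend on `z`. -/
theorem IsJacobiLike.apply_eq_apply (h : L.IsJacobiLike k 0 φ) (τ : ℍ) (z z' : Fin l → ℂ) :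
    φ τ z = φ τ z' := by
  refine is_const_of_fderiv_eq_zero (𝕜 := ℂ) (h.holo.differentiable_apply τ) (fun z => ?_) z z'
  ext v
  have hd := h.holo.differentiable_apply τ z
  rw [← hd.lineDeriv_eq_fderiv, h.holo.lineDeriv_eq_sum τ z v (Pi.basisFun ℂ (Fin l))]
  refine Finset.sum_eq_zero fun i _ => ?_
  rw [_root_.lineDeriv, Pi.basisFun_apply]
  simp [h.apply_add_smul_single le_rfl i τ z]

-- Setting z = 0 loses nothing in index zero. Boundedness at i∞ comes from the Fourier expansion,
-- and modular invariance carries it to every cusp.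
open scoped ModularForm in
theorem IsJacobiLike.exists_modularForm (h : L.IsJacobiLike k 0 φ)
    (hF : ∃ f, L.IsFourierExpansion f φ) : ∃ g : ModularForm 𝒮ℒ k, ∀ τ z, φ τ z = g τ := by
  have hslash : ∀ γ : SL(2, ℤ), (fun τ => φ τ 0) ∣[k] γ = fun τ => φ τ 0 := by
    intro γ
    funext τ
    have := h.modular γ τ 0
    rw [smul_zero] at this
    have hD := denomSL_ne_zero γ τ
    have h2 : UpperHalfPlane.denom γ τ = ((γ 1 0 : ℤ) : ℂ) * τ + ((γ 1 1 : ℤ) : ℂ) := by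
      simp [UpperHalfPlane.denom]
    rw [ModularForm.SL_slash_apply, this, h2, _root_.zpow_neg]
    field_simp
    simp
  refine ⟨{ toFun := fun τ => φ τ 0
            slash_action_eq' := ?_
            holo' := ?_
            bdd_at_cusps' := ?_ }, fun τ z => h.apply_eq_apply τ z 0⟩
  · rintro _ ⟨γ, rfl⟩
    exact hslash γ
  · refine UpperHalfPlane.mdifferentiable_iff.2 ?_
    exact DifferentiableOn.comp (g := extend φ) h.holo (f := fun τ : ℂ => (τ, (0 : Fin l → ℂ)))
      (by fun_prop) (fun τ hτ => hτ)
  · intro c hc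
    rw [OnePoint.isBoundedAt_iff_forall_SL2Z hc]
    intro γ _
    have h1 : (fun τ => φ τ 0) ∣[k] γ = fun τ => φ τ 0 := hslash γ
    obtain ⟨f, hf⟩ := hF
    obtain ⟨C, hC⟩ := hf.exists_norm_le one_pos 0
    simp only [h1]
    refine isBoundedAtImInfty_iff.2 ⟨C, 1, fun τ hτ => hC τ 0 hτ (by simp)⟩

end EvenLattice

end

/-! ### Division of Jacobians and the basic expansion. -/

noncomputable section

namespace EvenLattice

open Metric Topology Filter

variable {l : ℕ} {L : EvenLattice l} {G : Subgroup L.orthogonalGroup}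
  {e : Module.Basis (Fin l) ℂ (Fin l → ℂ)}

theorem IsJacobiLike.apply_int_vadd {k t : ℤ} {φ : ℍ → (Fin l → ℂ) → ℂ} (h : L.IsJacobiLike k t φ)
    (n : ℤ) (τ : ℍ) (z : Fin l → ℂ) : φ ((n : ℝ) +ᵥ τ) z = φ τ z := by
  have := h.modular (ModularGroup.T ^ n) τ z
  rw [UpperHalfPlane.modular_T_zpow_smul] at this
  simpa [ModularGroup.coe_T_zpow] using this

/-- A function with a nonzero Fourier coefficient `f(0, v)` is nonzero. -/
theorem IsFourierExpansion.ne_zero {f : ℕ → L.dual → ℂ} {φ : ℍ → (Fin l → ℂ) → ℂ}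
    (hf : L.IsFourierExpansion f φ) {v : L.dual} (hv : f 0 v ≠ 0) : φ ≠ 0 := by
  rintro rfl
  -- If φ were zero, the unbounded function τ would be a holomorphic quotient of φ by φ, whereas
  -- such quotients are bounded at i∞.
  have hh : IsHolo (fun (τ : ℍ) (_ : Fin l → ℂ) => (τ : ℂ)) := by
    refine DifferentiableOn.congr (f := Prod.fst) differentiableOn_fst fun p hp => ?_
    rw [extend_of_mem _ hp]
  obtain ⟨N, hN, Y, C, hC⟩ := exists_norm_le_of_mul_eq hh hf hf hv (by simp) 0
  let τ : ℍ := ⟨(|Y| + |C| + 1 : ℝ) * Complex.I, by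
    rw [Complex.im_ofReal_mul, Complex.I_im]
    positivity⟩
  have hτ : τ.im = |Y| + |C| + 1 := by
    change ((|Y| + |C| + 1 : ℝ) * Complex.I).im = _
    simp
  have h1 := hC τ 0 (by rw [hτ]; linarith [le_abs_self Y, abs_nonneg C]) (mem_of_mem_nhds hN)
  have h2 := (Complex.abs_im_le_norm (τ : ℂ)).trans h1
  rw [coe_im, hτ] at h2
  linarith [le_abs_self (|Y| + |C| + 1), le_abs_self C, abs_nonneg Y]

variable {kHat : ℤ} {m₀ : ℕ} {F : ℍ → (Fin l → ℂ) → ℂ}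

/-- `F` is a weak Jacobi form of weight `kHat` and index `m₀` by which Jacobians of `G`-invariant
weak Jacobi forms may be divided. -/
structure IsJacobianDivisor (G : Subgroup L.orthogonalGroup) (kHat : ℤ) (m₀ : ℕ)
    (F : ℍ → (Fin l → ℂ) → ℂ) : Prop where
  weakJacobi : L.IsWeakJacobiForm ⊥ kHat m₀ F
  mirrors : L.VanishesSimplyOnMirrors G F
  constTerm : ∃ f : ℕ → L.dual → ℂ, L.IsFourierExpansion f F ∧ ∃ v, f 0 v ≠ 0

theorem IsJacobianDivisor.ne_zero (hF : IsJacobianDivisor G kHat m₀ F) : F ≠ 0 := by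
  obtain ⟨f, hf, v, hv⟩ := hF.constTerm
  exact hf.ne_zero hv

variable {k : Fin (l + 1) → ℤ} {m : Fin (l + 1) → ℕ} {φ : Fin (l + 1) → ℍ → (Fin l → ℂ) → ℂ}

theorem IsJacobianDivisor.exists_quotient (hF : IsJacobianDivisor G kHat m₀ F)
    (hφ : ∀ j, L.IsWeakJacobiForm G (k j) (m j) (φ j)) :
    ∃ h, L.IsJacobiLike (l + ∑ j, k j - kHat) ((∑ j, m j : ℕ) - m₀) h ∧
      (∃ f, L.IsFourierExpansion f h) ∧ ∀ τ z, h τ z * F τ z = jacobian e m φ τ z := by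
  have hJ := isJacobiLike_jacobian (e := e) fun j => (hφ j).isJacobiLike
  have hFh := hF.weakJacobi.isJacobiLike
  obtain ⟨h, hh, hmul⟩ := hF.mirrors.exists_quotient hFh.holo hF.ne_zero hJ.holo
    fun r hr τ z hz => hJ.eq_zero_of_mem_mirror (G := G)
      (fun σ hσ => jacobian_act (fun j => (hφ j).holomorphic) fun j => (hφ j).invariant σ hσ) hr hz
  have hq := IsJacobiLike.quotient hFh hJ hF.ne_zero hh hmul
  obtain ⟨f, hf, v, hv⟩ := hF.constTerm
  obtain ⟨g, hg⟩ : jacobian e m φ ∈ L.fourierAlgebra :=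
    jacobian_mem _ (fun j => (hφ j).fourier) fun j i => by
      obtain ⟨f, hf⟩ := (hφ j).fourier
      exact hf.exists_lineDeriv _
  refine ⟨h, hq, exists_isFourierExpansion hh hq.apply_int_vadd hq.apply_add_incl fun z₀ => ?_, hmul⟩
  exact exists_norm_le_of_mul_eq hh hf hg hv hmul z₀

theorem IsJacobianDivisor.exists_modularForm (hF : IsJacobianDivisor G kHat m₀ F)
    (hφ : ∀ j, L.IsWeakJacobiForm G (k j) (m j) (φ j)) (hm : ∑ j, m j = m₀) :
    ∃ g : ModularForm 𝒮ℒ (l + ∑ j, k j - kHat), ∀ τ z, jacobian e m φ τ z = g τ * F τ z := by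
  obtain ⟨h, hq, hf, hmul⟩ := hF.exists_quotient (e := e) hφ
  rw [hm, sub_self] at hq
  obtain ⟨g, hg⟩ := hq.exists_modularForm hf
  exact ⟨g, fun τ z => by rw [← hmul, hg]⟩

theorem continuous_act (σ : L.orthogonalGroup) : Continuous (L.act σ) := by
  unfold act
  fun_prop

/-- F is assumed to be a form for the trivial group only. Its behaviour under G is inherited from J
= g F, since g does not depend on z. -/
theorem IsJacobianDivisor.apply_act (hF : IsJacobianDivisor G kHat m₀ F)
    (hφ : ∀ j, L.IsWeakJacobiForm G (k j) (m j) (φ j)) (hm : ∑ j, m j = m₀)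
    (hJ : jacobian e m φ ≠ 0) (σ : L.orthogonalGroup) (hσ : σ ∈ G) (τ : ℍ) (z : Fin l → ℂ) :
    F τ (L.act σ z) = sgn σ * F τ z := by
  obtain ⟨g, hg⟩ := hF.exists_modularForm (e := e) hφ hm
  have hJh := isJacobiLike_jacobian (e := e) fun j => (hφ j).isJacobiLike
  have hFc := hF.weakJacobi.isJacobiLike.holo.continuous
  have key := eq_of_eq_on_ne_zero (a := fun τ z => F τ (L.act σ z))
    (b := fun τ z => sgn σ * F τ z) hJh.holo hJ
    (hFc.comp (continuous_fst.prodMk ((continuous_act σ).comp continuous_snd)))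
    (continuous_const.mul hFc) fun τ z hz => ?_
  · exact congrFun (congrFun key τ) z
  · have h1 := jacobian_act (e := e) (m := m) (fun j => (hφ j).holomorphic)
      (fun j => (hφ j).invariant σ hσ) τ z
    have h0 : g τ ≠ 0 := fun h0 => hz (by rw [hg, h0, zero_mul])
    rw [hg, hg] at h1
    refine mul_left_cancel₀ h0 (h1.trans ?_)
    ring

/-- Numerator and denominator both transform by the determinant character, which cancels. -/
theorem IsJacobianDivisor.exists_invariant_quotient (hF : IsJacobianDivisor G kHat m₀ F)
    (hFG : ∀ σ ∈ G, ∀ τ z, F τ (L.act σ z) = sgn σ * F τ z)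
    (hφ : ∀ j, L.IsWeakJacobiForm G (k j) (m j) (φ j)) {s : ℕ} (hm : ∑ j, m j = m₀ + s) :
    ∃ h, L.IsWeakJacobiForm G (l + ∑ j, k j - kHat) s h ∧
      ∀ τ z, h τ z * F τ z = jacobian e m φ τ z := by
  obtain ⟨h, hq, hf, hmul⟩ := hF.exists_quotient (e := e) hφ
  rw [hm, Nat.cast_add, add_sub_cancel_left] at hq
  refine ⟨h, hq.isWeakJacobiForm hf fun σ hσ => ?_, hmul⟩
  have hFh := hF.weakJacobi.isJacobiLike.holo
  have key := eq_of_eq_on_ne_zero (a := fun τ z => h τ (L.act σ z)) hFh hF.ne_zero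
    (hq.holo.continuous.comp (continuous_fst.prodMk ((continuous_act σ).comp continuous_snd)))
    hq.holo.continuous fun τ z hz => ?_
  · exact fun τ z => congrFun (congrFun key τ) z
  · have h1 := jacobian_act (e := e) (m := m) (fun j => (hφ j).holomorphic)
      (fun j => (hφ j).invariant σ hσ) τ z
    rw [← hmul, ← hmul, hFG σ hσ] at h1
    have h2 : sgn σ ≠ 0 := fun h0 => by simpa [h0] using sgn_mul_self σ
    refine mul_right_cancel₀ (mul_ne_zero h2 hz) (h1.trans ?_)
    ring

theorem IsJacobianDivisor.jacobian_eq_zero (hF : IsJacobianDivisor G kHat m₀ F) (hl : 0 < l)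
    (hφ : ∀ j, L.IsWeakJacobiForm G (k j) (m j) (φ j)) (hm : ∑ j, m j < m₀) :
    jacobian e m φ = 0 := by
  obtain ⟨h, hq, hf, hmul⟩ := hF.exists_quotient (e := e) hφ
  have := hq.eq_zero_of_neg hl (by omega)
  funext τ z
  rw [← hmul, this]
  simp

/-- The expansion of a determinant with two equal rows. -/
theorem sum_mul_jacobian_eq_zero (e : Module.Basis (Fin l) ℂ (Fin l → ℂ)) (m : Fin (l + 2) → ℕ)
    (φ : Fin (l + 2) → ℍ → (Fin l → ℂ) → ℂ) (τ : ℍ) (z : Fin l → ℂ) :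
    ∑ j : Fin (l + 2), (-1) ^ (j : ℕ) * (m j * φ j τ z) *
      jacobian e (fun i => m (j.succAbove i)) (fun i => φ (j.succAbove i)) τ z = 0 := by
  let B : Matrix (Fin (l + 1)) (Fin (l + 2)) ℂ := Matrix.of fun i j =>
    (Fin.cases ((m j : ℂ) * φ j τ z) (fun i' => lineDeriv ℂ (φ j τ) z (e i')) i : ℂ)
  let A : Matrix (Fin (l + 2)) (Fin (l + 2)) ℂ := Matrix.of (Fin.cons (B 0) B)
  have hA : A.det = 0 := Matrix.det_zero_of_row_eq (i := 0) (j := 1) (by simp) rfl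
  rw [Matrix.det_succ_row_zero] at hA
  exact hA

/-- The engine of the inductions on the index. In the relation `sum_mul_jacobian_eq_zero` for ψ and
the φ_j, each Jacobian is a multiple of F; cancelling F and dividing by t leaves g ψ as a
combination of the φ_s with coefficients of smaller index. The case m s > t gives a quotient of
negative index, hence zero. -/
theorem IsJacobianDivisor.exists_expansion (hF : IsJacobianDivisor G kHat m₀ F) (hl : 0 < l)
    (hφ : ∀ j, L.IsWeakJacobiForm G (k j) (m j) (φ j)) (hm : ∑ j, m j = m₀)
    (hJ : jacobian e m φ ≠ 0) {w : ℤ} {g : ModularForm 𝒮ℒ w}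
    (hg : ∀ τ z, jacobian e m φ τ z = g τ * F τ z)
    {k' : ℤ} {t : ℕ} (ht : 0 < t) {ψ : ℍ → (Fin l → ℂ) → ℂ} (hψ : L.IsWeakJacobiForm G k' t ψ) :
    ∃ h : Fin (l + 1) → ℍ → (Fin l → ℂ) → ℂ,
      (∀ τ z, g τ * ψ τ z = ∑ s, φ s τ z * h s τ z) ∧
      ∀ s, h s = 0 ∨ ∃ (k'' : ℤ) (t'' : ℕ), L.IsWeakJacobiForm G k'' t'' (h s) ∧ t'' + m s = t := by
  let χ : Fin (l + 2) → ℍ → (Fin l → ℂ) → ℂ := Fin.cons ψ φ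
  let mχ : Fin (l + 2) → ℕ := Fin.cons t m
  let kχ : Fin (l + 2) → ℤ := Fin.cons k' k
  have hχ : ∀ j, L.IsWeakJacobiForm G (kχ j) (mχ j) (χ j) := fun j => by
    refine Fin.cases ?_ (fun j => ?_) j
    · exact hψ
    · exact hφ j
  have hFG := hF.apply_act (e := e) hφ hm hJ
  have hex : ∀ s : Fin (l + 1), ∃ q : ℍ → (Fin l → ℂ) → ℂ,
      (∀ τ z, q τ z * F τ z = jacobian e (fun i => mχ (s.succ.succAbove i))
        (fun i => χ (s.succ.succAbove i)) τ z) ∧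
      (q = 0 ∨ ∃ (k'' : ℤ) (t'' : ℕ), L.IsWeakJacobiForm G k'' t'' q ∧ t'' + m s = t) := by
    intro s
    -- The Jacobian without φ_s has index t + m₀ - m_s, so its quotient by F has index t - m_s.
    have hsum : ∑ i, mχ (s.succ.succAbove i) + m s = t + m₀ := by
      have h1 := Fin.sum_univ_succAbove mχ s.succ
      rw [Fin.sum_univ_succ] at h1
      simp only [mχ, Fin.cons_zero, Fin.cons_succ, hm] at h1
      simp only [mχ]
      omega
    rcases le_or_gt (m s) t with hst | hst
    · obtain ⟨q, hq, hmul⟩ := hF.exists_invariant_quotient (e := e) hFG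
        (fun i => hχ (s.succ.succAbove i)) (s := t - m s) (by omega)
      exact ⟨q, hmul, Or.inr ⟨_, _, hq, by omega⟩⟩
    · refine ⟨0, fun τ z => ?_, Or.inl rfl⟩
      rw [hF.jacobian_eq_zero hl (fun i => hχ (s.succ.succAbove i)) (by omega)]
      simp
  choose q hq hq' using hex
  -- φ_s stands in column s + 1; moving its term to the other side turns the sign (-1)^(s+1) into
  -- (-1)^s.
  refine ⟨fun s => ((-1) ^ (s : ℕ) * m s / t : ℂ) • q s, fun τ z => ?_, fun s => ?_⟩
  · have htc : (t : ℂ) ≠ 0 := by exact_mod_cast ht.ne'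
    have key := eq_of_eq_on_ne_zero (a := fun τ z => g τ * ψ τ z) (b := fun τ z =>
      ∑ s, φ s τ z * (((-1) ^ (s : ℕ) * m s / t : ℂ) • q s) τ z)
      hF.weakJacobi.isJacobiLike.holo hF.ne_zero ?_ ?_ ?_
    · exact congrFun (congrFun key τ) z
    · exact ((ModularFormClass.holo g).continuous.comp continuous_fst).mul hψ.isJacobiLike.holo.continuous
    · refine continuous_finsetSum _ fun s _ => (hφ s).isJacobiLike.holo.continuous.mul ?_
      refine continuous_const.mul ?_
      rcases hq' s with h0 | ⟨k'', t'', h, -⟩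
      · simpa [h0] using continuous_const
      · exact h.isJacobiLike.holo.continuous
    · intro τ z hz
      have h1 := sum_mul_jacobian_eq_zero e mχ χ τ z
      rw [Fin.sum_univ_succ] at h1
      have h2 : jacobian e (fun i => mχ (Fin.succAbove 0 i)) (fun i => χ (Fin.succAbove 0 i)) τ z =
          g τ * F τ z := by
        rw [← hg]
        rfl
      rw [h2] at h1
      simp only [← hq] at h1
      simp only [mχ, χ, Fin.cons_zero, Fin.cons_succ, Fin.val_zero, Fin.val_succ, pow_zero, one_mul]
        at h1
      refine mul_right_cancel₀ (mul_ne_zero htc hz) ?_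
      rw [Finset.sum_mul]
      have h3 : ∀ s : Fin (l + 1), φ s τ z * (((-1) ^ (s : ℕ) * m s / t : ℂ) • q s) τ z *
          (t * F τ z) = -((-1) ^ ((s : ℕ) + 1) * (m s * φ s τ z) * (q s τ z * F τ z)) := fun s => by
        simp only [Pi.smul_apply, smul_eq_mul]
        field_simp
        ring
      rw [Finset.sum_congr rfl fun s _ => h3 s, Finset.sum_neg_distrib]
      linear_combination h1
  · rcases hq' s with h0 | ⟨k'', t'', h, ht''⟩
    · left
      simp only [h0, smul_zero]
    · exact Or.inr ⟨k'', t'', (L.weakJacobi G k'' t'').smul_mem _ h, ht''⟩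

end EvenLattice

end

/-! ### Independence criteria and linear independence of weights and indices. -/

noncomputable section

/-- Induction on the degree: the partial derivatives of a relation are relations of lower degree,
hence zero. As positive integers are not zero divisors in R, the relation is then a constant, which
must vanish. -/
theorem algebraicIndependent_of_aeval_pderiv {σ R A : Type*} [CommRing R] [CommRing A] [Algebra R A]
    {x : σ → A} (hR : ∀ (n : ℕ) (r : R), r * (n + 1) = 0 → r = 0)
    (hinj : Function.Injective (algebraMap R A))
    (h : ∀ P : MvPolynomial σ R, MvPolynomial.aeval x P = 0 →
      ∀ i, MvPolynomial.aeval x (MvPolynomial.pderiv i P) = 0) : AlgebraicIndependent R x := by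
  have key : ∀ (N : ℕ) (P : MvPolynomial σ R), MvPolynomial.aeval x P = 0 →
      (∀ d : σ →₀ ℕ, N ≤ d.degree → P.coeff d = 0) → P = 0 := by
    intro N
    induction N with
    | zero => exact fun P _ hd => MvPolynomial.ext _ _ fun d => hd d (Nat.zero_le _)
    | succ N ih =>
      intro P hP hd
      have h1 : ∀ i, MvPolynomial.pderiv i P = 0 := fun i => ih _ (h P hP i) fun d hN => by
        rw [MvPolynomial.coeff_pderiv, hd, zero_mul]
        rw [map_add, Finsupp.degree_single]
        omega
      have h2 : ∀ d : σ →₀ ℕ, d ≠ 0 → P.coeff d = 0 := by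
        intro d hd0
        obtain ⟨i, hi⟩ := Finsupp.ne_iff.1 hd0
        have h3 := MvPolynomial.coeff_pderiv (i := i) P (d - Finsupp.single i 1)
        rw [h1 i, MvPolynomial.coeff_zero, tsub_add_cancel_of_le] at h3
        · exact hR _ _ h3.symm
        · rw [Finsupp.single_le_iff]
          simp only [Finsupp.coe_zero, Pi.zero_apply] at hi
          omega
      have h4 : P = MvPolynomial.C (P.coeff 0) := by
        classical
        ext d
        rw [MvPolynomial.coeff_C]
        split_ifs with hd
        · rw [hd]
        · exact h2 d (Ne.symm hd)
      rw [h4, MvPolynomial.aeval_C] at hP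
      rw [h4, (injective_iff_map_eq_zero _).1 hinj _ hP, map_zero]
  rw [algebraicIndependent_iff]
  intro P hP
  refine key (P.totalDegree + 1) P hP fun d hd => MvPolynomial.coeff_eq_zero_of_totalDegree_lt ?_
  exact hd

/-- Chain rule for derivations at a point. -/
theorem map_aeval_eq_sum_pderiv {σ R A : Type*} [Fintype σ] [CommRing R] [CommRing A] [Algebra R A]
    {B : Type*} [CommRing B] (ε : A →+* B) (δ : A →+ B)
    (hδ : ∀ a b, δ (a * b) = ε a * δ b + ε b * δ a) (h0 : ∀ r, δ (algebraMap R A r) = 0)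
    (x : σ → A) (P : MvPolynomial σ R) :
    δ (MvPolynomial.aeval x P) =
      ∑ j, ε (MvPolynomial.aeval x (MvPolynomial.pderiv j P)) * δ (x j) := by
  classical
  induction P using MvPolynomial.induction_on with
  | C r => simp [h0]
  | add p q hp hq => simp only [map_add, hp, hq, add_mul, Finset.sum_add_distrib]
  | mul_X p i hp =>
    simp only [map_mul, hδ, hp, MvPolynomial.aeval_X, MvPolynomial.pderiv_mul,
      MvPolynomial.pderiv_X, map_add, add_mul, Finset.sum_add_distrib, Finset.mul_sum]
    rw [add_comm]
    congr 1
    · exact Finset.sum_congr rfl fun j _ => by ring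
    · rw [Finset.sum_eq_single i (fun j _ hj => by simp [hj]) (by simp)]
      simp

/-- The polynomial ∑ c_i X^(κ_i) has infinitely many roots, so all its coefficients vanish. -/
theorem sum_ite_eq_zero_of_pow {ι : Type*} {s : Finset ι} {κ : ι → ℕ} {c : ι → ℂ} {x : ℕ → ℂ}
    (hx : (Set.range x).Infinite) (h : ∀ n, ∑ i ∈ s, c i * x n ^ κ i = 0) (d : ℕ) :
    ∑ i ∈ s, (if κ i = d then c i else 0) = 0 := by
  have hP : ∑ i ∈ s, Polynomial.monomial (κ i) (c i) = 0 := by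
    refine Polynomial.eq_zero_of_infinite_isRoot _ (hx.mono ?_)
    rintro _ ⟨n, rfl⟩
    simpa [Polynomial.IsRoot, Polynomial.eval_finsetSum] using h n
  have := congrArg (fun P => Polynomial.coeff P d) hP
  simpa [Polynomial.finsetSum_coeff, Polynomial.coeff_monomial] using this

namespace EvenLattice

open Metric Topology Filter

variable {l : ℕ} {L : EvenLattice l} {G : Subgroup L.orthogonalGroup}

/-- The absolute values grow like the exponential of a positive multiple of n², so they are
unbounded. -/
theorem infinite_range_elliptic (L : EvenLattice l) (i : Fin l) (τ : ℍ) (β : ℂ) :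
    (Set.range fun n : ℕ => Complex.exp (-(Real.pi * Complex.I *
      ((n : ℂ) ^ 2 * L.gram i i * τ + 2 * n * β)))).Infinite := by
  intro hfin
  obtain ⟨C, hC⟩ := hfin.isBounded.exists_norm_le
  have hb : ∀ n : ℕ, Real.pi * (n ^ 2 * L.gram i i * τ.im + 2 * n * β.im) ≤ C := by
    intro n
    have h1 := hC _ ⟨n, rfl⟩
    have hre : (-(Real.pi * Complex.I * ((n : ℂ) ^ 2 * L.gram i i * τ + 2 * n * β))).re =
        Real.pi * (n ^ 2 * L.gram i i * τ.im + 2 * n * β.im) := by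
      have : (-(Real.pi * Complex.I * ((n : ℂ) ^ 2 * L.gram i i * τ + 2 * n * β))) =
        ((-Real.pi : ℝ) : ℂ) * (((n ^ 2 * L.gram i i : ℝ) : ℂ) * τ +
          ((2 * n : ℝ) : ℂ) * β) * Complex.I := by
        push_cast
        ring
      rw [this, Complex.mul_I_re, Complex.im_ofReal_mul, Complex.add_im, Complex.im_ofReal_mul,
        Complex.im_ofReal_mul]
      simp only [coe_im]
      ring
    simp only [Complex.norm_exp] at h1
    rw [hre] at h1
    linarith [Real.add_one_le_exp (Real.pi * (n ^ 2 * L.gram i i * τ.im + 2 * n * β.im))]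
  have hQ : (0 : ℝ) < L.gram i i * τ.im :=
    mul_pos (by exact_mod_cast L.gram_diag_pos i) τ.im_pos
  obtain ⟨n, hn⟩ := exists_nat_gt ((2 * |β.im| + |C| + 1) / (L.gram i i * τ.im))
  rw [div_lt_iff₀ hQ] at hn
  have h1 := hb (n + 1)
  have h2 := Real.pi_gt_three
  have h3 := neg_abs_le β.im
  have h4 := le_abs_self C
  have h5 : (0 : ℝ) ≤ n := n.cast_nonneg
  have h6 := abs_nonneg β.im
  have h7 := abs_nonneg C
  push_cast at h1
  set q : ℝ := L.gram i i * τ.im with hq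
  have h8 : |C| + 1 ≤ ((n : ℝ) + 1) ^ 2 * L.gram i i * τ.im + 2 * (n + 1) * β.im := by
    have : ((n : ℝ) + 1) ^ 2 * L.gram i i * τ.im + 2 * (n + 1) * β.im =
        (n + 1) * ((n + 1) * q + 2 * β.im) := by rw [hq]; ring
    rw [this]
    nlinarith
  nlinarith

theorem infinite_range_modular (τ : ℍ) : (Set.range fun n : ℕ => (n : ℂ) * τ + 1).Infinite := by
  refine Set.infinite_range_of_injective fun a b hab => ?_
  have : (a : ℂ) = b := mul_right_cancel₀ τ.ne_zero (add_right_cancel hab)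
  exact_mod_cast this

/-- Translating z by nτ along a basis vector multiplies a form of index t by the t-th power of a
number x_n taking infinitely many values, which separates the indices. -/
theorem sum_index_eq_zero (hl : 0 < l) {s : Finset (ℤ × ℕ)} {f : ℤ × ℕ → ℍ → (Fin l → ℂ) → ℂ}
    (hf : ∀ i ∈ s, L.IsJacobiLike i.1 i.2 (f i)) (h : ∑ i ∈ s, f i = 0) (t : ℕ) :
    ∑ i ∈ s with i.2 = t, f i = 0 := by
  funext τ z
  let i₀ : Fin l := ⟨0, hl⟩
  have := sum_ite_eq_zero_of_pow (s := s) (κ := fun i => i.2) (c := fun i => f i τ z)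
    (infinite_range_elliptic L i₀ τ (L.form (Pi.single i₀ 1) z)) (fun n => ?_) t
  · simpa [Finset.sum_apply, Finset.sum_filter] using this
  · have h1 := congrFun (congrFun h τ) (z + (0 + ((n : ℤ) : ℂ) * (τ : ℂ)) • Pi.single i₀ 1)
    rw [Finset.sum_apply, Finset.sum_apply] at h1
    rw [Pi.zero_apply, Pi.zero_apply] at h1
    rw [← h1]
    refine Finset.sum_congr rfl fun i hi => ?_
    rw [(hf i hi).apply_add_int_mul, mul_comm, ← Complex.exp_nat_mul]
    simp

theorem eq_zero_of_sum_eq_zero (hl : 0 < l) {s : Finset (ℤ × ℕ)}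
    {f : ℤ × ℕ → ℍ → (Fin l → ℂ) → ℂ} (hf : ∀ i ∈ s, L.IsJacobiLike i.1 i.2 (f i))
    (h : ∑ i ∈ s, f i = 0) {i : ℤ × ℕ} (hi : i ∈ s) : f i = 0 := by
  have h1 := sum_index_eq_zero hl hf h i.2
  have his : i ∈ s.filter (fun j => j.2 = i.2) := Finset.mem_filter.2 ⟨hi, rfl⟩
  set s' := s.filter (fun j => j.2 = i.2) with hs'
  funext τ z
  -- Weights may be negative, so the power (nτ + 1)^K is factored out to leave natural exponents.
  obtain ⟨K, hK⟩ : ∃ K : ℤ, ∀ j ∈ s', K ≤ j.1 := by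
    obtain ⟨K, hK⟩ := (s'.image Prod.fst).bddBelow
    exact ⟨K, fun j hj => hK (Finset.mem_coe.2 (Finset.mem_image_of_mem _ hj))⟩
  have := sum_ite_eq_zero_of_pow (s := s') (κ := fun j => (j.1 - K).toNat) (c := fun j => f j τ z)
    (infinite_range_modular τ) (fun n => ?_) (i.1 - K).toNat
  · rw [Finset.sum_eq_single_of_mem i his] at this
    · simpa using this
    · intro j hj hji
      rw [if_neg]
      intro hjK
      apply hji
      have h2 := (Finset.mem_filter.1 hj).2
      have h3 := hK j hj
      have h4 := hK i his
      exact Prod.ext (by omega) h2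
  -- Its factor is nτ + 1, with infinitely many values; the exponential factor is common because all
  -- remaining forms have the same index.
  · let γ : SL(2, ℤ) := ⟨!![1, 0; n, 1], by simp [Matrix.det_fin_two]⟩
    have hγ0 : ((γ 1 0 : ℤ) : ℂ) = n := by simp [γ]
    have hγ1 : ((γ 1 1 : ℤ) : ℂ) = 1 := by simp [γ]
    have hD := denomSL_ne_zero γ τ
    rw [hγ0, hγ1] at hD
    have h2 := congrFun (congrFun h1 (γ • τ)) (((n : ℂ) * τ + 1)⁻¹ • z)
    rw [Finset.sum_apply, Finset.sum_apply, Pi.zero_apply, Pi.zero_apply] at h2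
    set E := Complex.exp (i.2 * (Real.pi * Complex.I * (n * L.form z z / (n * τ + 1)))) with hE
    have hE0 : E ≠ 0 := Complex.exp_ne_zero _
    have h3 : ∀ j ∈ s', f j (γ • τ) (((n : ℂ) * τ + 1)⁻¹ • z) =
        (((n : ℂ) * τ + 1) ^ K * E) * (f j τ z * (n * τ + 1) ^ (j.1 - K).toNat) := by
      intro j hj
      have h4 := (hf j (Finset.mem_of_mem_filter j hj)).modular γ τ z
      rw [hγ0, hγ1, (Finset.mem_filter.1 hj).2] at h4
      have h5 : ((n : ℂ) * τ + 1) ^ j.1 = (n * τ + 1) ^ K * (n * τ + 1) ^ (j.1 - K).toNat := by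
        rw [← zpow_natCast, ← zpow_add₀ hD, Int.toNat_of_nonneg (sub_nonneg.2 (hK j hj)),
          add_sub_cancel]
      rw [h4, h5, hE, Int.cast_natCast]
      ring
    rw [Finset.sum_congr rfl h3, ← Finset.mul_sum] at h2
    exact (mul_eq_zero.1 h2).resolve_left (mul_ne_zero (zpow_ne_zero _ hD) hE0)

/-- The elements of the algebra of Jacobi forms as functions. -/
def toFunHom (G : Subgroup L.orthogonalGroup) : L.JacobiAlgebra G →+* (ℍ → (Fin l → ℂ) → ℂ) :=
  DirectSum.coeRingHom (L.jacobiPiece G)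

theorem toFunHom_of (i : ℤ × ℕ) (φ : L.jacobiPiece G i) :
    toFunHom G (DirectSum.of (fun i => L.jacobiPiece G i) i φ) = φ :=
  DirectSum.coeRingHom_of ..

theorem toFunHom_toAlg {k : ℤ} {t : ℕ} (φ : L.weakJacobi G k t) : toFunHom G (L.toAlg φ) = φ :=
  toFunHom_of (k, t) φ

theorem toFunHom_injective (hl : 0 < l) : Function.Injective (toFunHom G) := by
  rw [injective_iff_map_eq_zero]
  intro a ha
  classical
  have h1 : toFunHom G a = ∑ i ∈ DFinsupp.support a, (a i : ℍ → (Fin l → ℂ) → ℂ) := by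
    conv_lhs => rw [← DirectSum.sum_support_of a, map_sum]
    exact Finset.sum_congr rfl fun i _ => toFunHom_of i (a i)
  rw [ha] at h1
  ext i : 1
  by_cases hi : i ∈ DFinsupp.support a
  · exact Subtype.ext (eq_zero_of_sum_eq_zero hl
      (f := fun i => (a i : ℍ → (Fin l → ℂ) → ℂ)) (fun j _ => (a j).2.isJacobiLike) h1.symm hi)
  · simpa using hi

end EvenLattice

end

/-! ### Derivations of the algebra of Jacobi forms and algebraic independence. -/

noncomputable section

namespace EvenLattice

open Metric Topology Filter

variable {l : ℕ} {L : EvenLattice l} {G : Subgroup L.orthogonalGroup}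

theorem algebraMap_of {k : ℤ} (g : ModularForm 𝒮ℒ k) :
    algebraMap ModularFormRing (L.JacobiAlgebra G) (DirectSum.of (fun i : ℤ => ModularForm 𝒮ℒ i) k g) =
      DirectSum.of (fun i => L.jacobiPiece G i) (k, 0) ⟨fun τ _ => g τ, L.modularForm_mem G g⟩ :=
  DirectSum.toAddMonoid_of (fun k => L.modularPiece G k) k g

theorem toFunHom_algebraMap_of {k : ℤ} (g : ModularForm 𝒮ℒ k) (τ : ℍ) (z : Fin l → ℂ) :
    toFunHom G (algebraMap ModularFormRing (L.JacobiAlgebra G)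
      (DirectSum.of (fun i : ℤ => ModularForm 𝒮ℒ i) k g)) τ z = g τ := by
  rw [algebraMap_of, toFunHom_of]

theorem algebraMap_apply (r : ModularFormRing) (k : ℤ) (τ : ℍ) (z : Fin l → ℂ) :
    ((algebraMap ModularFormRing (L.JacobiAlgebra G) r (k, 0) : L.jacobiPiece G (k, 0)) :
      ℍ → (Fin l → ℂ) → ℂ) τ z = r k τ := by
  induction r using DirectSum.induction_on with
  | zero => simp
  | of i g =>
    rw [algebraMap_of]
    by_cases hik : i = k
    · subst hik
      rw [DirectSum.of_eq_same, DirectSum.of_eq_same]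
    · rw [DirectSum.of_eq_of_ne _ _ _ (by simpa using Ne.symm hik),
        DirectSum.of_eq_of_ne _ _ _ (Ne.symm hik)]
      simp
  | add r s hr hs =>
    rw [map_add, DirectSum.add_apply, DirectSum.add_apply]
    simp [hr, hs]

theorem algebraMap_injective : Function.Injective (algebraMap ModularFormRing (L.JacobiAlgebra G)) := by
  rw [injective_iff_map_eq_zero]
  intro r hr
  ext k : 1
  refine ModularForm.ext fun τ => ?_
  rw [← algebraMap_apply (G := G) r k τ 0, hr]
  simp

theorem eq_zero_of_mul_natCast_add_one {n : ℕ} {r : ModularFormRing} (h : r * (n + 1) = 0) : r = 0 := by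
  have h1 : ((n : ℂ) + 1) • r = 0 := by
    rw [mul_comm, ← Nat.cast_succ, ← nsmul_eq_mul, ← Nat.cast_smul_eq_nsmul ℂ] at h
    simpa using h
  exact (smul_eq_zero.1 h1).resolve_left (by exact_mod_cast n.succ_ne_zero)

theorem isHolo_toFunHom (a : L.JacobiAlgebra G) : IsHolo (toFunHom G a) := by
  induction a using DirectSum.induction_on with
  | zero =>
    rw [map_zero]
    exact (holoAlgebra l).zero_mem
  | of i φ =>
    rw [toFunHom_of]
    exact φ.2.isJacobiLike.holo
  | add a b ha hb =>
    rw [map_add]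
    exact (holoAlgebra l).add_mem ha hb

theorem exists_isFourierExpansion_toFunHom (a : L.JacobiAlgebra G) :
    ∃ f, L.IsFourierExpansion f (toFunHom G a) := by
  change toFunHom G a ∈ L.fourierAlgebra
  induction a using DirectSum.induction_on with
  | zero =>
    rw [map_zero]
    exact zero_mem _
  | of i φ =>
    rw [toFunHom_of]
    exact φ.2.fourier
  | add a b ha hb =>
    rw [map_add]
    exact add_mem ha hb

theorem toFunHom_act (a : L.JacobiAlgebra G) (σ : L.orthogonalGroup) (hσ : σ ∈ G) (τ : ℍ)
    (z : Fin l → ℂ) : toFunHom G a τ (L.act σ z) = toFunHom G a τ z := by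
  induction a using DirectSum.induction_on with
  | zero => simp
  | of i φ =>
    rw [toFunHom_of]
    exact φ.2.invariant σ hσ τ z
  | add a b ha hb =>
    rw [map_add]
    simp [ha, hb]

/-- The evaluation at a point. -/
def evalHom (G : Subgroup L.orthogonalGroup) (τ : ℍ) (z : Fin l → ℂ) : L.JacobiAlgebra G →+* ℂ :=
  ((Pi.evalRingHom (fun _ : Fin l → ℂ => ℂ) z).comp
    (Pi.evalRingHom (fun _ : ℍ => (Fin l → ℂ) → ℂ) τ)).comp (toFunHom G)

theorem evalHom_apply (τ : ℍ) (z : Fin l → ℂ) (a : L.JacobiAlgebra G) :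
    evalHom G τ z a = toFunHom G a τ z := rfl

/-- The directional derivative at a point. -/
def lineDerivHom (G : Subgroup L.orthogonalGroup) (τ : ℍ) (z v : Fin l → ℂ) :
    L.JacobiAlgebra G →+ ℂ where
  toFun a := lineDeriv ℂ (toFunHom G a τ) z v
  map_zero' := by
    rw [map_zero]
    simp [lineDeriv]
  map_add' a b := by
    have ha := (isHolo_toFunHom a).hasDerivAt_line τ z v
    have hb := (isHolo_toFunHom b).hasDerivAt_line τ z v
    rw [map_add]
    exact (ha.add hb).deriv

theorem lineDerivHom_mul (τ : ℍ) (z v : Fin l → ℂ) (a b : L.JacobiAlgebra G) :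
    lineDerivHom G τ z v (a * b) =
      evalHom G τ z a * lineDerivHom G τ z v b + evalHom G τ z b * lineDerivHom G τ z v a := by
  have ha := (isHolo_toFunHom a).hasDerivAt_line τ z v
  have hb := (isHolo_toFunHom b).hasDerivAt_line τ z v
  change lineDeriv ℂ (toFunHom G (a * b) τ) z v = _
  rw [map_mul]
  refine (ha.mul hb).deriv.trans ?_
  simp only [zero_smul, add_zero]
  rw [evalHom_apply, evalHom_apply]
  change _ = _ * lineDeriv ℂ (toFunHom G b τ) z v + _ * lineDeriv ℂ (toFunHom G a τ) z v
  ring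

/-- The value at a point of the operator multiplying forms of index `t` by `t`. -/
def indexHom (G : Subgroup L.orthogonalGroup) (τ : ℍ) (z : Fin l → ℂ) : L.JacobiAlgebra G →+ ℂ :=
  DirectSum.toAddMonoid fun i =>
    { toFun := fun φ => i.2 * (φ : ℍ → (Fin l → ℂ) → ℂ) τ z
      map_zero' := by simp
      map_add' := fun a b => by simp [mul_add] }

theorem indexHom_of (τ : ℍ) (z : Fin l → ℂ) (i : ℤ × ℕ) (φ : L.jacobiPiece G i) :
    indexHom G τ z (DirectSum.of (fun i => L.jacobiPiece G i) i φ) =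
      i.2 * (φ : ℍ → (Fin l → ℂ) → ℂ) τ z :=
  DirectSum.toAddMonoid_of ..

theorem indexHom_toAlg (τ : ℍ) (z : Fin l → ℂ) {k : ℤ} {t : ℕ} (φ : L.weakJacobi G k t) :
    indexHom G τ z (L.toAlg φ) = t * (φ : ℍ → (Fin l → ℂ) → ℂ) τ z :=
  indexHom_of τ z (k, t) φ

/-- Indices add under multiplication, so multiplying by the index is a derivation, like the Euler
operator. It accounts for the first row of the Jacobian. -/
theorem indexHom_mul (τ : ℍ) (z : Fin l → ℂ) (a b : L.JacobiAlgebra G) :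
    indexHom G τ z (a * b) =
      evalHom G τ z a * indexHom G τ z b + evalHom G τ z b * indexHom G τ z a := by
  induction a using DirectSum.induction_on with
  | zero => simp
  | add a a' ha ha' =>
    rw [add_mul, map_add, ha, ha', map_add, map_add]
    ring
  | of i φ =>
    induction b using DirectSum.induction_on with
    | zero => simp
    | add b b' hb hb' =>
      rw [mul_add, map_add, hb, hb', map_add, map_add]
      ring
    | of j ψ =>
      rw [DirectSum.of_mul_of, indexHom_of, indexHom_of, indexHom_of, evalHom_apply, evalHom_apply,
        toFunHom_of, toFunHom_of]
      simp only [Prod.snd_add, Nat.cast_add]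
      change _ * ((φ : ℍ → (Fin l → ℂ) → ℂ) τ z * (ψ : ℍ → (Fin l → ℂ) → ℂ) τ z) = _
      ring

theorem indexHom_algebraMap (τ : ℍ) (z : Fin l → ℂ) (r : ModularFormRing) :
    indexHom G τ z (algebraMap ModularFormRing (L.JacobiAlgebra G) r) = 0 := by
  induction r using DirectSum.induction_on with
  | zero => simp
  | add a b ha hb => rw [map_add, map_add, ha, hb, add_zero]
  | of k g =>
    rw [algebraMap_of, indexHom_of]
    simp

theorem lineDerivHom_algebraMap (τ : ℍ) (z v : Fin l → ℂ) (r : ModularFormRing) :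
    lineDerivHom G τ z v (algebraMap ModularFormRing (L.JacobiAlgebra G) r) = 0 := by
  induction r using DirectSum.induction_on with
  | zero => simp
  | add a b ha hb => rw [map_add, map_add, ha, hb, add_zero]
  | of k g =>
    change lineDeriv ℂ (toFunHom G _ τ) z v = 0
    rw [algebraMap_of, toFunHom_of]
    simp [lineDeriv]

variable {e : Module.Basis (Fin l) ℂ (Fin l → ℂ)} {k : Fin (l + 1) → ℤ} {m : Fin (l + 1) → ℕ}

/-- Jacobi forms with nonvanishing Jacobian are algebraically independent over the ring of modular
forms. -/
theorem algebraicIndependent_of_jacobian_ne_zero (hl : 0 < l) (φ : ∀ j, L.weakJacobi G (k j) (m j))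
    (hJ : jacobian e m (fun j => (φ j : ℍ → (Fin l → ℂ) → ℂ)) ≠ 0) :
    AlgebraicIndependent ModularFormRing (fun j => L.toAlg (φ j)) := by
  refine algebraicIndependent_of_aeval_pderiv (fun n r h => eq_zero_of_mul_natCast_add_one h)
    algebraMap_injective fun P hP => ?_
  have hJh := isJacobiLike_jacobian (e := e) fun j => (φ j).2.isJacobiLike
  intro j
  refine toFunHom_injective hl ?_
  rw [map_zero]
  refine eq_of_eq_on_ne_zero hJh.holo hJ (isHolo_toFunHom _).continuous continuous_const
    fun τ z hz => ?_
  set c : Fin (l + 1) → ℂ := fun j =>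
    evalHom G τ z (MvPolynomial.aeval (fun j => L.toAlg (φ j)) (MvPolynomial.pderiv j P)) with hc
  change c j = 0
  -- The derivations applied to P(φ) = 0 say that the Jacobian matrix at (τ, z) kills c, and its
  -- determinant is nonzero there.
  have h0 : c = 0 := by
    refine Matrix.eq_zero_of_mulVec_eq_zero hz ?_
    funext i
    refine Fin.cases ?_ (fun i => ?_) i
    · have h1 := map_aeval_eq_sum_pderiv (evalHom G τ z) (indexHom G τ z) (indexHom_mul τ z)
        (indexHom_algebraMap τ z) (fun j => L.toAlg (φ j)) P
      rw [hP, map_zero] at h1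
      rw [Pi.zero_apply, h1, mulVec, dotProduct]
      refine Finset.sum_congr rfl fun j _ => ?_
      rw [mul_comm, indexHom_toAlg]
      rfl
    · have h1 := map_aeval_eq_sum_pderiv (evalHom G τ z) (lineDerivHom G τ z (e i))
        (lineDerivHom_mul τ z (e i)) (lineDerivHom_algebraMap τ z (e i)) (fun j => L.toAlg (φ j)) P
      rw [hP, map_zero] at h1
      rw [Pi.zero_apply, h1, mulVec, dotProduct]
      refine Finset.sum_congr rfl fun j _ => ?_
      rw [mul_comm]
      congr 1
      change _ = lineDeriv ℂ (toFunHom G _ τ) z (e i)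
      rw [toFunHom_toAlg]
      rfl
  rw [h0]
  rfl

end EvenLattice

end

/-! ### Inductions on the index and the comparison of rings. -/

noncomputable section

namespace EvenLattice

open Metric Topology Filter

variable {l : ℕ} {L : EvenLattice l} {G : Subgroup L.orthogonalGroup}
  {e : Module.Basis (Fin l) ℂ (Fin l → ℂ)} {k : Fin (l + 1) → ℤ} {m : Fin (l + 1) → ℕ}
  {kHat : ℤ} {m₀ : ℕ} {F : ℍ → (Fin l → ℂ) → ℂ} {w : ℤ} {g : ModularForm 𝒮ℒ w}

/-- A modular form as an element of the ring of modular forms. -/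
abbrev _root_.ModularForm.toRing {w : ℤ} (g : ModularForm 𝒮ℒ w) : ModularFormRing :=
  DirectSum.of (fun i : ℤ => ModularForm 𝒮ℒ i) w g

theorem exists_toAlg_eq_algebraMap {k' : ℤ} (ψ : L.weakJacobi G k' 0) :
    ∃ g' : ModularForm 𝒮ℒ k', L.toAlg ψ = algebraMap ModularFormRing (L.JacobiAlgebra G) g'.toRing := by
  obtain ⟨g', hg'⟩ := IsJacobiLike.exists_modularForm ψ.2.isJacobiLike ψ.2.fourier
  refine ⟨g', ?_⟩
  rw [algebraMap_of, toAlg]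
  congr 1
  exact Subtype.ext (funext fun τ => funext fun z => hg' τ z)

/-- A form of index zero does not depend on z, so its column in the Jacobian would be zero. The
inductions on the index need this. -/
theorem index_pos_of_jacobian_ne_zero (φ : ∀ j, L.weakJacobi G (k j) (m j))
    (hJ : jacobian e m (fun j => (φ j : ℍ → (Fin l → ℂ) → ℂ)) ≠ 0) (j : Fin (l + 1)) : 0 < m j := by
  by_contra hm
  have hm0 : m j = 0 := by omega
  apply hJ
  funext τ z
  refine Matrix.det_eq_zero_of_column_eq_zero j fun i => ?_
  refine Fin.cases ?_ (fun i => ?_) i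
  · simp [hm0]
  · have h := (φ j).2.isJacobiLike
    have hm0' : ((m j : ℕ) : ℤ) = 0 := by exact_mod_cast hm0
    rw [hm0'] at h
    simp [lineDeriv, h.apply_eq_apply τ _ z]

theorem IsJacobianDivisor.exists_toAlg_expansion (hF : IsJacobianDivisor G kHat m₀ F) (hl : 0 < l)
    (φ : ∀ j, L.weakJacobi G (k j) (m j)) (hm : ∑ j, m j = m₀)
    (hJ : jacobian e m (fun j => (φ j : ℍ → (Fin l → ℂ) → ℂ)) ≠ 0)
    (hg : ∀ τ z, jacobian e m (fun j => (φ j : ℍ → (Fin l → ℂ) → ℂ)) τ z = g τ * F τ z)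
    {k' : ℤ} {t : ℕ} (ht : 0 < t) (ψ : L.weakJacobi G k' t) :
    ∃ H : Fin (l + 1) → L.JacobiAlgebra G,
      algebraMap ModularFormRing _ g.toRing * L.toAlg ψ = ∑ s, L.toAlg (φ s) * H s ∧
      ∀ s, H s = 0 ∨ ∃ (k'' : ℤ) (t'' : ℕ) (η : L.weakJacobi G k'' t''),
        H s = L.toAlg η ∧ t'' + m s = t := by
  obtain ⟨h, hsum, hh⟩ := hF.exists_expansion hl (fun j => (φ j).2) hm hJ hg ht ψ.2
  have hH : ∀ s, ∃ H : L.JacobiAlgebra G, toFunHom G H = h s ∧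
      (H = 0 ∨ ∃ (k'' : ℤ) (t'' : ℕ) (η : L.weakJacobi G k'' t''),
        H = L.toAlg η ∧ t'' + m s = t) := by
    intro s
    rcases hh s with h0 | ⟨k'', t'', hη, ht''⟩
    · exact ⟨0, by rw [h0, map_zero], Or.inl rfl⟩
    · exact ⟨L.toAlg ⟨h s, hη⟩, toFunHom_toAlg _, Or.inr ⟨k'', t'', ⟨h s, hη⟩, rfl, ht''⟩⟩
  choose H hH hH' using hH
  refine ⟨H, toFunHom_injective hl ?_, hH'⟩
  funext τ z
  rw [map_mul, map_sum, Finset.sum_apply, Finset.sum_apply]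
  simp only [map_mul, hH, toFunHom_toAlg, Pi.mul_apply]
  rw [toFunHom_algebraMap_of, hsum]

theorem exists_mul_eq_one_of_weight_eq_zero (L : EvenLattice l) (hl : 0 < l) (hw : w = 0) (hg : (g : ℍ → ℂ) ≠ 0) :
    ∃ r : ModularFormRing, r * g.toRing = 1 := by
  subst hw
  obtain ⟨c, hc⟩ := ModularFormClass.levelOne_weight_zero_const g
  have hc0 : c ≠ 0 := by
    rintro rfl
    exact hg hc
  refine ⟨(ModularForm.const c⁻¹ : ModularForm 𝒮ℒ 0).toRing, ?_⟩
  refine algebraMap_injective (L := L) (G := ⊥) (toFunHom_injective hl ?_)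
  funext τ z
  rw [map_mul, map_mul, map_one, map_one, Pi.mul_apply, Pi.mul_apply, toFunHom_algebraMap_of,
    toFunHom_algebraMap_of, hc]
  simp [hc0]

theorem toAlg_mem_of_index_eq_zero (S : Subalgebra ModularFormRing (L.JacobiAlgebra G)) {k' : ℤ}
    (ψ : L.weakJacobi G k' 0) : L.toAlg ψ ∈ S := by
  obtain ⟨g', hg'⟩ := exists_toAlg_eq_algebraMap ψ
  rw [hg']
  exact S.algebraMap_mem _

theorem eq_top_of_toAlg_mem {S : Subalgebra ModularFormRing (L.JacobiAlgebra G)}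
    (h : ∀ (k' : ℤ) (t : ℕ) (ψ : L.weakJacobi G k' t), L.toAlg ψ ∈ S) : S = ⊤ := by
  refine eq_top_iff.2 fun a _ => ?_
  induction a using DirectSum.induction_on with
  | zero => exact S.zero_mem
  | of i ψ => exact h i.1 i.2 ψ
  | add a b ha hb => exact S.add_mem (ha trivial) (hb trivial)

/-- In weight zero g is a nonzero constant, hence a unit, so the expansion expresses each form
through the φ_s and forms of smaller index, down to modular forms in index zero. -/
theorem IsJacobianDivisor.adjoin_eq_top (hF : IsJacobianDivisor G kHat m₀ F) (hl : 0 < l)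
    (φ : ∀ j, L.weakJacobi G (k j) (m j)) (hm : ∑ j, m j = m₀)
    (hJ : jacobian e m (fun j => (φ j : ℍ → (Fin l → ℂ) → ℂ)) ≠ 0)
    (hg : ∀ τ z, jacobian e m (fun j => (φ j : ℍ → (Fin l → ℂ) → ℂ)) τ z = g τ * F τ z)
    (hw : w = 0) :
    Algebra.adjoin ModularFormRing (Set.range fun j => L.toAlg (φ j)) = ⊤ := by
  have hg0 : (g : ℍ → ℂ) ≠ 0 := by
    intro h0
    apply hJ
    funext τ z
    rw [hg, h0]
    simp
  obtain ⟨r, hr⟩ := exists_mul_eq_one_of_weight_eq_zero L hl hw hg0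
  set S := Algebra.adjoin ModularFormRing (Set.range fun j => L.toAlg (φ j)) with hS
  have hφS : ∀ s, L.toAlg (φ s) ∈ S := fun s => Algebra.subset_adjoin ⟨s, rfl⟩
  have key : ∀ (t : ℕ) (k' : ℤ) (ψ : L.weakJacobi G k' t), L.toAlg ψ ∈ S := by
    intro t
    induction t using Nat.strong_induction_on with
    | _ t ih =>
      intro k' ψ
      rcases Nat.eq_zero_or_pos t with rfl | ht
      · exact toAlg_mem_of_index_eq_zero S ψ
      · obtain ⟨H, hH, hH'⟩ := hF.exists_toAlg_expansion hl φ hm hJ hg ht ψ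
        have h1 : algebraMap ModularFormRing _ g.toRing * L.toAlg ψ ∈ S := by
          rw [hH]
          refine S.sum_mem fun s _ => S.mul_mem (hφS s) ?_
          rcases hH' s with h0 | ⟨k'', t'', η, h0, ht''⟩
          · rw [h0]
            exact S.zero_mem
          · rw [h0]
            have := index_pos_of_jacobian_ne_zero φ hJ s
            exact ih t'' (by omega) k'' η
        have h2 := S.mul_mem (S.algebraMap_mem r) h1
        rwa [← mul_assoc, ← map_mul, hr, map_one, one_mul] at h2
  exact eq_top_of_toAlg_mem fun k' t ψ => key t k' ψ

theorem IsJacobianDivisor.pow_smul_toAlg_mem (hF : IsJacobianDivisor G kHat m₀ F) (hl : 0 < l)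
    (φ : ∀ j, L.weakJacobi G (k j) (m j)) (hm : ∑ j, m j = m₀)
    (hJ : jacobian e m (fun j => (φ j : ℍ → (Fin l → ℂ) → ℂ)) ≠ 0)
    (hg : ∀ τ z, jacobian e m (fun j => (φ j : ℍ → (Fin l → ℂ) → ℂ)) τ z = g τ * F τ z)
    {M : ℕ} (hM : IsLeast (L.missingIndices (Algebra.adjoin ModularFormRing
      (Set.range fun j => L.toAlg (φ j)))) M) (t : ℕ) (k' : ℤ) (ψ : L.weakJacobi G k' t) :
    g.toRing ^ (t + 1 - M) • L.toAlg ψ ∈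
      Algebra.adjoin ModularFormRing (Set.range fun j => L.toAlg (φ j)) := by
  set S := Algebra.adjoin ModularFormRing (Set.range fun j => L.toAlg (φ j)) with hS
  have hφS : ∀ s, L.toAlg (φ s) ∈ S := fun s => Algebra.subset_adjoin ⟨s, rfl⟩
  induction t using Nat.strong_induction_on generalizing k' with
  | _ t ih =>
    rcases lt_or_ge t M with htM | htM
    -- Below M every form lies in S by minimality; the truncated exponent is then zero.
    · refine S.smul_mem ?_ _
      by_contra hψ
      exact absurd (hM.2 ⟨k', ψ, hψ⟩) (by omega)
    · rcases Nat.eq_zero_or_pos t with rfl | ht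
      · exact S.smul_mem (toAlg_mem_of_index_eq_zero S ψ) _
      · obtain ⟨H, hH, hH'⟩ := hF.exists_toAlg_expansion hl φ hm hJ hg ht ψ
        -- One factor g is spent on the expansion of ψ, and t - M factors remain for the
        -- coefficients.
        rw [show t + 1 - M = (t - M) + 1 by omega, pow_succ, mul_smul, Algebra.smul_def g.toRing, hH,
          Algebra.smul_def, Finset.mul_sum]
        refine S.sum_mem fun s _ => ?_
        rw [mul_left_comm, ← Algebra.smul_def]
        refine S.mul_mem (hφS s) ?_
        rcases hH' s with h0 | ⟨k'', t'', η, h0, ht''⟩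
        · rw [h0]
          exact S.smul_mem S.zero_mem _
        · have := index_pos_of_jacobian_ne_zero φ hJ s
          -- Since t'' < t, the remaining factors cover the t'' + 1 - M needed for η, and the
          -- surplus is harmless.
          rw [h0, show t - M = (t - M - (t'' + 1 - M)) + (t'' + 1 - M) by omega, pow_add, mul_smul]
          exact S.smul_mem (ih t'' (by omega) k'' η) _

theorem existsUnique_aeval_eq {x : Fin (l + 1) → L.JacobiAlgebra G}
    (hx : AlgebraicIndependent ModularFormRing x) {a : L.JacobiAlgebra G}
    (ha : a ∈ Algebra.adjoin ModularFormRing (Set.range x)) :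
    ∃! P : MvPolynomial (Fin (l + 1)) ModularFormRing, a = MvPolynomial.aeval x P := by
  rw [Algebra.adjoin_range_eq_range_aeval] at ha
  obtain ⟨P, rfl⟩ := ha
  exact ⟨P, rfl, fun Q hQ => hx hQ.symm⟩

theorem restrict_apply (g : ℍ → ℂ) (a : L.JacobiAlgebra G)
    (p : {p : ℍ × (Fin l → ℂ) // g p.1 ≠ 0}) :
    L.restrict G g a p = toFunHom G a p.1.1 p.1.2 := rfl

theorem restrict_algebraMap_mem_hatRing (g : ℍ → ℂ) (m : Fin (l + 1) → ℕ)
    (φ : Fin (l + 1) → ℍ → (Fin l → ℂ) → ℂ) (r : ModularFormRing) :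
    L.restrict G g (algebraMap ModularFormRing (L.JacobiAlgebra G) r) ∈ L.hatRing G g m φ :=
  ⟨MvPolynomial.C r, MvPolynomial.eval₂_C ..⟩

theorem div_pow_mem_hatRing (g : ℍ → ℂ) (m : Fin (l + 1) → ℕ)
    (φ : Fin (l + 1) → ℍ → (Fin l → ℂ) → ℂ) (j : Fin (l + 1)) :
    (fun p : {p : ℍ × (Fin l → ℂ) // g p.1 ≠ 0} => φ j p.1.1 p.1.2 / g p.1.1 ^ m j) ∈
      L.hatRing G g m φ :=
  ⟨MvPolynomial.X j, MvPolynomial.eval₂_X ..⟩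

/-- Dividing the expansion by g produces φ_s / g = g^(m_s - 1) · φ_s / g^(m_s), which lies in the
larger ring because m_s ≥ 1. -/
theorem IsJacobianDivisor.jacobiRing_le_hatRing (hF : IsJacobianDivisor G kHat m₀ F) (hl : 0 < l)
    (φ : ∀ j, L.weakJacobi G (k j) (m j)) (hm : ∑ j, m j = m₀)
    (hJ : jacobian e m (fun j => (φ j : ℍ → (Fin l → ℂ) → ℂ)) ≠ 0)
    (hg : ∀ τ z, jacobian e m (fun j => (φ j : ℍ → (Fin l → ℂ) → ℂ)) τ z = g τ * F τ z) :
    L.jacobiRing G g ≤ L.hatRing G g m (fun j => (φ j : ℍ → (Fin l → ℂ) → ℂ)) := by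
  set T := L.hatRing G g m (fun j => (φ j : ℍ → (Fin l → ℂ) → ℂ)) with hT
  have key : ∀ (t : ℕ) (k' : ℤ) (ψ : L.weakJacobi G k' t), L.restrict G g (L.toAlg ψ) ∈ T := by
    intro t
    induction t using Nat.strong_induction_on with
    | _ t ih =>
      intro k' ψ
      rcases Nat.eq_zero_or_pos t with rfl | ht
      · obtain ⟨g', hg'⟩ := exists_toAlg_eq_algebraMap ψ
        rw [hg']
        exact restrict_algebraMap_mem_hatRing _ _ _ _
      · obtain ⟨H, hH, hH'⟩ := hF.exists_toAlg_expansion hl φ hm hJ hg ht ψ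
        have h1 : L.restrict G g (L.toAlg ψ) = ∑ s,
            (fun p : {p : ℍ × (Fin l → ℂ) // g p.1 ≠ 0} =>
              (φ s : ℍ → (Fin l → ℂ) → ℂ) p.1.1 p.1.2 / g p.1.1 ^ m s) *
            (L.restrict G g (algebraMap ModularFormRing (L.JacobiAlgebra G) g.toRing) ^ (m s - 1) *
              L.restrict G g (H s)) := by
          funext p
          have h2 := congrArg (fun a => toFunHom G a p.1.1 p.1.2) hH
          simp only [map_mul, map_sum, Finset.sum_apply, Pi.mul_apply, toFunHom_toAlg,
            toFunHom_algebraMap_of] at h2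
          simp only [Finset.sum_apply, Pi.mul_apply, Pi.pow_apply, restrict_apply, toFunHom_toAlg,
            toFunHom_algebraMap_of]
          have hp := p.2
          refine mul_left_cancel₀ hp (h2.trans ?_)
          rw [Finset.mul_sum]
          refine Finset.sum_congr rfl fun s _ => ?_
          rw [← mul_pow_sub_one (index_pos_of_jacobian_ne_zero φ hJ s).ne' (g p.1.1)]
          field_simp
        rw [h1]
        refine T.sum_mem fun s _ => T.mul_mem (div_pow_mem_hatRing _ _ _ s)
          (T.mul_mem (T.pow_mem (restrict_algebraMap_mem_hatRing _ _ _ _) _) ?_)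
        rcases hH' s with h0 | ⟨k'', t'', η, h0, ht''⟩
        · rw [h0, map_zero]
          exact T.zero_mem
        · rw [h0]
          have := index_pos_of_jacobian_ne_zero φ hJ s
          exact ih t'' (by omega) k'' η
  rintro _ ⟨a, rfl⟩
  induction a using DirectSum.induction_on with
  | zero =>
    rw [map_zero]
    exact T.zero_mem
  | of i ψ => exact key i.2 i.1 ψ
  | add a b ha hb =>
    rw [map_add]
    exact T.add_mem ha hb

/-- Holomorphic quotients of Jacobi forms by powers of modular forms are Jacobi forms. -/
theorem isWeakJacobiForm_of_pow_mul_eq (hg0 : (g : ℍ → ℂ) ≠ 0) {k' : ℤ} {t n : ℕ}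
    {φ : ℍ → (Fin l → ℂ) → ℂ} (hφ : L.IsWeakJacobiForm G k' t φ) (a : L.JacobiAlgebra G)
    (ha : ∀ τ z, g τ ≠ 0 → g τ ^ n * toFunHom G a τ z = φ τ z) :
    L.IsWeakJacobiForm G (k' - n * w) t (toFunHom G a) ∧
      ∀ τ z, g τ ^ n * toFunHom G a τ z = φ τ z := by
  have hg : L.IsWeakJacobiForm G w 0 (fun τ _ => g τ) := L.modularForm_mem G g
  have hgn : (fun (τ : ℍ) (_ : Fin l → ℂ) => g τ) ≠ 0 := fun h =>
    hg0 (funext fun τ => congrFun (congrFun h τ) 0)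
  have hc : Continuous fun p : ℍ × (Fin l → ℂ) => g p.1 := hg.isJacobiLike.holo.continuous
  have hmul : ∀ τ z, g τ ^ n * toFunHom G a τ z = φ τ z := by
    have := eq_of_eq_on_ne_zero (a := fun τ z => g τ ^ n * toFunHom G a τ z) (b := φ)
      hg.isJacobiLike.holo hgn ((hc.pow n).mul (isHolo_toFunHom a).continuous)
      hφ.isJacobiLike.holo.continuous ha
    exact fun τ z => congrFun (congrFun this τ) z
  refine ⟨IsJacobiLike.isWeakJacobiForm ?_ (exists_isFourierExpansion_toFunHom a)
    fun σ hσ => toFunHom_act a σ hσ, hmul⟩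
  have hpow : L.IsWeakJacobiForm G (n • ((w, 0) : ℤ × ℕ)).1 (n • ((w, 0) : ℤ × ℕ)).2
      ((fun (τ : ℍ) (_ : Fin l → ℂ) => g τ) ^ n) :=
    SetLike.pow_mem_graded (A := L.jacobiPiece G) n (i := (w, 0)) hg
  have hq := hpow.isJacobiLike.quotient hφ.isJacobiLike (h := toFunHom G a) ?_ (isHolo_toFunHom a)
    fun τ z => by rw [mul_comm]; exact hmul τ z
  · simpa using hq
  · obtain ⟨τ, hτ⟩ := Function.ne_iff.1 hg0
    refine Function.ne_iff.2 ⟨τ, Function.ne_iff.2 ⟨0, ?_⟩⟩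
    exact pow_ne_zero n hτ

/-- Otherwise the φ_j / g^(m_j) extend to Jacobi forms. Their Jacobian is divisible by F, with a
quotient of negative weight, so it vanishes, and with it J. -/
theorem IsJacobianDivisor.not_hatRing_le_jacobiRing (hF : IsJacobianDivisor G kHat m₀ F)
    (hl : 0 < l) (φ : ∀ j, L.weakJacobi G (k j) (m j)) (hm : ∑ j, m j = m₀)
    (hJ : jacobian e m (fun j => (φ j : ℍ → (Fin l → ℂ) → ℂ)) ≠ 0)
    (hg0 : (g : ℍ → ℂ) ≠ 0) (hw : w = l + ∑ j, k j - kHat) (hw0 : 0 < w) :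
    ¬ L.hatRing G g m (fun j => (φ j : ℍ → (Fin l → ℂ) → ℂ)) ≤ L.jacobiRing G g := by
  intro hle
  have hex : ∀ j, ∃ η, L.IsWeakJacobiForm G (k j - m j * w) (m j) η ∧
      ∀ τ z, g τ ^ m j * η τ z = (φ j : ℍ → (Fin l → ℂ) → ℂ) τ z := by
    intro j
    -- The element a need not be homogeneous a priori; agreeing with φ_j / g^(m_j) off the zeros of
    -- g fixes its weight and index.
    obtain ⟨a, ha⟩ := hle (div_pow_mem_hatRing (G := G) g m _ j)
    refine ⟨_, isWeakJacobiForm_of_pow_mul_eq hg0 (φ j).2 a fun τ z hτ => ?_⟩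
    have := congrFun ha ⟨(τ, z), hτ⟩
    rw [restrict_apply] at this
    simp only at this
    rw [this]
    field_simp
  choose η hη hmul using hex
  obtain ⟨g', hg'⟩ := hF.exists_modularForm (e := e) hη hm
  have hneg : (l + ∑ j, (k j - m j * w) - kHat : ℤ) < 0 := by
    -- Each φ_j loses weight m_j w. The result is negative because the m_j are positive and there
    -- are l + 1 ≥ 2 of them.
    have h1 : (l + ∑ j, (k j - m j * w) - kHat : ℤ) = w * (1 - (∑ j, m j : ℕ)) := by
      rw [Finset.sum_sub_distrib, ← Finset.sum_mul, hw]
      push_cast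
      ring
    have h2 : l + 1 ≤ ∑ j, m j := by
      have := Finset.sum_le_sum (s := Finset.univ) (f := fun _ : Fin (l + 1) => 1) (g := m)
        fun j _ => index_pos_of_jacobian_ne_zero φ hJ j
      simpa using this
    rw [h1]
    refine mul_neg_of_pos_of_neg hw0 ?_
    have : (l : ℤ) + 1 ≤ (∑ j, m j : ℕ) := by exact_mod_cast h2
    omega
  have hz := ModularFormClass.levelOne_neg_weight_eq_zero hneg g'
  apply hJ
  funext τ z
  have hd : ∀ j v, lineDeriv ℂ ((φ j : ℍ → (Fin l → ℂ) → ℂ) τ) z v =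
      g τ ^ m j * lineDeriv ℂ (η j τ) z v := by
    intro j v
    have h1 := ((hη j).isJacobiLike.holo.hasDerivAt_line τ z v).const_mul (g τ ^ m j)
    simp only [hmul] at h1
    exact h1.deriv
  have h3 : jacobian e m (fun j => (φ j : ℍ → (Fin l → ℂ) → ℂ)) τ z =
      (∏ j, g τ ^ m j) * (1 : Matrix (Fin l) (Fin l) ℂ).det * jacobian e m η τ z := by
    rw [jacobian, jacobian]
    refine det_affine_transform (c := 0) (fun j => ?_) fun i j => ?_
    · simp only [of_apply, Fin.cases_zero]
      rw [← hmul]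
      ring
    · simp only [of_apply, Fin.cases_succ, hd]
      simp [Matrix.one_apply]
  rw [h3, hg', hz]
  simp

end EvenLattice

end

/-! ### The theorem. -/

theorem proposition2p2 {l : ℕ} (hl : 0 < l) (L : EvenLattice l) (G : Subgroup L.orthogonalGroup)
    (e : Module.Basis (Fin l) ℂ (Fin l → ℂ))
    (k : Fin (l + 1) → ℤ) (m : Fin (l + 1) → ℕ) (φ : ∀ j, L.weakJacobi G (k j) (m j))
    (J : ℍ → (Fin l → ℂ) → ℂ) (hJ : J = EvenLattice.jacobian e m (fun j => (φ j : ℍ → (Fin l → ℂ) → ℂ)))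
    (hJ0 : J ≠ 0)
    (k₀ : ℤ) (hk₀ : k₀ = l + ∑ j, k j) (m₀ : ℕ) (hm₀ : m₀ = ∑ j, m j)
    (kHat : ℤ) (JHat : ℍ → (Fin l → ℂ) → ℂ) (hJHat : L.IsWeakJacobiForm ⊥ kHat m₀ JHat)
    (hdiv : L.VanishesSimplyOnMirrors G JHat)
    (hq0 : ∃ f : ℕ → L.dual → ℂ, L.IsFourierExpansion f JHat ∧ ∃ v, f 0 v ≠ 0) :
    (k₀ = kHat →
      AlgebraicIndependent ModularFormRing (fun j => L.toAlg (φ j)) ∧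
      Algebra.adjoin ModularFormRing (Set.range fun j => L.toAlg (φ j)) = ⊤) ∧
    (kHat < k₀ →
      ∃ g : ModularForm 𝒮ℒ (k₀ - kHat),
        (∀ (τ : ℍ) (z : Fin l → ℂ), J τ z = g τ * JHat τ z) ∧
        (∀ M : ℕ, IsLeast (L.missingIndices (Algebra.adjoin ModularFormRing
            (Set.range fun j => L.toAlg (φ j)))) M →
          ∀ (k' : ℤ) (t : ℕ) (ψ : L.weakJacobi G k' t),
            -- natural subtraction: the exponent is `max (t - M + 1) 0`
            ∃! P : MvPolynomial (Fin (l + 1)) ModularFormRing,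
              DirectSum.of (fun i : ℤ => ModularForm 𝒮ℒ i) (k₀ - kHat) g ^ (t + 1 - M) • L.toAlg ψ
                = MvPolynomial.aeval (fun j => L.toAlg (φ j)) P) ∧
        (L.missingIndices (Algebra.adjoin ModularFormRing
            (Set.range fun j => L.toAlg (φ j))) = ∅ →
          ∀ (k' : ℤ) (t : ℕ) (ψ : L.weakJacobi G k' t),
            ∃! P : MvPolynomial (Fin (l + 1)) ModularFormRing,
              L.toAlg ψ = MvPolynomial.aeval (fun j => L.toAlg (φ j)) P) ∧
        L.jacobiRing G g <
          L.hatRing G g m (fun j => (φ j : ℍ → (Fin l → ℂ) → ℂ))) := by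
  subst hJ hk₀ hm₀
  have hF : EvenLattice.IsJacobianDivisor G kHat _ JHat := ⟨hJHat, hdiv, hq0⟩
  have hind := EvenLattice.algebraicIndependent_of_jacobian_ne_zero hl φ hJ0
  obtain ⟨g, hg⟩ := hF.exists_modularForm (e := e) (fun j => (φ j).2) rfl
  have hg0 : (g : ℍ → ℂ) ≠ 0 := by
    intro h0
    apply hJ0
    funext τ z
    rw [hg, h0]
    simp
  refine ⟨fun hk => ⟨hind, hF.adjoin_eq_top hl φ rfl hJ0 hg (sub_eq_zero.2 hk)⟩,
    fun hk => ⟨g, hg, fun M hM k' t ψ => ?_, fun hM k' t ψ => ?_, ?_⟩⟩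
  · exact EvenLattice.existsUnique_aeval_eq hind
      (hF.pow_smul_toAlg_mem hl φ rfl hJ0 hg hM t k' ψ)
  · refine EvenLattice.existsUnique_aeval_eq hind ?_
    by_contra hψ
    exact (Set.eq_empty_iff_forall_notMem.1 hM) t ⟨k', ψ, hψ⟩
  · exact lt_of_le_not_ge (hF.jacobiRing_le_hatRing hl φ rfl hJ0 hg)
      (hF.not_hatRing_le_jacobiRing hl φ rfl hJ0 hg0 rfl (sub_pos.2 hk))
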